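/- **Setting.** All graphs are finite. A graph $G$ consists of vertices $V_G$, directed edges $E^{\rm dir}_G$, head and tail maps $h_G,t_G$, and an involution $\iota_G$ of $E^{\rm dir}_G$ with $t_G\iota_G=h_G$. Its edges $E_G$ are the $\iota_G$-orbits; a fixed point of $\iota_G$ is a half-loop, and $e\ne\iota_Ge$ with $h_Ge=t_Ge$ is a whole-loop. The degree of a vertex is the number of directed edges with that tail; $G$ is pruned if all degrees are at least $2$; ${\rm ord}(G)=\#E_G-\#V_G$; a cycle is a connected pruned graph of order $0$, and its length is $\#E_G$. The Hashimoto matrix $H_G$, indexed by $E^{\rm dir}_G$, has $(e,e')$ entry $1$ if $h_Ge=t_Ge'$ and $\iota_Ge\neq e'$, and $0$ otherwise; $\mu_1(G)$ is its Perron–Frobenius eigenvalue (spectral radius). A function $f$ is of growth $\rho$ if $|f(k)|=o((\rho+\epsilon)^k)$ for every $\epsilon>0$. Fix a graph $B$. A $B$-graph is a graph $S$ with a graph morphism $\pi:S\to B$; it is étale if $\pi$ is injective on the directed edges with any given tail and on those with any given head. Write $a_S(e)=\#\pi^{-1}(e)$, $b_S(v)=\#\pi^{-1}(v)$. **Models.**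 ${\rm Coord}_n(B)$ is the set of covers $G$ of $B$ with $V_G=V_B\times[n]$, $E^{\rm dir}_G=E^{\rm dir}_B\times[n]$, $t_G(e,i)=(t_Be,i)$, $h_G(e,i)=(h_Be,\sigma(e)i)$, $\iota_G(e,i)=(\iota_Be,\sigma(e)i)$, where $\sigma:E_B^{\rm dir}\to\mathcal S_n$ satisfies $\sigma(\iota_Be)=\sigma(e)^{-1}$. A model over $B$ is a family $\{\mathcal C_n(B)\}_{n\in N}$ of probability spaces, $N$ an infinite set of positive integers, whose atoms lie in ${\rm Coord}_n(B)$. In each of our basic models the $\sigma(e)$, for $e$ in an orientation of $B$, are independent and uniformly distributed, as follows. (i) Permutation model ($B$ without half-loops, all $n\ge1$): $\sigma(e)$ is uniform in $\mathcal S_n$. (ii), (iii) Permutation-involution models of even, resp. odd, degree ($n$ even, resp. odd): the same, except that at each half-loop $\sigma(e)$ is a uniform involution without fixed points, resp. with exactly one fixed point. (iv) Cyclic model ($B$ without half-loops, all $n\ge1$): as (i), except that at each whole-loop $\sigma(e)$ is a uniform $n$-cycle. (v), (vi) Cyclic-involution models of even and odd degree: as (ii), (iii), except that at each whole-loop $\sigma(e)$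 is a uniform $n$-cycle. A $B$-graph $S$ occurs in a model if for all sufficiently large $n\in N$ some atom of $\mathcal C_n(B)$ has a $B$-subgraph isomorphic to $S$. Let $\#([S^{\le}]\cap G)$ be the number of injective $B$-morphisms $S\to G$ (equivalently, the number of ordered $B$-subgraphs of $G$ isomorphic to $S$ with any fixed ordering). **Conditions on a model.** (1) For each $r\ge1$ there is a $g$ of growth $\mu_1(B)$ such that for $n\in N$ and $1\le k\le n/4$ the expected number of strictly non-backtracking closed walks of length $k$ in $G\in\mathcal C_n(B)$ whose visited subgraph has order at least $r$ is at most $g(k)/n^r$. (2) There are real numbers $c_i(S)$, $i\ge0$, such that for each $r\ge1$ there are a $g$ of growth $1$ and a $C>0$ such that for every pruned $B$-graph $S$ with ${\rm ord}(S)<r$: if $S$ occurs, then for all $n\in N$ with $1\le\#E^{\rm dir}_S\le n^{1/2}/C$, $$\Bigl|\mathbb E_{G\in\mathcal C_n(B)}\bigl[\#([S^{\le}]\cap G)\bigr]-\sum_{i<r}c_i(S)n^{-i}\Bigr|\le C\,|g(\#E_S)|\,n^{-r},$$ with $c_i(S)=0$ for $i<{\rm ord}(S)$ and $c_i(S)>0$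 for $i={\rm ord}(S)$; if $S$ does not occur, this expectation is $0$ for all $n\in N$ with $\#E^{\rm dir}_S\le n^{1/2}/C$. (3) $c_0(S)=1$ for every cycle $S$ that occurs. **Strongly algebraic** means: (1)–(3) hold; (4) $S$ occurs iff $S$ is étale and has no half-loops; (5) there are polynomials $p_0=1,p_1,p_2,\dots$ with $c_{{\rm ord}(S)+i}(S)=p_i(\vec a_S,\vec b_S)$ for all pruned étale $S$ that occur and all $i\ge0$. **Algebraic.** For a word $w=e_1\cdots e_k$ over $E_B^{\rm dir}$ let $w^R=\iota_Be_k\cdots\iota_Be_1$. A $B$-wording of a graph $T$ assigns to each $e\in E^{\rm dir}_T$ a word $W(e)$ of positive length, the directed edges of a non-backtracking walk in $B$, such that $W(\iota_Te)=W(e)^R$, $W(e)$ is a single half-loop letter if $e$ is a half-loop, and the tail of the first letter of $W(e)$ depends only on $t_Te$. ${\rm VLG}(T,W)$ is the $B$-graph obtained from $T$ by replacing each edge $e$ by a path lying over the walk $W(e)$. A $B$-type $(T,\mathcal R)$ assigns to each $e\in E^{\rm dir}_T$ a regular language $\mathcal R(e)$ of words of non-backtracking walks of positive length, with $\mathcal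 R(e)^R\subset\mathcal R(\iota_Te)$, such that any $W$ with $W(e)\in\mathcal R(e)$ and $W(\iota_Te)=W(e)^R$ for all $e$ is a $B$-wording; such $W$ are the wordings of that type. A model is algebraic if (1)–(3) hold; the number $h(k)$ of isomorphism classes of étale $B$-graphs that are cycles of length $k$ and do not occur is of growth $\mu_1(B)^{1/2}$; and for each pruned $T$ there are finitely many $B$-types $(T,\mathcal R_1),\dots,(T,\mathcal R_s)$ such that each $B$-wording of $T$ is of exactly one of them and, for each $j$, among the graphs ${\rm VLG}(T,W)$ with $W$ of type $(T,\mathcal R_j)$ either none occurs, or all occur and there are polynomials $p_0,p_1,\dots$ with $c_i(S)=p_i(\vec a_S)$ for all these $S$ and all $i\ge 0$. The eigenvalues of a regular language are the smallest finite set $\Lambda\subset\mathbb C$ such that for all $k\ge1$ the number of its words of length $k$ is $\sum_{\mu\in\Lambda}p_\mu(k)\mu^k$ with polynomials $p_\mu$, where for $\mu=0$ the term stands for any function vanishing for large $k$. A set of eigenvalues of an algebraic model is any set containing the eigenvalues of all languages $\mathcal R_j(e)$ for some choice, for every pruned $T$, of $B$-types as in the definition of algebraic. **Lemma.** Let $B$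 be a graph. Each of the basic models (i)–(vi) over $B$ (with $B$ without half-loops in (i) and (iv)) is algebraic, and has a set of eigenvalues that consists of some of the eigenvalues of $H_B$, possibly $1$, and, if $B$ has half-loops, possibly $0$. Moreover, the permutation model and the permutation-involution model of even degree are strongly algebraic. -/

import Mathlib

open Filter Asymptotics
open scoped Classical

universe u

/-- A finite graph in the sense of Friedman: directed edges `E` with tails, heads and an involution
`inv` exchanging tails and heads.  A fixed point of `inv` is a half-loop. -/
structure FinGraph where
  V : Type u
  E : Type u
  finV : Finite V
  finE : Finite E
  tail : E → V
  head : E → V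
  inv : E → E
  inv_inv : ∀ e, inv (inv e) = e
  tail_inv : ∀ e, tail (inv e) = head e

namespace FinGraph

instance (G : FinGraph.{u}) : Finite G.V := G.finV
instance (G : FinGraph.{u}) : Finite G.E := G.finE
noncomputable instance (G : FinGraph.{u}) : Fintype G.V := Fintype.ofFinite _
noncomputable instance (G : FinGraph.{u}) : Fintype G.E := Fintype.ofFinite _

theorem head_inv (G : FinGraph.{u}) (e : G.E) : G.head (G.inv e) = G.tail e := by
  rw [← G.tail_inv, G.inv_inv]

variable (G : FinGraph.{u})

def IsHalfLoop (e : G.E) : Prop := G.inv e = e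

def IsWholeLoop (e : G.E) : Prop := G.inv e ≠ e ∧ G.head e = G.tail e

def NoHalfLoops : Prop := ∀ e, ¬ G.IsHalfLoop e

/-- Number of directed edges. -/
noncomputable def numDir : ℕ := Nat.card G.E

/-- Number of edges, i.e. of orbits `{e, inv e}` of the involution. -/
noncomputable def numEdges : ℕ := Set.ncard {p : Sym2 G.E | ∃ e, p = s(e, G.inv e)}

/-- The order `#E - #V` (half-loops and whole-loops both count once in `#E`). -/
noncomputable def order : ℤ := (G.numEdges : ℤ) - (Nat.card G.V : ℤ)

/-- A whole-loop contributes two to the degree, a half-loop one. -/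
noncomputable def degree (v : G.V) : ℕ := Nat.card {e : G.E // G.tail e = v}

def Pruned : Prop := ∀ v, 2 ≤ G.degree v

def Connected : Prop :=
  Nonempty G.V ∧
    ∀ v v' : G.V, Relation.ReflTransGen (fun x y => ∃ e, G.tail e = x ∧ G.head e = y) v v'

/-- A cycle (of length `numEdges`): a connected pruned graph of order zero. -/
def IsCycle : Prop := G.Pruned ∧ G.Connected ∧ G.order = 0

/-- `e, e'` are the directed edges of a non-backtracking walk of length two. -/
def NBStep (e e' : G.E) : Prop := G.head e = G.tail e' ∧ G.inv e ≠ e'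

/-- The Hashimoto (non-backtracking) matrix. -/
noncomputable def hashimoto : Matrix G.E G.E ℂ :=
  Matrix.of fun e e' => if G.NBStep e e' then 1 else 0

/-- The Perron-Frobenius eigenvalue of the Hashimoto matrix, i.e. its spectral radius. -/
noncomputable def mu1 : ℝ := (spectralRadius ℂ G.hashimoto).toReal

/-- Strictly non-backtracking closed walks of length `k ≥ 1`, given by their directed edges:
cyclically consecutive edges form non-backtracking walks of length two. -/
def IsSNBC {k : ℕ} (w : Fin k → G.E) : Prop := ∀ i, G.NBStep (w i) (w (finRotate k i))

/-- The visited subgraph of a walk, given by its directed edges. -/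
def visited {k : ℕ} (w : Fin k → G.E) : FinGraph.{u} where
  V := {v : G.V // ∃ i, v = G.tail (w i) ∨ v = G.head (w i)}
  E := {e : G.E // ∃ i, e = w i ∨ e = G.inv (w i)}
  finV := inferInstance
  finE := inferInstance
  tail e := ⟨G.tail e.1, by
    obtain ⟨e, i, rfl | rfl⟩ := e
    · exact ⟨i, Or.inl rfl⟩
    · exact ⟨i, Or.inr (G.tail_inv _)⟩⟩
  head e := ⟨G.head e.1, by
    obtain ⟨e, i, rfl | rfl⟩ := e
    · exact ⟨i, Or.inr rfl⟩
    · exact ⟨i, Or.inl (G.head_inv _)⟩⟩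
  inv e := ⟨G.inv e.1, by
    obtain ⟨e, i, rfl | rfl⟩ := e
    · exact ⟨i, Or.inr rfl⟩
    · exact ⟨i, Or.inl (G.inv_inv _)⟩⟩
  inv_inv e := Subtype.ext (G.inv_inv _)
  tail_inv e := Subtype.ext (G.tail_inv _)

/-- The number of SNBC walks of length `k` whose visited subgraph has order at least `r`. -/
noncomputable def snbcGE (r k : ℕ) : ℕ :=
  Nat.card {w : Fin k → G.E // G.IsSNBC w ∧ (r : ℤ) ≤ (G.visited w).order}

/-- Morphisms of graphs. -/
structure Hom (G H : FinGraph.{u}) where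
  onV : G.V → H.V
  onE : G.E → H.E
  tail_onE : ∀ e, H.tail (onE e) = onV (G.tail e)
  head_onE : ∀ e, H.head (onE e) = onV (G.head e)
  inv_onE : ∀ e, H.inv (onE e) = onE (G.inv e)

end FinGraph

/-- A `B`-graph: a graph with a morphism to `B`. -/
structure BGraph (B : FinGraph.{u}) where
  graph : FinGraph.{u}
  proj : graph.Hom B

namespace BGraph

variable {B : FinGraph.{u}}

def Etale (S : BGraph B) : Prop :=
  (∀ e e', S.graph.tail e = S.graph.tail e' → S.proj.onE e = S.proj.onE e' → e = e') ∧
  (∀ e e', S.graph.head e = S.graph.head e' → S.proj.onE e = S.proj.onE e' → e = e')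

/-- Injective morphisms of `B`-graphs.  For any ordering of `S` these are in bijection with the
ordered `B`-subgraphs of `G` isomorphic to the ordered `B`-graph `S`. -/
structure Embedding (S G : BGraph B) extends S.graph.Hom G.graph where
  injV : Function.Injective onV
  injE : Function.Injective onE
  projV : ∀ v, G.proj.onV (onV v) = S.proj.onV v
  projE : ∀ e, G.proj.onE (onE e) = S.proj.onE e

/-- Isomorphism of `B`-graphs. -/
def Iso (S S' : BGraph B) : Prop :=
  ∃ f : Embedding S S', Function.Surjective f.onV ∧ Function.Surjective f.onE

/-- The fibre counting function of `S` on directed edges of `B`. -/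
noncomputable def fibreE (S : BGraph B) (e : B.E) : ℕ :=
  Nat.card {x : S.graph.E // S.proj.onE x = e}

/-- The fibre counting function of `S` on vertices of `B`. -/
noncomputable def fibreV (S : BGraph B) (v : B.V) : ℕ :=
  Nat.card {x : S.graph.V // S.proj.onV x = v}

end BGraph

/-- Coordinatized covers of `B` of degree `n`, given by their permutation assignments. -/
def Coord (B : FinGraph.{u}) (n : ℕ) : Type u :=
  {σ : B.E → Equiv.Perm (Fin n) // ∀ e, σ (B.inv e) = (σ e)⁻¹}

instance (B : FinGraph.{u}) (n : ℕ) : Finite (Coord B n) :=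
  inferInstanceAs (Finite {σ : B.E → Equiv.Perm (Fin n) // ∀ e, σ (B.inv e) = (σ e)⁻¹})

noncomputable instance (B : FinGraph.{u}) (n : ℕ) : Fintype (Coord B n) := Fintype.ofFinite _

/-- The covering graph of a permutation assignment, with its projection to `B`. -/
def Coord.toBGraph {B : FinGraph.{u}} {n : ℕ} (σ : Coord B n) : BGraph B where
  graph :=
    { V := B.V × Fin n
      E := B.E × Fin n
      finV := inferInstance
      finE := inferInstance
      tail := fun x => (B.tail x.1, x.2)
      head := fun x => (B.head x.1, σ.1 x.1 x.2)
      inv := fun x => (B.inv x.1, σ.1 x.1 x.2)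
      inv_inv := fun x => by
        refine Prod.ext (B.inv_inv _) ?_
        simp [σ.2]
      tail_inv := fun x => Prod.ext (B.tail_inv _) rfl }
  proj :=
    { onV := Prod.fst
      onE := Prod.fst
      tail_onE := fun _ => rfl
      head_onE := fun _ => rfl
      inv_onE := fun _ => rfl }

/-- A model over `B`: for each `n` in an infinite set of positive integers, a probability measure on
the coordinatized covers of degree `n`.  Its atoms are the elements of the support. -/
structure Model (B : FinGraph.{u}) where
  degrees : Set ℕ
  infinite_degrees : degrees.Infinite
  pos_of_mem : ∀ n ∈ degrees, 0 < n
  law : (n : degrees) → PMF (Coord B n)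

/-- `f` is of growth `ρ`. -/
def IsOfGrowth (f : ℕ → ℝ) (ρ : ℝ) : Prop :=
  ∀ ε : ℝ, 0 < ε → f =o[atTop] fun k : ℕ => (ρ + ε) ^ k

namespace Model

variable {B : FinGraph.{u}} (M : Model B)

/-- Expected value of a random variable on the covers of degree `n`. -/
noncomputable def expect (n : M.degrees) (X : Coord B n → ℝ) : ℝ :=
  ∑ σ, (M.law n σ).toReal * X σ

/-- The expected number of ordered `B`-subgraphs isomorphic to `S` (with any fixed ordering). -/
noncomputable def expectCount (S : BGraph B) (n : M.degrees) : ℝ :=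
  M.expect n fun σ => (Nat.card (BGraph.Embedding S σ.toBGraph) : ℝ)

/-- For all large `n` in the index set, `S` is isomorphic to a `B`-subgraph of some atom. -/
def Occurs (S : BGraph B) : Prop :=
  ∃ n₀ : ℕ, ∀ n : M.degrees, n₀ ≤ (n : ℕ) →
    ∃ σ ∈ (M.law n).support, Nonempty (BGraph.Embedding S σ.toBGraph)

/-- The bound on the expected number of SNBC walks of large order. -/
def OrderBound : Prop :=
  ∀ r : ℕ, 1 ≤ r → ∃ g : ℕ → ℝ, IsOfGrowth g B.mu1 ∧
    ∀ (n : M.degrees) (k : ℕ), 1 ≤ k → (k : ℝ) ≤ (n : ℕ) / 4 →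
      M.expect n (fun σ => (σ.toBGraph.graph.snbcGE r k : ℝ)) ≤ g k / ((n : ℕ) : ℝ) ^ r

/-- `c S i` is the coefficient of `1 / n ^ i` in the asymptotic expansion of the expected number of
occurrences of the pruned `B`-graph `S`; the error terms are uniform in `S` and `n`. -/
def HasExpansions (c : BGraph B → ℕ → ℝ) : Prop :=
  ∀ r : ℕ, 1 ≤ r → ∃ (g : ℕ → ℝ) (C : ℝ), IsOfGrowth g 1 ∧ 0 < C ∧
    ∀ S : BGraph B, S.graph.Pruned → S.graph.order < r →
      (M.Occurs S →
        (∀ n : M.degrees, 1 ≤ S.graph.numDir →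
          (S.graph.numDir : ℝ) ≤ Real.sqrt (n : ℕ) / C →
          |M.expectCount S n - ∑ i ∈ Finset.range r, c S i / ((n : ℕ) : ℝ) ^ i|
            ≤ C * |g S.graph.numEdges| / ((n : ℕ) : ℝ) ^ r) ∧
        (∀ i : ℕ, (i : ℤ) < S.graph.order → c S i = 0) ∧
        (∀ i : ℕ, (i : ℤ) = S.graph.order → 0 < c S i)) ∧
      (¬ M.Occurs S →
        ∀ n : M.degrees, (S.graph.numDir : ℝ) ≤ Real.sqrt (n : ℕ) / C → M.expectCount S n = 0)

/-- The leading coefficient is one for cycles that occur. -/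
def CycleCoeff (c : BGraph B → ℕ → ℝ) : Prop :=
  ∀ S : BGraph B, S.graph.IsCycle → M.Occurs S → c S 0 = 1

def IsStronglyAlgebraic : Prop :=
  M.OrderBound ∧
  ∃ c : BGraph B → ℕ → ℝ, M.HasExpansions c ∧ M.CycleCoeff c ∧
    (∀ S : BGraph B, M.Occurs S ↔ S.Etale ∧ S.graph.NoHalfLoops) ∧
    ∃ p : ℕ → MvPolynomial (B.E ⊕ B.V) ℝ, p 0 = 1 ∧
      ∀ S : BGraph B, S.graph.Pruned → S.Etale → M.Occurs S →
        ∀ j i : ℕ, (j : ℤ) = S.graph.order + i →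
          c S j = (p i).eval (Sum.elim (fun e => (S.fibreE e : ℝ)) fun v => (S.fibreV v : ℝ))

end Model

/-- The word of the reverse walk. -/
def revWord (B : FinGraph.{u}) (w : List B.E) : List B.E := (w.map B.inv).reverse

/-- Words (of positive length) of non-backtracking walks. -/
def IsNBWord (B : FinGraph.{u}) (w : List B.E) : Prop := w ≠ [] ∧ w.IsChain B.NBStep

/-- `B`-wordings of a graph `T`.  The last condition says that the vertex of `B` at which the walk
`W e` begins depends only on the tail of `e`. -/
structure IsWording (B T : FinGraph.{u}) (W : T.E → List B.E) : Prop where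
  nb : ∀ e, IsNBWord B (W e)
  rev : ∀ e, W (T.inv e) = revWord B (W e)
  half : ∀ e, T.IsHalfLoop e → ∃ b, B.IsHalfLoop b ∧ W e = [b]
  start : ∃ f : T.V → B.V, ∀ (e : T.E) (b : B.E) (l : List B.E), W e = b :: l → B.tail b = f (T.tail e)

namespace IsWording

variable {B T : FinGraph.{u}} {W : T.E → List B.E}

theorem length_inv (h : IsWording B T W) (e : T.E) : (W (T.inv e)).length = (W e).length := by
  simp [h.rev, revWord]

theorem length_pos (h : IsWording B T W) (e : T.E) : 0 < (W e).length :=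
  List.length_pos_iff.2 (h.nb e).1

/-- Directed edges of the variable-length graph: `(e, i)` is the `i`-th step (counted from zero)
along the path replacing `e`. -/
abbrev Step (W : T.E → List B.E) : Type u := {x : T.E × ℕ // x.2 < (W x.1).length}

instance : Finite (Step W) :=
  Finite.of_injective
    (fun x : Step W => (⟨x.1.1, ⟨x.1.2, x.2⟩⟩ : Σ e : T.E, Fin (W e).length)) <| by
      rintro ⟨⟨e, i⟩, hi⟩ ⟨⟨e', i'⟩, hi'⟩ h
      simp only [Sigma.mk.injEq] at h
      obtain ⟨rfl, h⟩ := h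
      simp only [heq_eq_eq, Fin.mk.injEq] at h
      subst h
      rfl

/-- The same step, traversed backwards. -/
def stepInv (h : IsWording B T W) (x : Step W) : Step W :=
  ⟨(T.inv x.1.1, (W x.1.1).length - 1 - x.1.2), by
    have := h.length_pos x.1.1
    simp only [h.length_inv]
    omega⟩

theorem stepInv_stepInv (h : IsWording B T W) (x : Step W) : h.stepInv (h.stepInv x) = x := by
  have := x.2
  refine Subtype.ext (Prod.ext (T.inv_inv _) ?_)
  simp only [stepInv, h.length_inv]
  omega

/-- The letter of `B` over a step. -/
def letter (W : T.E → List B.E) (x : Step W) : B.E := (W x.1.1).get ⟨x.1.2, x.2⟩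

theorem letter_stepInv (h : IsWording B T W) (x : Step W) :
    letter W (h.stepInv x) = B.inv (letter W x) := by
  obtain ⟨⟨e, i⟩, hi⟩ := x
  simp only at hi
  have key : ∀ (w : List B.E) (hw : w = revWord B (W e)) (hl : (W e).length - 1 - i < w.length),
      w.get ⟨(W e).length - 1 - i, hl⟩ = B.inv ((W e).get ⟨i, hi⟩) := by
    rintro w rfl hl
    simp only [revWord, List.get_eq_getElem, List.getElem_reverse, List.getElem_map,
      List.length_map]
    congr 2
    omega
  exact key _ (h.rev e) _

/-- Positions of intermediate vertices: the tails of the steps `(e, i)` with `0 < i`. -/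
abbrev Pos (W : T.E → List B.E) : Type u := {x : Step W // 0 < x.1.2}

/-- The position `(e, i)` seen from the other end of the path. -/
def posInv (h : IsWording B T W) (x : Pos W) : Pos W :=
  ⟨⟨(T.inv x.1.1.1, (W x.1.1.1).length - x.1.1.2), by
    have h1 := x.2
    have h2 := x.1.2
    simp only [h.length_inv]
    omega⟩, by
    have h2 := x.1.2
    simp only
    omega⟩

/-- The intermediate vertices: `(e, i)` and `(inv e, length - i)` are the same vertex. -/
def Bead (h : IsWording B T W) : Type u := Quot fun x y : Pos W => y = h.posInv x

instance (h : IsWording B T W) : Finite h.Bead :=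
  inferInstanceAs (Finite (Quot fun x y : Pos W => y = h.posInv x))

noncomputable def stepTail (h : IsWording B T W) (x : Step W) : T.V ⊕ h.Bead :=
  if hx : 0 < x.1.2 then Sum.inr (Quot.mk _ ⟨x, hx⟩) else Sum.inl (T.tail x.1.1)

theorem tail_letter_posInv (h : IsWording B T W) (x : Pos W) :
    B.tail (letter W (h.posInv x).1) = B.tail (letter W x.1) := by
  obtain ⟨⟨⟨e, i⟩, hi⟩, h0⟩ := x
  simp only at hi h0
  have hs : (h.posInv ⟨⟨⟨e, i⟩, hi⟩, h0⟩).1 = h.stepInv ⟨⟨e, i - 1⟩, by simp only; omega⟩ := by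
    refine Subtype.ext (Prod.ext rfl ?_)
    simp only [posInv, stepInv]
    omega
  rw [hs, letter_stepInv, B.tail_inv]
  have hc := List.isChain_iff_getElem.1 (h.nb e).2 (i - 1) (by omega)
  have h3 : i - 1 + 1 = i := by omega
  simp only [h3] at hc
  exact hc.1

/-- The vertex of `B` under a vertex of `T`. -/
noncomputable def vertexMap (h : IsWording B T W) : T.V → B.V := Classical.choose h.start

theorem tail_first (h : IsWording B T W) (e : T.E) (h0 : 0 < (W e).length) :
    B.tail (letter W ⟨(e, 0), h0⟩) = h.vertexMap (T.tail e) := by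
  have hs := Classical.choose_spec h.start e
  cases hW : W e with
  | nil => simp [hW] at h0
  | cons b l =>
    rw [vertexMap, ← hs b l hW]
    simp [letter, hW]

noncomputable def projV (h : IsWording B T W) : T.V ⊕ h.Bead → B.V :=
  Sum.elim h.vertexMap
    (Quot.lift (fun x : Pos W => B.tail (letter W x.1)) fun x y hxy => by
      subst hxy
      exact (h.tail_letter_posInv x).symm)

theorem projV_stepTail (h : IsWording B T W) (x : Step W) :
    h.projV (h.stepTail x) = B.tail (letter W x) := by
  unfold stepTail
  split_ifs with hx
  · rfl
  · obtain ⟨⟨e, i⟩, hi⟩ := x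
    simp only at hx hi
    obtain rfl : i = 0 := by omega
    exact (h.tail_first e hi).symm

/-- The variable-length graph `VLG(T, W)` with its `B`-graph structure: each edge of `T` is replaced
by a path over the walk `W e`. -/
noncomputable def vlg (h : IsWording B T W) : BGraph B where
  graph :=
    { V := T.V ⊕ h.Bead
      E := Step W
      finV := inferInstance
      finE := inferInstance
      tail := h.stepTail
      head := fun x => h.stepTail (h.stepInv x)
      inv := h.stepInv
      inv_inv := h.stepInv_stepInv
      tail_inv := fun _ => rfl }
  proj :=
    { onV := h.projV
      onE := letter W
      tail_onE := fun x => (h.projV_stepTail x).symm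
      head_onE := fun x => by
        rw [h.projV_stepTail, letter_stepInv, B.tail_inv]
      inv_onE := fun x => (h.letter_stepInv x).symm }

end IsWording

/-- A `B`-type with underlying graph `T`. -/
structure BType (B T : FinGraph.{u}) where
  lang : T.E → Language B.E
  regular : ∀ e, (lang e).IsRegular
  nb : ∀ e, ∀ w ∈ lang e, IsNBWord B w
  rev : ∀ e, ∀ w ∈ lang e, revWord B w ∈ lang (T.inv e)
  wording : ∀ W : T.E → List B.E, (∀ e, W e ∈ lang e) → (∀ e, W (T.inv e) = revWord B (W e)) →
    IsWording B T W

/-- `f k`, for `k ≥ 1`, is the sum of `p_μ(k) μ ^ k` over `μ ∈ Λ` for some polynomials `p_μ`, where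
the term of `μ = 0` stands for any function that vanishes for large `k`. -/
def HasExponents (f : ℕ → ℂ) (Λ : Finset ℂ) : Prop :=
  ∃ (p : ℂ → Polynomial ℂ) (z : ℕ → ℂ),
    (∀ᶠ k in atTop, z k = 0) ∧ ((0 : ℂ) ∉ Λ → ∀ k, z k = 0) ∧
    ∀ k : ℕ, 1 ≤ k → f k = ∑ μ ∈ Λ.erase 0, (p μ).eval (k : ℂ) * μ ^ k + z k

/-- The number of words of length `k` of a language. -/
noncomputable def wordCount {α : Type u} (L : Language α) (k : ℕ) : ℕ :=
  Set.ncard {w : List α | w ∈ L ∧ w.length = k}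

/-- The eigenvalues of a regular language: the smallest set of exponents of its counting function. -/
def langEigenvalues {α : Type u} (L : Language α) : Set ℂ :=
  {μ | ∀ Λ : Finset ℂ, HasExponents (fun k => (wordCount L k : ℂ)) Λ → μ ∈ Λ}

namespace BType

variable {B T : FinGraph.{u}}

/-- The wording `W` is of the given type. -/
def Contains (R : BType B T) (W : T.E → List B.E) : Prop := ∀ e, W e ∈ R.lang e

/-- The `B`-graphs `VLG(T, W)` with `W` a wording of the given type. -/
def graphs (R : BType B T) : Set (BGraph B) :=
  {S | ∃ (W : T.E → List B.E) (h : IsWording B T W), R.Contains W ∧ S = h.vlg}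

def eigenvalues (R : BType B T) : Set ℂ := ⋃ e, langEigenvalues (R.lang e)

end BType

namespace Model

variable {B : FinGraph.{u}} (M : Model B)

/-- The model (with expansion coefficients `c`) is algebraic restricted to a set of `B`-graphs. -/
def AlgebraicOn (c : BGraph B → ℕ → ℝ) (𝒯 : Set (BGraph B)) : Prop :=
  (∀ S ∈ 𝒯, ¬ M.Occurs S) ∨
  ((∀ S ∈ 𝒯, M.Occurs S) ∧
    ∃ p : ℕ → MvPolynomial B.E ℝ, ∀ S ∈ 𝒯, ∀ i, c S i = (p i).eval fun e => (S.fibreE e : ℝ))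

/-- For each pruned graph `T` there are finitely many `B`-types, with all eigenvalues in `Λ`, such
that every wording of `T` is of exactly one of the types and the model is algebraic restricted to each
of them. -/
def HasTypes (c : BGraph B → ℕ → ℝ) (Λ : Set ℂ) : Prop :=
  ∀ T : FinGraph.{u}, T.Pruned → ∃ (s : ℕ) (R : Fin s → BType B T),
    (∀ W, IsWording B T W → ∃! j, (R j).Contains W) ∧
    ∀ j, M.AlgebraicOn c (R j).graphs ∧ (R j).eigenvalues ⊆ Λ

/-- The number of isomorphism classes of étale `B`-graphs that are cycles of length `k` and do not
occur in the model. -/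
noncomputable def missingCycles (k : ℕ) : ℕ :=
  Set.ncard {q : Quot (BGraph.Iso (B := B)) |
    ∃ S : BGraph B, q = Quot.mk _ S ∧ S.Etale ∧ S.graph.IsCycle ∧ S.graph.numEdges = k ∧
      ¬ M.Occurs S}

def IsAlgebraic : Prop :=
  M.OrderBound ∧ IsOfGrowth (fun k => (M.missingCycles k : ℝ)) (Real.sqrt B.mu1) ∧
  ∃ c : BGraph B → ℕ → ℝ, M.HasExpansions c ∧ M.CycleCoeff c ∧ M.HasTypes c Set.univ

/-- `Λ` is a set of eigenvalues of the (algebraic) model: it contains the eigenvalues of some choice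
of the types in the definition of an algebraic model. -/
def IsEigenvalueSet (Λ : Set ℂ) : Prop :=
  ∃ c : BGraph B → ℕ → ℝ, M.HasExpansions c ∧ M.CycleCoeff c ∧ M.HasTypes c Λ

end Model

/-- The names of the basic models. -/
inductive BasicKind where
  | permutation
  | permInvEven
  | permInvOdd
  | cyclic
  | cycInvEven
  | cycInvOdd

namespace BasicKind

/-- The permutation and the cyclic model are defined only for `B` without half-loops. -/
def Admissible (B : FinGraph.{u}) : BasicKind → Prop
  | permutation => B.NoHalfLoops
  | cyclic => B.NoHalfLoops
  | _ => True

def degrees : BasicKind → Set ℕ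
  | permutation => {n | 0 < n}
  | cyclic => {n | 0 < n}
  | permInvEven => {n | 0 < n ∧ Even n}
  | cycInvEven => {n | 0 < n ∧ Even n}
  | permInvOdd => {n | 0 < n ∧ Odd n}
  | cycInvOdd => {n | 0 < n ∧ Odd n}

/-- `σ` is a perfect matching. -/
def IsPerfectMatching {n : ℕ} (σ : Equiv.Perm (Fin n)) : Prop :=
  (∀ i, σ (σ i) = i) ∧ ∀ i, σ i ≠ i

/-- `σ` is a near perfect matching. -/
def IsNearPerfectMatching {n : ℕ} (σ : Equiv.Perm (Fin n)) : Prop :=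
  (∀ i, σ (σ i) = i) ∧ ∃! i, σ i = i

/-- The values allowed at a half-loop (irrelevant for models over graphs without half-loops). -/
def HalfRule {n : ℕ} (σ : Equiv.Perm (Fin n)) : BasicKind → Prop
  | permutation => True
  | cyclic => True
  | permInvEven => IsPerfectMatching σ
  | cycInvEven => IsPerfectMatching σ
  | permInvOdd => IsNearPerfectMatching σ
  | cycInvOdd => IsNearPerfectMatching σ

/-- The values allowed at a whole-loop: all permutations, or those consisting of a single `n`-cycle. -/
def WholeRule {n : ℕ} (σ : Equiv.Perm (Fin n)) : BasicKind → Prop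
  | cyclic => σ.IsCycleOn Set.univ
  | cycInvEven => σ.IsCycleOn Set.univ
  | cycInvOdd => σ.IsCycleOn Set.univ
  | _ => True

/-- The permutation assignments of positive probability.  At directed edges that are not loops all
permutations are allowed. -/
noncomputable def atoms (κ : BasicKind) (B : FinGraph.{u}) (n : ℕ) : Finset (Coord B n) :=
  Finset.univ.filter fun σ => ∀ e,
    (B.IsHalfLoop e → HalfRule (σ.1 e) κ) ∧ (B.IsWholeLoop e → WholeRule (σ.1 e) κ)

theorem infinite_degrees (κ : BasicKind) : κ.degrees.Infinite := by
  refine Set.infinite_of_forall_exists_gt fun a => ?_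
  cases κ
  · exact ⟨a + 1, Nat.succ_pos _, Nat.lt_succ_self _⟩
  · exact ⟨2 * (a + 1), ⟨by omega, even_two_mul _⟩, by omega⟩
  · exact ⟨2 * a + 1, ⟨by omega, odd_two_mul_add_one _⟩, by omega⟩
  · exact ⟨a + 1, Nat.succ_pos _, Nat.lt_succ_self _⟩
  · exact ⟨2 * (a + 1), ⟨by omega, even_two_mul _⟩, by omega⟩
  · exact ⟨2 * a + 1, ⟨by omega, odd_two_mul_add_one _⟩, by omega⟩

theorem pos_of_mem_degrees (κ : BasicKind) (n : ℕ) (hn : n ∈ κ.degrees) : 0 < n := by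
  cases κ
  · exact hn
  · exact hn.1
  · exact hn.1
  · exact hn
  · exact hn.1
  · exact hn.1

theorem isCycleOn_finRotate (n : ℕ) : (finRotate n).IsCycleOn Set.univ := by
  match n with
  | 0 => exact ⟨by simp, fun x => x.elim0⟩
  | 1 =>
    refine ⟨by simp, fun x _ y _ => ?_⟩
    rw [Subsingleton.elim x y]
  | n + 2 =>
    have h := (isCycle_finRotate (n := n)).isCycleOn
    convert h using 1
    ext x
    simp only [Set.mem_univ, true_iff, Set.mem_ofPred_eq]
    have := (support_finRotate (n := n))
    have hx : x ∈ (finRotate (n + 2)).support := by rw [this]; exact Finset.mem_univ _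
    exact Equiv.Perm.mem_support.1 hx

theorem isPerfectMatching_rev {n : ℕ} (hn : Even n) : IsPerfectMatching (Fin.revPerm (n := n)) := by
  refine ⟨fun i => by simp, fun i h => ?_⟩
  have := congrArg Fin.val h
  simp only [Fin.revPerm_apply, Fin.val_rev] at this
  obtain ⟨m, rfl⟩ := hn
  omega

theorem isNearPerfectMatching_rev {n : ℕ} (hn : Odd n) :
    IsNearPerfectMatching (Fin.revPerm (n := n)) := by
  obtain ⟨m, rfl⟩ := hn
  refine ⟨fun i => by simp, ⟨m, by omega⟩, ?_, fun i h => ?_⟩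
  · ext
    simp only [Fin.revPerm_apply, Fin.val_rev]
    omega
  · have := congrArg Fin.val h
    simp only [Fin.revPerm_apply, Fin.val_rev] at this
    ext
    simp only
    omega

theorem atoms_nonempty (κ : BasicKind) (B : FinGraph.{u}) (n : ℕ) (hn : n ∈ κ.degrees) :
    (κ.atoms B n).Nonempty := by
  let f := Finite.equivFin B.E
  have hrev : (Fin.revPerm (n := n))⁻¹ = Fin.revPerm := by
    ext i
    simp [Equiv.Perm.inv_def]
  let τ : B.E → Equiv.Perm (Fin n) := fun e =>
    if B.inv e = e then Fin.revPerm else if f e < f (B.inv e) then finRotate n else (finRotate n)⁻¹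
  have hτ : ∀ e, τ (B.inv e) = (τ e)⁻¹ := by
    intro e
    by_cases he : B.inv e = e
    · simp [τ, he, hrev]
    · have he' : f (B.inv e) ≠ f e := fun h => he (f.injective h)
      rcases lt_or_gt_of_ne he' with h | h
      · simp [τ, he, Ne.symm he, B.inv_inv, h, h.not_gt]
      · simp [τ, he, Ne.symm he, B.inv_inv, h, h.not_gt]
  refine ⟨⟨τ, hτ⟩, Finset.mem_filter.2 ⟨Finset.mem_univ _, fun e => ⟨fun he => ?_, fun he => ?_⟩⟩⟩
  · have h1 : τ e = Fin.revPerm := by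
      have : B.inv e = e := he
      simp [τ, this]
    simp only [h1]
    cases κ
    · trivial
    · exact isPerfectMatching_rev hn.2
    · exact isNearPerfectMatching_rev hn.2
    · trivial
    · exact isPerfectMatching_rev hn.2
    · exact isNearPerfectMatching_rev hn.2
  · have h1 : (τ e).IsCycleOn Set.univ := by
      have : B.inv e ≠ e := he.1
      simp only [τ, this, if_false]
      split_ifs
      · exact isCycleOn_finRotate n
      · exact (isCycleOn_finRotate n).inv
    cases κ
    · trivial
    · trivial
    · trivial
    · exact h1
    · exact h1
    · exact h1

end BasicKind

/-- The basic models: the covers of degree `n` are uniformly distributed over the permutation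
assignments with allowed values at all directed edges.  The allowed sets at `e` and `inv e` correspond
under inversion, so equivalently the values on any orientation of `B` are independent and each is
uniformly distributed over its allowed set. -/
noncomputable def basicModel (B : FinGraph.{u}) (κ : BasicKind) (_hκ : κ.Admissible B) : Model B where
  degrees := κ.degrees
  infinite_degrees := κ.infinite_degrees
  pos_of_mem := κ.pos_of_mem_degrees
  law n := PMF.uniformOfFinset (κ.atoms B n) (κ.atoms_nonempty B n n.2)

/-! Everything rests on an exact formula for expectations. Constraints `σ e i = j` that are
compatible with the involution can be imposed independently on the orbits of edges
(`covCount_eq_prod`). At one orbit, the probability that `m` consistent constraints hold is the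
reciprocal of `∏ t < m, (n - (α t + β))` (`extCount_allowed`). Here `(α, β)` is `(1, 0)` for uniform
permutations, `(1, 1)` for `n`-cycles, `(2, 1)` for perfect matchings and `(2, 0)` for near perfect
matchings.

An embedding of an étale `S` into a cover is the same as a labeling of its vertices, injective on
each fibre, whose induced constraints all hold (`embeddingEquiv`). The probability of these
constraints does not depend on the labeling. So the expected number of copies of `S` is a product of
falling factorials of `n`, one for each vertex of `B`, divided by the products above
(`expectCount_of_good`). This holds when `S` is `Good`: étale, with at most one (in even degree: no)
half-loop over each half-loop of `B`, and, for cyclic kinds, without a part that runs around a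
whole-loop and closes up, since an `n`-cycle cannot close early. Good graphs are exactly those that
occur (`occurs_iff_good`); for the others the expectation vanishes once `n` exceeds the number of
directed edges.

For pruned `S` the formula is `n ^ (-ord S)` times a power series in `1 / n` with constant term one,
a product of factors `1 - w / n` and `1 / (1 - w / n)`. Its coefficients are polynomial in the
lengths of the products (`exists_polynomial_linBlock`, `exists_polynomial_geomBlock`). The weights
`w` add up to a quantity of order `numDir ^ 2`, so comparison with a geometric series gives errors
that are uniform for `numDir` up to a multiple of `sqrt n` (`GeomBounded.remainder`,
`expansion_remainder`).

For the bound on closed walks of large order, reveal the cover along the walk. The order of the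
visited graph plus one is the number of coincidences, that is, of new edges that end at a known
vertex (`order_visited_lt`). Each coincidence has conditional probability `O(k / n)`, hence `r + 1`
of them and `n` starting labels give `n ^ (-r)`, while the words below the walk are counted by
powers of the Hashimoto matrix (`coinCount_le`, `snbcGE_le`).

A missing étale cycle winds around a whole-loop, and its length and the loop determine it up to
isomorphism, so there are boundedly many of each length (`missingCycles_le`).

For the types, attach to each edge of `T` the first and last letter of its word and whether the word
repeats a single whole-loop. These keys decide whether `VLG(T, W)` is good (`good_vlg_iff`) and make
its vertex counts affine functions of its edge counts (`two_mul_fibreV_vlg`). The words with a given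
key are counted by an entry of a power of the Hashimoto matrix corrected by at most one constant
word, or form a single one-letter word at a half-loop of `T`. This is where the eigenvalues of
`H_B`, `1` and `0` come from (`hasExponents_keyLang`). -/

/-! ### Exponential sums and powers of matrices -/

/-- `f k` is for all `k ≥ 0` a sum of terms `p_μ(k) μ ^ k`, `μ ∈ Λ`. -/
def IsExpSum (Λ : Finset ℂ) (f : ℕ → ℂ) : Prop :=
  ∃ (p : ℂ → Polynomial ℂ) (z : ℕ → ℂ),
    (∀ᶠ k in atTop, z k = 0) ∧ ((0 : ℂ) ∉ Λ → ∀ k, z k = 0) ∧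
    ∀ k : ℕ, f k = ∑ μ ∈ Λ.erase 0, (p μ).eval (k : ℂ) * μ ^ k + z k

namespace IsExpSum

variable {Λ : Finset ℂ} {f g : ℕ → ℂ}

theorem zero : IsExpSum Λ fun _ => 0 := ⟨0, 0, by simp, by simp, by simp⟩

theorem add (hf : IsExpSum Λ f) (hg : IsExpSum Λ g) : IsExpSum Λ fun k => f k + g k := by
  obtain ⟨p, z, h1, h2, h3⟩ := hf
  obtain ⟨p', z', h1', h2', h3'⟩ := hg
  refine ⟨p + p', z + z', ?_, fun h k => by simp [h2 h, h2' h], fun k => ?_⟩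
  · filter_upwards [h1, h1'] with k hk hk'
    simp [hk, hk']
  · simp only [h3, h3', Pi.add_apply, Polynomial.eval_add, add_mul, Finset.sum_add_distrib]
    ring

theorem const_mul (c : ℂ) (hf : IsExpSum Λ f) : IsExpSum Λ fun k => c * f k := by
  obtain ⟨p, z, h1, h2, h3⟩ := hf
  refine ⟨fun μ => Polynomial.C c * p μ, fun k => c * z k, ?_, fun h k => by simp [h2 h], fun k => ?_⟩
  · filter_upwards [h1] with k hk
    simp [hk]
  · simp only [h3, Polynomial.eval_mul, Polynomial.eval_C, mul_assoc, ← Finset.mul_sum]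
    ring

theorem sum {ι : Type*} (s : Finset ι) {F : ι → ℕ → ℂ} (h : ∀ i ∈ s, IsExpSum Λ (F i)) :
    IsExpSum Λ fun k => ∑ i ∈ s, F i k := by
  induction s using Finset.induction_on with
  | empty => simpa using zero
  | insert a s ha ih =>
    simp only [Finset.sum_insert ha]
    exact (h a (by simp)).add (ih fun i hi => h i (by simp [hi]))

theorem single {μ : ℂ} (hμ : μ ∈ Λ) (h0 : μ ≠ 0) (q : Polynomial ℂ) :
    IsExpSum Λ fun k => q.eval (k : ℂ) * μ ^ k := by
  refine ⟨fun ν => if ν = μ then q else 0, 0, by simp, by simp, fun k => ?_⟩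
  rw [Finset.sum_eq_single μ]
  · simp
  · intro b _ hb
    simp [hb]
  · intro h
    exact absurd (Finset.mem_erase.2 ⟨h0, hμ⟩) h

theorem of_eventually_zero (h0 : (0 : ℂ) ∈ Λ) (hf : ∀ᶠ k in atTop, f k = 0) : IsExpSum Λ f :=
  ⟨0, f, hf, fun h => absurd h0 h, by simp⟩

/-- Each monomial in `k` is absorbed by the exponential gap between `‖μ‖` and `ρ + ε`. -/
theorem isLittleO (hf : IsExpSum Λ f) {ρ : ℝ} (hΛ : ∀ μ ∈ Λ, ‖μ‖ ≤ ρ) {ε : ℝ}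
    (hε : 0 < ε) : f =o[atTop] fun k : ℕ => (ρ + ε) ^ k := by
  obtain ⟨p, z, h1, _, h3⟩ := hf
  have hz : (fun k => z k) =o[atTop] fun k : ℕ => (ρ + ε) ^ k := by
    refine (isLittleO_zero (E' := ℂ) (fun k : ℕ => (ρ + ε) ^ k) atTop).congr' ?_ EventuallyEq.rfl
    filter_upwards [h1] with k hk
    exact hk.symm
  have : f = fun k : ℕ => ∑ μ ∈ Λ.erase 0, (p μ).eval (k : ℂ) * μ ^ k + z k := funext h3
  rw [this]
  refine IsLittleO.add (IsLittleO.fun_sum fun μ hμ => ?_) hz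
  have hμ0 := Finset.ne_of_mem_erase hμ
  have hμρ := hΛ μ (Finset.mem_of_mem_erase hμ)
  have hμp : 0 < ‖μ‖ := norm_pos_iff.2 hμ0
  simp only [Polynomial.eval_eq_sum_range, Finset.sum_mul]
  refine IsLittleO.fun_sum fun i _ => ?_
  have hr : 1 < (ρ + ε) / ‖μ‖ := by
    rw [one_lt_div hμp]
    linarith
  have h := (isLittleO_pow_const_const_pow_of_one_lt (R := ℝ) i hr).const_mul_left
    ‖(p μ).coeff i‖
  have h' := h.mul_isBigO (isBigO_refl (fun k : ℕ => ‖μ‖ ^ k) atTop)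
  refine (h'.congr_right (fun k => ?_)).norm_left.congr_left (fun k => ?_) |>.of_norm_left
  · rw [← mul_pow, div_mul_cancel₀ _ hμp.ne']
  · simp

end IsExpSum

/-- The polynomial `k ↦ k.choose j`. -/
noncomputable def choosePoly (j : ℕ) : Polynomial ℂ :=
  Polynomial.C ((j.factorial : ℂ)⁻¹) * descPochhammer ℂ j

theorem choosePoly_eval (j k : ℕ) : (choosePoly j).eval (k : ℂ) = k.choose j := by
  have h : (j.factorial : ℂ) ≠ 0 := by exact_mod_cast j.factorial_ne_zero
  rw [choosePoly, Polynomial.eval_mul, Polynomial.eval_C, descPochhammer_eval_eq_descFactorial,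
    Nat.descFactorial_eq_factorial_mul_choose]
  push_cast
  field_simp

/-- The space is the sum of the generalized eigenspaces. On the one of `μ ≠ 0`, `A` is `μ` plus a
nilpotent map and the binomial theorem gives a polynomial times `μ ^ k`; on the one of `0` the
powers vanish eventually. -/
theorem isExpSum_end {V : Type*} [AddCommGroup V] [Module ℂ V] [FiniteDimensional ℂ V]
    (A : Module.End ℂ V) (φ : V →ₗ[ℂ] ℂ) (Λ : Finset ℂ) (hΛ : ∀ μ, A.HasEigenvalue μ → μ ∈ Λ)
    (v : V) : IsExpSum Λ fun k => φ ((A ^ k) v) := by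
  have hv : v ∈ ⨆ μ, A.maxGenEigenspace μ := by
    rw [Module.End.iSup_maxGenEigenspace_eq_top]
    trivial
  induction hv using Submodule.iSup_induction' with
  | zero => simpa using IsExpSum.zero
  | add x y _ _ hx hy => simpa using hx.add hy
  | mem μ x hx =>
    by_cases hx0 : x = 0
    · subst hx0
      simpa using IsExpSum.zero
    obtain ⟨N, hN⟩ := (Module.End.mem_maxGenEigenspace A μ x).1 hx
    have hμ : μ ∈ Λ := by
      refine hΛ μ ?_
      refine Module.End.hasEigenvalue_of_hasGenEigenvalue (k := N) ?_
      intro h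
      have : x ∈ A.genEigenspace μ N := (Module.End.mem_genEigenspace_nat).2 (by simpa using hN)
      rw [h] at this
      exact hx0 (by simpa using this)
    have hN' : ∀ j, N ≤ j → ((A - μ • (1 : Module.End ℂ V)) ^ j) x = 0 := by
      intro j hj
      obtain ⟨d, rfl⟩ := Nat.exists_eq_add_of_le hj
      rw [add_comm, pow_add, Module.End.mul_apply, hN, map_zero]
    by_cases hμ0 : μ = 0
    · subst hμ0
      refine IsExpSum.of_eventually_zero hμ ?_
      filter_upwards [eventually_ge_atTop N] with k hk
      have := hN' k hk
      simp only [zero_smul, sub_zero] at this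
      rw [this, map_zero]
    · have key : ∀ k : ℕ, φ ((A ^ k) x) = ∑ j ∈ Finset.range N,
          (φ (((A - μ • (1 : Module.End ℂ V)) ^ j) x) * (μ ^ j)⁻¹) *
            ((choosePoly j).eval (k : ℂ) * μ ^ k) := by
        intro k
        have hcomm : Commute (A - μ • (1 : Module.End ℂ V)) (μ • (1 : Module.End ℂ V)) :=
          (Commute.one_right _).smul_right μ
        have hA : A ^ k = ∑ j ∈ Finset.range (k + 1), (A - μ • (1 : Module.End ℂ V)) ^ j *
            (μ • (1 : Module.End ℂ V)) ^ (k - j) * (k.choose j : Module.End ℂ V) := by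
          rw [← hcomm.add_pow, sub_add_cancel]
        have h1 : φ ((A ^ k) x) = ∑ j ∈ Finset.range (k + 1),
            φ (((A - μ • (1 : Module.End ℂ V)) ^ j) x) * μ ^ (k - j) * (k.choose j : ℂ) := by
          rw [hA]
          simp only [LinearMap.sum_apply, map_sum]
          refine Finset.sum_congr rfl fun j _ => ?_
          simp only [smul_pow, one_pow, Module.End.mul_apply, Module.End.natCast_apply, map_nsmul,
            LinearMap.smul_apply, Module.End.one_apply, map_smul, smul_eq_mul, nsmul_eq_mul]
          ring
        rw [h1]
        have h2 : ∀ j, j < N ∨ N ≤ j := fun j => lt_or_ge j N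
        -- Both sums are extended to a common range: binomial coefficients vanish for `j > k`,
        -- nilpotency kills the terms with `j ≥ N`.
        have e1 : ∑ j ∈ Finset.range (k + 1),
            φ (((A - μ • (1 : Module.End ℂ V)) ^ j) x) * μ ^ (k - j) * (k.choose j : ℂ) =
            ∑ j ∈ Finset.range (max (k + 1) N),
            φ (((A - μ • (1 : Module.End ℂ V)) ^ j) x) * μ ^ (k - j) * (k.choose j : ℂ) := by
          refine Finset.sum_subset (Finset.range_mono (le_max_left _ _)) fun j _ hj => ?_
          rw [Nat.choose_eq_zero_of_lt (by simpa using hj)]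
          simp
        have e2 : ∑ j ∈ Finset.range N,
            (φ (((A - μ • (1 : Module.End ℂ V)) ^ j) x) * (μ ^ j)⁻¹) *
              ((choosePoly j).eval (k : ℂ) * μ ^ k) =
            ∑ j ∈ Finset.range (max (k + 1) N),
            (φ (((A - μ • (1 : Module.End ℂ V)) ^ j) x) * (μ ^ j)⁻¹) *
              ((choosePoly j).eval (k : ℂ) * μ ^ k) := by
          refine Finset.sum_subset (Finset.range_mono (le_max_right _ _)) fun j _ hj => ?_
          rw [hN' j (by simpa using hj)]
          simp
        rw [e1, e2]
        refine Finset.sum_congr rfl fun j _ => ?_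
        rw [choosePoly_eval]
        by_cases hj : j ≤ k
        · have : μ ^ k = μ ^ (k - j) * μ ^ j := by rw [← pow_add, Nat.sub_add_cancel hj]
          rw [this]
          have : μ ^ j ≠ 0 := pow_ne_zero _ hμ0
          field_simp
        · rw [Nat.choose_eq_zero_of_lt (by omega)]
          simp
      simp only [key]
      exact IsExpSum.sum _ fun j _ => (IsExpSum.single hμ hμ0 _).const_mul _

theorem isExpSum_matrix_pow {ι : Type*} [Fintype ι] (A : Matrix ι ι ℂ) (Λ : Finset ℂ)
    (hΛ : ∀ μ ∈ spectrum ℂ A, μ ∈ Λ) (i j : ι) : IsExpSum Λ fun k => (A ^ k) i j := by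
  have := isExpSum_end (Matrix.toLin' A) (LinearMap.proj i) Λ (fun μ hμ => hΛ μ ?_) (Pi.single j 1)
  · convert this using 2 with k
    rw [← Matrix.toLin'_pow]
    rw [Matrix.toLin'_apply, LinearMap.proj_apply, Matrix.mulVec_single_one]
    rfl
  · have := hμ.mem_spectrum
    rwa [Matrix.spectrum_toLin'] at this

theorem spectrum_matrix_finite {ι : Type*} [Fintype ι] (A : Matrix ι ι ℂ) :
    (spectrum ℂ A).Finite := by
  have := Module.End.finite_spectrum (Matrix.toLin' A)
  rwa [Matrix.spectrum_toLin'] at this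

/-- Words with `k + 1` letters are counted by the `k`-th power of the matrix. The shift of the index
is absorbed by the polynomials, because the exponents in question are nonzero. -/
theorem IsExpSum.hasExponents {Λ : Finset ℂ} {f g : ℕ → ℂ} (hf : IsExpSum Λ f)
    (hg : ∀ k, g (k + 1) = f k) : HasExponents g Λ := by
  obtain ⟨p, z, h1, h2, h3⟩ := hf
  refine ⟨fun μ => Polynomial.C μ⁻¹ * (p μ).comp (Polynomial.X - 1), fun k => z (k - 1), ?_,
    fun h k => h2 h _, ?_⟩
  · exact (tendsto_sub_atTop_nat 1).eventually h1
  · intro k hk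
    obtain ⟨k, rfl⟩ := Nat.exists_eq_add_of_le' hk
    rw [hg, h3]
    congr 1
    refine Finset.sum_congr rfl fun μ hμ => ?_
    have := Finset.ne_of_mem_erase hμ
    simp only [Polynomial.eval_mul, Polynomial.eval_C, Polynomial.eval_comp, Polynomial.eval_sub,
      Polynomial.eval_X, Polynomial.eval_one, Nat.cast_add, Nat.cast_one, add_sub_cancel_right,
      pow_succ]
    field_simp

/-! ### The spectrum of the Hashimoto matrix and `mu1` -/

namespace FinGraph

variable (B : FinGraph.{u})

noncomputable def spec : Finset ℂ := (spectrum_matrix_finite B.hashimoto).toFinset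

theorem mem_spec {μ : ℂ} : μ ∈ B.spec ↔ μ ∈ spectrum ℂ B.hashimoto := by simp [spec]

theorem mu1_nonneg : 0 ≤ B.mu1 := ENNReal.toReal_nonneg

theorem norm_le_mu1 {μ : ℂ} (hμ : μ ∈ B.spec) : ‖μ‖ ≤ B.mu1 := by
  have h1 : (‖μ‖₊ : ENNReal) ≤ spectralRadius ℂ B.hashimoto :=
    le_iSup₂ (f := fun k (_ : k ∈ spectrum ℂ B.hashimoto) => (‖k‖₊ : ENNReal)) μ (B.mem_spec.1 hμ)
  -- `mu1` is a `toReal`, which would be zero at `⊤`; finiteness of the spectrum excludes this.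
  have h2 : spectralRadius ℂ B.hashimoto ≠ ⊤ := by
    refine ne_top_of_le_ne_top (ENNReal.coe_ne_top (r := ∑ μ ∈ B.spec, ‖μ‖₊)) ?_
    refine iSup₂_le fun k hk => ?_
    exact_mod_cast Finset.single_le_sum (f := fun μ : ℂ => ‖μ‖₊) (fun _ _ => zero_le)
      (B.mem_spec.2 hk)
  have := ENNReal.toReal_mono h2 h1
  simpa [mu1] using this

theorem hashimoto_pow_isLittleO (e e' : B.E) {ε : ℝ} (hε : 0 < ε) :
    (fun k => (B.hashimoto ^ k) e e') =o[atTop] fun k : ℕ => (B.mu1 + ε) ^ k :=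
  (isExpSum_matrix_pow B.hashimoto B.spec (fun _ h => B.mem_spec.2 h) e e').isLittleO
    (fun _ h => B.norm_le_mu1 h) hε

end FinGraph

/-! ### Functions of given growth -/

namespace IsOfGrowth

theorem of_isBigO {f g : ℕ → ℝ} {ρ : ℝ} (hg : IsOfGrowth g ρ) (h : f =O[atTop] g) :
    IsOfGrowth f ρ := fun ε hε => h.trans_isLittleO (hg ε hε)

theorem pow_mul {f : ℕ → ℝ} {ρ : ℝ} (hρ : 0 ≤ ρ) (hf : IsOfGrowth f ρ) (d : ℕ) :
    IsOfGrowth (fun k => (k : ℝ) ^ d * f k) ρ := by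
  intro ε hε
  -- One half of `ε` is spent on the power of `k`, the other on `f`.
  have hr : 1 < (ρ + ε) / (ρ + ε / 2) := by
    rw [one_lt_div (by linarith)]
    linarith
  have h := (isLittleO_pow_const_const_pow_of_one_lt (R := ℝ) d hr).mul (hf (ε / 2) (by linarith))
  refine h.congr_right fun k => ?_
  rw [← mul_pow, div_mul_cancel₀]
  linarith

theorem one : IsOfGrowth (fun _ => 1) 1 := by
  intro ε hε
  have := isLittleO_pow_const_const_pow_of_one_lt (R := ℝ) 0 (show 1 < 1 + ε by linarith)
  simpa using this

theorem pow (d : ℕ) : IsOfGrowth (fun k => (k : ℝ) ^ d) 1 := by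
  simpa using one.pow_mul zero_le_one d

end IsOfGrowth

/-! ### Counting edges and vertices -/

namespace FinGraph

variable (B : FinGraph.{u})

theorem inv_involutive : Function.Involutive B.inv := B.inv_inv

/-- One directed edge from each orbit of the involution. -/
noncomputable def reps : Finset B.E :=
  Finset.univ.filter fun e => Finite.equivFin B.E e ≤ Finite.equivFin B.E (B.inv e)

theorem mem_reps_or (e : B.E) : e ∈ B.reps ∨ B.inv e ∈ B.reps := by
  simp only [reps, Finset.mem_filter, Finset.mem_univ, true_and, B.inv_inv]
  exact le_total _ _

theorem eq_of_mem_reps {e : B.E} (h : e ∈ B.reps) (h' : B.inv e ∈ B.reps) : B.inv e = e := by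
  simp only [reps, Finset.mem_filter, Finset.mem_univ, true_and, B.inv_inv] at h h'
  exact (Finite.equivFin B.E).injective (le_antisymm h' h)

theorem mem_reps_of_halfLoop {e : B.E} (h : B.IsHalfLoop e) : e ∈ B.reps := by
  have h' : B.inv e = e := h
  rcases B.mem_reps_or e with h1 | h1
  · exact h1
  · rwa [h'] at h1

/-- The involution maps the complement of the representatives bijectively onto the representatives
that are not half-loops. -/
theorem sum_reps (g : B.E → ℕ) (hg : ∀ e, g (B.inv e) = g e) :
    ∑ e, g e = ∑ e ∈ B.reps, if B.IsHalfLoop e then g e else 2 * g e := by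
  have h1 : ∑ e, g e = ∑ e ∈ B.reps, g e + ∑ e ∈ B.repsᶜ, g e :=
    (Finset.sum_add_sum_compl _ _).symm
  have h2 : ∑ e ∈ B.repsᶜ, g e = ∑ e ∈ B.reps.filter fun e => ¬ B.IsHalfLoop e, g e := by
    refine Finset.sum_nbij' B.inv B.inv ?_ ?_ ?_ ?_ ?_
    · intro e he
      rw [Finset.mem_compl] at he
      refine Finset.mem_filter.2 ⟨(B.mem_reps_or e).resolve_left he, fun h => ?_⟩
      have h' : B.inv (B.inv e) = B.inv e := h
      rw [B.inv_inv] at h'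
      have := (B.mem_reps_or e).resolve_left he
      rw [← h'] at this
      exact he this
    · intro e he
      rw [Finset.mem_filter] at he
      rw [Finset.mem_compl]
      exact fun h => he.2 (B.eq_of_mem_reps he.1 h)
    · intro e _; exact B.inv_inv e
    · intro e _; exact B.inv_inv e
    · intro e _; exact (hg e).symm
  rw [h1, h2, Finset.sum_filter, ← Finset.sum_add_distrib]
  refine Finset.sum_congr rfl fun e _ => ?_
  by_cases h : B.IsHalfLoop e
  · simp [h]
  · simp [h]; ring

/-- Number of half-loops. -/
noncomputable def numHalf : ℕ := Nat.card {e : B.E // B.inv e = e}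

theorem numEdges_eq_card_reps : B.numEdges = B.reps.card := by
  rw [numEdges, ← Set.ncard_coe_finset]
  symm
  refine Set.ncard_congr (fun e _ => s(e, B.inv e)) ?_ ?_ ?_
  · intro e _; exact ⟨e, rfl⟩
  · intro e e' he he' h
    rw [Sym2.eq_iff] at h
    rcases h with ⟨h, _⟩ | ⟨h, h'⟩
    · exact h
    · have he2 : e' ∈ B.reps := by exact_mod_cast he'
      have he1 : B.inv e' ∈ B.reps := by rw [← h]; exact_mod_cast he
      rw [h, B.eq_of_mem_reps he2 he1]
  · rintro p ⟨e, rfl⟩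
    rcases B.mem_reps_or e with h | h
    · exact ⟨e, by exact_mod_cast h, rfl⟩
    · exact ⟨B.inv e, by exact_mod_cast h, by rw [B.inv_inv, Sym2.eq_swap]⟩

theorem two_mul_numEdges : 2 * B.numEdges = B.numDir + B.numHalf := by
  have h := B.sum_reps (fun _ => 1) fun _ => rfl
  have h1 : B.numDir = ∑ _e : B.E, 1 := by simp [numDir]
  have h2 : B.numHalf = ∑ e ∈ B.reps, if B.IsHalfLoop e then 1 else 0 := by
    rw [numHalf, Nat.card_eq_fintype_card, Fintype.card_subtype, Finset.card_eq_sum_ones,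
      ← Finset.sum_filter]
    refine Finset.sum_congr ?_ fun _ _ => rfl
    ext e
    simp only [Finset.mem_filter, Finset.mem_univ, true_and]
    exact ⟨fun h => ⟨B.mem_reps_of_halfLoop h, h⟩, fun h => h.2⟩
  rw [h1, h, h2, ← Finset.sum_add_distrib, numEdges_eq_card_reps, Finset.card_eq_sum_ones,
    Finset.mul_sum]
  refine Finset.sum_congr rfl fun e _ => ?_
  split_ifs <;> rfl

theorem numDir_le : B.numDir ≤ 2 * B.numEdges := by
  have := B.two_mul_numEdges
  omega

theorem numDir_eq_sum_degree : B.numDir = ∑ v, B.degree v := by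
  rw [numDir, ← Nat.card_congr (Equiv.sigmaFiberEquiv B.tail), Nat.card_sigma]
  rfl

variable {B}

theorem Pruned.two_mul_card_le (h : B.Pruned) : 2 * Nat.card B.V ≤ B.numDir := by
  rw [numDir_eq_sum_degree, Nat.card_eq_fintype_card, Fintype.card, Finset.card_eq_sum_ones,
    Finset.mul_sum]
  exact Finset.sum_le_sum fun v _ => by simpa using h v

/-- Combine `2 #E = numDir + numHalf` with the degree bound `2 #V ≤ numDir`. In particular a pruned
graph of order zero has no half-loops. -/
theorem Pruned.numHalf_le_order (h : B.Pruned) : (B.numHalf : ℤ) ≤ 2 * B.order := by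
  have h1 := B.two_mul_numEdges
  have h2 := h.two_mul_card_le
  rw [order]
  omega

theorem Pruned.order_nonneg (h : B.Pruned) : 0 ≤ B.order := by
  have := h.numHalf_le_order
  omega

theorem IsCycle.noHalfLoops (h : B.IsCycle) : B.NoHalfLoops := by
  intro e he
  have h1 := h.1.numHalf_le_order
  rw [h.2.2] at h1
  have h2 : B.numHalf = 0 := by omega
  have : IsEmpty {e : B.E // B.inv e = e} := by
    rcases Nat.card_eq_zero.1 h2 with h | h
    · exact h
    · exact absurd h (by simp; infer_instance)
  exact this.false ⟨e, he⟩

/-- Order zero makes the sum of the degrees equal to `2 #V`, so no degree can exceed its lower bound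
two. -/
theorem IsCycle.degree_eq (h : B.IsCycle) (v : B.V) : B.degree v = 2 := by
  have h1 := h.1.numHalf_le_order
  rw [h.2.2] at h1
  have h2 := B.two_mul_numEdges
  have h3 := h.2.2
  rw [order] at h3
  have h4 : ∑ v, B.degree v = ∑ _v : B.V, 2 := by
    rw [← numDir_eq_sum_degree]
    simp only [Finset.sum_const, Finset.card_univ, smul_eq_mul, ← Nat.card_eq_fintype_card]
    omega
  exact ((Finset.sum_eq_sum_iff_of_le fun v _ => h.1 v).1 h4.symm v (Finset.mem_univ v)).symm

end FinGraph

/-! ### Fibre counts of a `B`-graph -/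

namespace BGraph

variable {B : FinGraph.{u}} (S : BGraph B)

/-- Number of half-loops over an edge of `B`. -/
noncomputable def fixE (b : B.E) : ℕ :=
  Nat.card {x : S.graph.E // S.proj.onE x = b ∧ S.graph.inv x = x}

/-- Number of edges over the orbit of an edge of `B`. -/
noncomputable def mult (b : B.E) : ℕ :=
  if B.IsHalfLoop b then (S.fibreE b + S.fixE b) / 2 else S.fibreE b

theorem fixE_eq_zero {b : B.E} (hb : ¬ B.IsHalfLoop b) : S.fixE b = 0 := by
  rw [fixE, Nat.card_eq_zero]
  left
  refine ⟨fun x => hb ?_⟩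
  obtain ⟨x, rfl, hx⟩ := x
  have := S.proj.inv_onE x
  rwa [hx] at this

theorem fibreE_inv (b : B.E) : S.fibreE (B.inv b) = S.fibreE b := by
  refine Nat.card_congr ⟨fun x => ⟨S.graph.inv x.1, ?_⟩, fun x => ⟨S.graph.inv x.1, ?_⟩, fun x => ?_,
    fun x => ?_⟩
  · rw [← S.proj.inv_onE, x.2, B.inv_inv]
  · rw [← S.proj.inv_onE, x.2]
  · exact Subtype.ext (S.graph.inv_inv _)
  · exact Subtype.ext (S.graph.inv_inv _)

theorem fixE_inv (b : B.E) : S.fixE (B.inv b) = S.fixE b := by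
  by_cases hb : B.IsHalfLoop b
  · have hb' : B.inv b = b := hb
    rw [hb']
  · rw [S.fixE_eq_zero hb, S.fixE_eq_zero]
    intro h
    have h' : B.inv (B.inv b) = B.inv b := h
    rw [B.inv_inv] at h'
    exact hb h'.symm

theorem numDir_eq_sum : S.graph.numDir = ∑ b, S.fibreE b := by
  rw [FinGraph.numDir, ← Nat.card_congr (Equiv.sigmaFiberEquiv S.proj.onE), Nat.card_sigma]
  rfl

theorem card_V_eq_sum : Nat.card S.graph.V = ∑ v, S.fibreV v := by
  rw [← Nat.card_congr (Equiv.sigmaFiberEquiv S.proj.onV), Nat.card_sigma]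
  rfl

theorem numHalf_eq_sum : S.graph.numHalf = ∑ b, S.fixE b := by
  rw [FinGraph.numHalf, ← Nat.card_congr (Equiv.sigmaFiberEquiv
    fun x : {e : S.graph.E // S.graph.inv e = e} => S.proj.onE x.1), Nat.card_sigma]
  refine Finset.sum_congr rfl fun b _ => Nat.card_congr
    ⟨fun x => ⟨x.1.1, x.2, x.1.2⟩, fun x => ⟨⟨x.1, x.2.2⟩, x.2.1⟩, fun x => rfl, fun x => rfl⟩

/-- The edges over a half-loop, as loops at a single vertex. -/
def fibreGraph {b : B.E} (hb : B.IsHalfLoop b) : FinGraph.{u} where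
  V := PUnit
  E := {x : S.graph.E // S.proj.onE x = b}
  finV := inferInstance
  finE := inferInstance
  tail _ := PUnit.unit
  head _ := PUnit.unit
  inv x := ⟨S.graph.inv x.1, by rw [← S.proj.inv_onE, x.2]; exact hb⟩
  inv_inv x := Subtype.ext (S.graph.inv_inv _)
  tail_inv _ := rfl

/-- The halving in `mult` is exact: the directed edges over a half-loop are closed under the
involution and form a one-vertex graph, to which the count of orbits applies. -/
theorem two_mul_mult {b : B.E} (hb : B.IsHalfLoop b) :
    2 * S.mult b = S.fibreE b + S.fixE b := by
  have h := (S.fibreGraph hb).two_mul_numEdges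
  have h1 : (S.fibreGraph hb).numDir = S.fibreE b := rfl
  have h2 : (S.fibreGraph hb).numHalf = S.fixE b := by
    refine Nat.card_congr ⟨fun x => ⟨x.1.1, x.1.2, congrArg Subtype.val x.2⟩,
      fun x => ⟨⟨x.1, x.2.1⟩, Subtype.ext x.2.2⟩, fun x => rfl, fun x => rfl⟩
  rw [mult, if_pos hb]
  omega

theorem numEdges_eq_sum : S.graph.numEdges = ∑ b ∈ B.reps, S.mult b := by
  have h := S.graph.two_mul_numEdges
  rw [numDir_eq_sum, numHalf_eq_sum, ← Finset.sum_add_distrib,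
    B.sum_reps _ fun b => by rw [fibreE_inv, fixE_inv]] at h
  have : ∑ b ∈ B.reps, (if B.IsHalfLoop b then S.fibreE b + S.fixE b
      else 2 * (S.fibreE b + S.fixE b)) = 2 * ∑ b ∈ B.reps, S.mult b := by
    rw [Finset.mul_sum]
    refine Finset.sum_congr rfl fun b _ => ?_
    split_ifs with hb
    · rw [two_mul_mult S hb]
    · rw [mult, if_neg hb, S.fixE_eq_zero hb, add_zero]
  omega

theorem fibreE_le_numDir (b : B.E) : S.fibreE b ≤ S.graph.numDir :=
  Nat.card_le_card_of_injective _ Subtype.val_injective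

theorem fixE_le_fibreE (b : B.E) : S.fixE b ≤ S.fibreE b :=
  Nat.card_le_card_of_injective
    (fun x : {x : S.graph.E // S.proj.onE x = b ∧ S.graph.inv x = x} =>
      (⟨x.1, x.2.1⟩ : {x : S.graph.E // S.proj.onE x = b}))
    fun _ _ h => Subtype.ext (congrArg (fun z => z.1) h)

theorem mult_le_fibreE (b : B.E) : S.mult b ≤ S.fibreE b := by
  have := S.fixE_le_fibreE b
  rw [mult]
  split_ifs <;> omega

theorem fibreV_le_card (v : B.V) : S.fibreV v ≤ Nat.card S.graph.V :=
  Nat.card_le_card_of_injective _ Subtype.val_injective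

end BGraph

/-! ### Power series with geometrically bounded coefficients -/

/-- The coefficients of `φ` are bounded by those of `1 / (1 - s x)`, and `φ` converges to `f`. -/
structure GeomBounded (φ : PowerSeries ℝ) (s : ℝ) (f : ℝ → ℝ) : Prop where
  nonneg : 0 ≤ s
  bound : ∀ i, |PowerSeries.coeff i φ| ≤ s ^ i
  hasSum : ∀ x, 0 ≤ x → s * x < 1 → HasSum (fun i => PowerSeries.coeff i φ * x ^ i) (f x)

/-- The power series of `1 - w x`. -/
noncomputable def linSeries (w : ℝ) : PowerSeries ℝ := 1 - PowerSeries.C w * PowerSeries.X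

/-- The power series of `1 / (1 - w x)`. -/
noncomputable def geomSeries (w : ℝ) : PowerSeries ℝ := PowerSeries.mk fun i => w ^ i

theorem coeff_linSeries (w : ℝ) (i : ℕ) :
    PowerSeries.coeff i (linSeries w) = if i = 0 then 1 else if i = 1 then -w else 0 := by
  rw [linSeries, map_sub, PowerSeries.coeff_one, PowerSeries.coeff_C_mul, PowerSeries.coeff_X]
  rcases i with _ | _ | i <;> simp

theorem geomSeries_mul_linSeries (w : ℝ) : geomSeries w * linSeries w = 1 := by
  ext i
  rw [linSeries, mul_sub, mul_one, map_sub, mul_left_comm, PowerSeries.coeff_C_mul]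
  rcases i with _ | i
  · simp [geomSeries]
  · rw [PowerSeries.coeff_succ_mul_X]
    simp [geomSeries, PowerSeries.coeff_one, pow_succ]
    ring

namespace GeomBounded

theorem one : GeomBounded 1 0 fun _ => 1 where
  nonneg := le_rfl
  bound i := by
    rw [PowerSeries.coeff_one]
    rcases i with _ | i <;> simp
  hasSum x _ _ := by
    have := hasSum_ite_eq (0 : ℕ) (1 : ℝ)
    refine this.congr_fun ?_
    intro i
    rw [PowerSeries.coeff_one]
    rcases i with _ | i <;> simp

theorem lin {w : ℝ} (hw : 0 ≤ w) : GeomBounded (linSeries w) w fun x => 1 - w * x where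
  nonneg := hw
  bound i := by
    rw [coeff_linSeries]
    rcases i with _ | _ | i <;> simp [abs_of_nonneg, hw]
  hasSum x _ _ := by
    have h : ∀ i ∉ Finset.range 2, PowerSeries.coeff i (linSeries w) * x ^ i = 0 := by
      intro i hi
      rw [coeff_linSeries]
      rcases i with _ | _ | i <;> simp at hi ⊢
    have := hasSum_sum_of_ne_finset_zero (L := SummationFilter.unconditional ℕ) h
    convert this using 1
    simp [Finset.sum_range_succ, coeff_linSeries, sub_eq_add_neg]

theorem geom {w : ℝ} (hw : 0 ≤ w) : GeomBounded (geomSeries w) w fun x => (1 - w * x)⁻¹ where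
  nonneg := hw
  bound i := by simp [geomSeries, abs_of_nonneg, hw]
  hasSum x hx h := by
    have := hasSum_geometric_of_lt_one (mul_nonneg hw hx) h
    simpa [geomSeries, mul_pow] using this

variable {φ ψ : PowerSeries ℝ} {s t : ℝ} {f g : ℝ → ℝ}

theorem summable_norm (h : GeomBounded φ s f) {x : ℝ} (hx : 0 ≤ x) (hs : s * x < 1) :
    Summable fun i => ‖PowerSeries.coeff i φ * x ^ i‖ := by
  refine Summable.of_nonneg_of_le (fun _ => norm_nonneg _) (fun i => ?_)
    (summable_geometric_of_lt_one (mul_nonneg h.nonneg hx) hs)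
  rw [norm_mul, mul_pow, norm_pow, Real.norm_of_nonneg hx]
  exact mul_le_mul_of_nonneg_right (h.bound i) (pow_nonneg hx i)

/-- Radii add because the Cauchy product is bounded by `∑ s ^ i * t ^ j`, which the binomial
expansion of `(s + t) ^ (i + j)` dominates term by term. -/
theorem mul (hf : GeomBounded φ s f) (hg : GeomBounded ψ t g) :
    GeomBounded (φ * ψ) (s + t) fun x => f x * g x where
  nonneg := add_nonneg hf.nonneg hg.nonneg
  bound i := by
    rw [PowerSeries.coeff_mul, (Commute.all s t).add_pow']
    refine (Finset.abs_sum_le_sum_abs _ _).trans (Finset.sum_le_sum fun p hp => ?_)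
    rw [abs_mul, nsmul_eq_mul]
    have h1 := mul_le_mul (hf.bound p.1) (hg.bound p.2) (abs_nonneg _) (pow_nonneg hf.nonneg _)
    have h2 : (1 : ℝ) ≤ (i.choose p.1 : ℕ) := by
      have : p.1 ≤ i := by
        have := Finset.HasAntidiagonal.mem_antidiagonal.1 hp
        omega
      exact_mod_cast Nat.choose_pos this
    have h3 : 0 ≤ s ^ p.1 * t ^ p.2 := mul_nonneg (pow_nonneg hf.nonneg _) (pow_nonneg hg.nonneg _)
    nlinarith
  hasSum x hx h := by
    have hs : s * x < 1 := by nlinarith [mul_nonneg hg.nonneg hx]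
    have ht : t * x < 1 := by nlinarith [mul_nonneg hf.nonneg hx]
    have h1 := tsum_mul_tsum_eq_tsum_sum_antidiagonal_of_summable_norm
      (hf.summable_norm hx hs) (hg.summable_norm hx ht)
    have h2 := summable_norm_sum_mul_antidiagonal_of_summable_norm
      (hf.summable_norm hx hs) (hg.summable_norm hx ht)
    rw [(hf.hasSum x hx hs).tsum_eq, (hg.hasSum x hx ht).tsum_eq] at h1
    rw [h1]
    refine h2.of_norm.hasSum.congr_fun ?_
    intro i
    rw [PowerSeries.coeff_mul, Finset.sum_mul]
    refine Finset.sum_congr rfl fun p hp => ?_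
    rw [← (Finset.HasAntidiagonal.mem_antidiagonal.1 hp), pow_add]
    ring

theorem prod {ι : Type*} (A : Finset ι) {φ : ι → PowerSeries ℝ} {s : ι → ℝ} {f : ι → ℝ → ℝ}
    (h : ∀ i ∈ A, GeomBounded (φ i) (s i) (f i)) :
    GeomBounded (∏ i ∈ A, φ i) (∑ i ∈ A, s i) fun x => ∏ i ∈ A, f i x := by
  induction A using Finset.induction_on with
  | empty => simpa using one
  | insert a A ha ih =>
    simp only [Finset.prod_insert ha, Finset.sum_insert ha]
    exact (h a (by simp)).mul (ih fun i hi => h i (by simp [hi]))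

/-- The tail is dominated by a geometric series with ratio `s * x ≤ 1 / 2`, which accounts for the
factor two. -/
theorem remainder (h : GeomBounded φ s f) {x : ℝ} (hx : 0 ≤ x) (hs : s * x ≤ 1 / 2) (R : ℕ) :
    |f x - ∑ i ∈ Finset.range R, PowerSeries.coeff i φ * x ^ i| ≤ 2 * (s * x) ^ R := by
  have hs1 : s * x < 1 := by linarith
  have h0 := mul_nonneg h.nonneg hx
  have hsum := h.hasSum x hx hs1
  have h1 := (hasSum_nat_add_iff' R).2 hsum
  rw [← h1.tsum_eq]
  have hgeo := (hasSum_geometric_of_lt_one h0 hs1).mul_left ((s * x) ^ R)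
  refine (tsum_of_norm_bounded (f := fun i => PowerSeries.coeff (i + R) φ * x ^ (i + R)) hgeo
    fun i => ?_).trans ?_
  · rw [norm_mul, norm_pow, Real.norm_of_nonneg hx, ← pow_add, mul_pow, add_comm R i]
    exact mul_le_mul_of_nonneg_right (h.bound _) (pow_nonneg hx _)
  · have : (1 - s * x)⁻¹ ≤ 2 := by
      rw [inv_le_comm₀ (by linarith) (by norm_num)]
      linarith
    rw [mul_comm]
    exact mul_le_mul_of_nonneg_right this (pow_nonneg h0 _)

end GeomBounded

/-- The power series of `∏ t < m, (1 - (α t + β) x)`. -/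
noncomputable def linBlock (α β : ℝ) (m : ℕ) : PowerSeries ℝ :=
  ∏ t ∈ Finset.range m, linSeries (α * t + β)

/-- The power series of `∏ t < m, 1 / (1 - (α t + β) x)`. -/
noncomputable def geomBlock (α β : ℝ) (m : ℕ) : PowerSeries ℝ :=
  ∏ t ∈ Finset.range m, geomSeries (α * t + β)

theorem sum_arith_le {α β : ℝ} (hα : 0 ≤ α) (hβ : 0 ≤ β) (m : ℕ) :
    ∑ t ∈ Finset.range m, (α * t + β) ≤ (α + β) * (m : ℝ) ^ 2 := by
  have : ∀ t ∈ Finset.range m, (α * t + β) ≤ (α + β) * m := by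
    intro t ht
    have h1 : (t : ℝ) + 1 ≤ m := by exact_mod_cast Finset.mem_range.1 ht
    have h2 : (0 : ℝ) ≤ t := Nat.cast_nonneg t
    nlinarith [mul_nonneg hα h2, mul_nonneg hβ h2]
  refine (Finset.sum_le_sum this).trans ?_
  simp only [Finset.sum_const, Finset.card_range, nsmul_eq_mul]
  apply le_of_eq
  ring

/-- Faulhaber's formula with Bernoulli numbers, carried from the rationals to the reals. -/
theorem exists_polynomial_sum (q : Polynomial ℝ) :
    ∃ p : Polynomial ℝ, ∀ n : ℕ, p.eval (n : ℝ) = ∑ t ∈ Finset.range n, q.eval (t : ℝ) := by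
  induction q using Polynomial.induction_on' with
  | add q q' h h' =>
    obtain ⟨p, hp⟩ := h
    obtain ⟨p', hp'⟩ := h'
    exact ⟨p + p', fun n => by simp [hp, hp', Finset.sum_add_distrib]⟩
  | monomial d a =>
    let P : Polynomial ℚ := ∑ i ∈ Finset.range (d + 1),
      Polynomial.C (bernoulli i * ((d + 1).choose i : ℚ) / (d + 1)) * Polynomial.X ^ (d + 1 - i)
    have hP : ∀ n : ℕ, P.eval (n : ℚ) = ∑ t ∈ Finset.range n, (t : ℚ) ^ d := by
      intro n
      rw [sum_range_pow]
      simp only [P, Polynomial.eval_finsetSum, Polynomial.eval_mul, Polynomial.eval_C,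
        Polynomial.eval_pow, Polynomial.eval_X]
      refine Finset.sum_congr rfl fun i _ => ?_
      ring
    refine ⟨Polynomial.C a * P.map (algebraMap ℚ ℝ), fun n => ?_⟩
    have h1 : (P.map (algebraMap ℚ ℝ)).eval (n : ℝ) = ((P.eval (n : ℚ) : ℚ) : ℝ) := by
      have := Polynomial.eval_map_algebraMap (B := ℝ) P (n : ℝ)
      rw [this]
      have h2 := Polynomial.aeval_algebraMap_apply ℝ (n : ℚ) P
      simpa using h2
    rw [Polynomial.eval_mul, Polynomial.eval_C, h1, hP]
    simp [Finset.mul_sum]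

theorem linBlock_succ (α β : ℝ) (m : ℕ) :
    linBlock α β (m + 1) = linBlock α β m * linSeries (α * m + β) := Finset.prod_range_succ _ _

theorem coeff_linBlock_succ (α β : ℝ) (m i : ℕ) :
    PowerSeries.coeff (i + 1) (linBlock α β (m + 1)) = PowerSeries.coeff (i + 1) (linBlock α β m) -
      (α * m + β) * PowerSeries.coeff i (linBlock α β m) := by
  rw [linBlock_succ, linSeries, mul_sub, mul_one, map_sub, mul_left_comm, PowerSeries.coeff_C_mul,
    PowerSeries.coeff_succ_mul_X]

theorem geomBlock_succ_mul (α β : ℝ) (m : ℕ) :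
    geomBlock α β (m + 1) * linSeries (α * m + β) = geomBlock α β m := by
  rw [geomBlock, Finset.prod_range_succ, mul_assoc, geomSeries_mul_linSeries, mul_one]
  rfl

theorem coeff_geomBlock_succ (α β : ℝ) (m i : ℕ) :
    PowerSeries.coeff (i + 1) (geomBlock α β (m + 1)) =
      PowerSeries.coeff (i + 1) (geomBlock α β m) +
      (α * m + β) * PowerSeries.coeff i (geomBlock α β (m + 1)) := by
  rw [← geomBlock_succ_mul α β m, linSeries, mul_sub, mul_one, map_sub, mul_left_comm,
    PowerSeries.coeff_C_mul, PowerSeries.coeff_succ_mul_X]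
  ring

theorem coeff_zero_linBlock (α β : ℝ) (m : ℕ) : PowerSeries.coeff 0 (linBlock α β m) = 1 := by
  rw [PowerSeries.coeff_zero_eq_constantCoeff_apply, linBlock, map_prod]
  exact Finset.prod_eq_one fun t _ => by
    rw [← PowerSeries.coeff_zero_eq_constantCoeff_apply, coeff_linSeries]
    simp

theorem coeff_zero_geomBlock (α β : ℝ) (m : ℕ) : PowerSeries.coeff 0 (geomBlock α β m) = 1 := by
  rw [PowerSeries.coeff_zero_eq_constantCoeff_apply, geomBlock, map_prod]
  exact Finset.prod_eq_one fun t _ => by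
    rw [← PowerSeries.coeff_zero_eq_constantCoeff_apply]
    simp [geomSeries]

/-- As a function of `m`, the coefficient of degree `i + 1` has as its difference a linear function
times the coefficient of degree `i`, so it is a discrete antiderivative of a polynomial. -/
theorem exists_polynomial_linBlock (α β : ℝ) (i : ℕ) :
    ∃ p : Polynomial ℝ, ∀ m : ℕ, PowerSeries.coeff i (linBlock α β m) = p.eval (m : ℝ) := by
  induction i with
  | zero => exact ⟨1, fun m => by rw [coeff_zero_linBlock]; simp⟩
  | succ i ih =>
    obtain ⟨p, hp⟩ := ih
    obtain ⟨P, hP⟩ := exists_polynomial_sum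
      (-((Polynomial.C α * Polynomial.X + Polynomial.C β) * p))
    refine ⟨P, fun m => ?_⟩
    rw [hP]
    induction m with
    | zero => simp [linBlock, PowerSeries.coeff_one]
    | succ m ihm =>
      rw [coeff_linBlock_succ, Finset.sum_range_succ, ihm, hp]
      simp
      ring

/-- The same recursion, except that the lower coefficient is taken at `m + 1`, whence the
composition with `X + 1`. -/
theorem exists_polynomial_geomBlock (α β : ℝ) (i : ℕ) :
    ∃ p : Polynomial ℝ, ∀ m : ℕ, PowerSeries.coeff i (geomBlock α β m) = p.eval (m : ℝ) := by
  induction i with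
  | zero => exact ⟨1, fun m => by rw [coeff_zero_geomBlock]; simp⟩
  | succ i ih =>
    obtain ⟨p, hp⟩ := ih
    obtain ⟨P, hP⟩ := exists_polynomial_sum
      ((Polynomial.C α * Polynomial.X + Polynomial.C β) * p.comp (Polynomial.X + 1))
    refine ⟨P, fun m => ?_⟩
    rw [hP]
    induction m with
    | zero => simp [geomBlock, PowerSeries.coeff_one]
    | succ m ihm =>
      rw [coeff_geomBlock_succ, Finset.sum_range_succ, ihm, hp]
      simp

/-! ### Polynomial dependence, expressed as membership in a subalgebra of functions -/

section Subalgebra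

variable {ι κ : Type*} (A : Subalgebra ℝ (ι → ℝ))

theorem Subalgebra.polynomial_comp_mem {g : ι → ℝ} (hg : g ∈ A) (p : Polynomial ℝ) :
    (fun s => p.eval (g s)) ∈ A := by
  have h : Polynomial.aeval g p ∈ A := Polynomial.aeval_mem_adjoin_singleton ℝ g |>
    Algebra.adjoin_le (Set.singleton_subset_iff.2 hg)
  convert h using 1
  ext s
  have := Polynomial.aeval_algHom_apply (Pi.evalAlgHom ℝ (fun _ : ι => ℝ) s) g p
  simp only [Pi.evalAlgHom_apply] at this
  rw [← this, Polynomial.coe_aeval_eq_eval]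

theorem Subalgebra.coeff_mul_mem {φ ψ : ι → PowerSeries ℝ}
    (hφ : ∀ i, (fun s => PowerSeries.coeff i (φ s)) ∈ A)
    (hψ : ∀ i, (fun s => PowerSeries.coeff i (ψ s)) ∈ A) (i : ℕ) :
    (fun s => PowerSeries.coeff i (φ s * ψ s)) ∈ A := by
  simp only [PowerSeries.coeff_mul]
  have : (fun s => ∑ p ∈ Finset.HasAntidiagonal.antidiagonal i,
      PowerSeries.coeff p.1 (φ s) * PowerSeries.coeff p.2 (ψ s)) =
      ∑ p ∈ Finset.HasAntidiagonal.antidiagonal i, (fun s => PowerSeries.coeff p.1 (φ s)) *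
        fun s => PowerSeries.coeff p.2 (ψ s) := by
    ext s
    simp
  rw [this]
  exact A.sum_mem fun p _ => A.mul_mem (hφ _) (hψ _)

theorem Subalgebra.coeff_prod_mem (K : Finset κ) {φ : κ → ι → PowerSeries ℝ}
    (hφ : ∀ k ∈ K, ∀ i, (fun s => PowerSeries.coeff i (φ k s)) ∈ A) (i : ℕ) :
    (fun s => PowerSeries.coeff i (∏ k ∈ K, φ k s)) ∈ A := by
  induction K using Finset.induction_on generalizing i with
  | empty =>
    simp only [Finset.prod_empty]
    exact A.algebraMap_mem (PowerSeries.coeff i (1 : PowerSeries ℝ))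
  | insert a K ha ih =>
    simp only [Finset.prod_insert ha]
    exact A.coeff_mul_mem (hφ a (by simp)) (ih fun k hk => hφ k (by simp [hk])) i

end Subalgebra

/-! ### Permutations extending a partial injection -/

section Extensions

variable {α : Type*} [Fintype α]

/-- The permutations in `A` whose graph contains `F`. -/
noncomputable def extSet (A : Finset (Equiv.Perm α)) (F : Finset (α × α)) :
    Finset (Equiv.Perm α) := A.filter fun σ => ∀ p ∈ F, σ p.1 = p.2

theorem mem_extSet {A : Finset (Equiv.Perm α)} {F : Finset (α × α)} {σ : Equiv.Perm α} :
    σ ∈ extSet A F ↔ σ ∈ A ∧ ∀ p ∈ F, σ p.1 = p.2 := Finset.mem_filter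

/-- The number of permutations in `A` whose graph contains `F`. -/
noncomputable def extCount (A : Finset (Equiv.Perm α)) (F : Finset (α × α)) : ℕ :=
  (extSet A F).card

def IsPartialInj (F : Finset (α × α)) : Prop :=
  ∀ p ∈ F, ∀ q ∈ F, (p.1 = q.1 → p = q) ∧ (p.2 = q.2 → p = q)

/-- A relation that contains a nonempty part in which each pair has a successor. -/
def HasLoopRel (F : Finset (α × α)) : Prop :=
  ∃ Z ⊆ F, Z.Nonempty ∧ ∀ p ∈ Z, ∃ q ∈ Z, q.1 = p.2

theorem IsPartialInj.mono {F F' : Finset (α × α)} (h : IsPartialInj F) (hF : F' ⊆ F) :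
    IsPartialInj F' := fun p hp q hq => h p (hF hp) q (hF hq)

theorem HasLoopRel.mono {F F' : Finset (α × α)} (h : HasLoopRel F') (hF : F' ⊆ F) :
    HasLoopRel F := by
  obtain ⟨Z, hZ, h⟩ := h
  exact ⟨Z, hZ.trans hF, h⟩

theorem extCount_empty (A : Finset (Equiv.Perm α)) : extCount A ∅ = A.card := by
  simp [extCount, extSet]

theorem extCount_eq_sum (A : Finset (Equiv.Perm α)) (F : Finset (α × α)) (i : α) :
    extCount A F = ∑ j, extCount A (insert (i, j) F) := by
  rw [extCount, extSet, Finset.card_eq_sum_card_fiberwise (f := fun σ : Equiv.Perm α => σ i)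
    (t := Finset.univ) (fun _ _ => Finset.mem_coe.2 (Finset.mem_univ _))]
  refine Finset.sum_congr rfl fun j _ => ?_
  rw [extCount, extSet, Finset.filter_filter]
  congr 1
  ext σ
  simp only [Finset.mem_filter, Finset.mem_insert, forall_eq_or_imp]
  tauto

theorem extCount_congr {A A' : Finset (Equiv.Perm α)} {F F' : Finset (α × α)} (e : Equiv.Perm α)
    (h : ∀ σ, (σ ∈ A ∧ ∀ p ∈ F, σ p.1 = p.2) ↔ (σ * e ∈ A' ∧ ∀ p ∈ F', (σ * e) p.1 = p.2)) :
    extCount A F = extCount A' F' := by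
  refine Finset.card_bij (fun σ _ => σ * e) (fun σ hσ => ?_) (fun σ _ τ _ h => mul_right_cancel h)
    fun τ hτ => ⟨τ * e⁻¹, ?_, by simp⟩
  · rw [mem_extSet] at hσ ⊢
    exact (h σ).1 hσ
  · rw [mem_extSet] at hτ ⊢
    exact (h _).2 (by simpa using hτ)

theorem extCount_eq_zero {A : Finset (Equiv.Perm α)} {F : Finset (α × α)}
    (h : ∀ σ ∈ A, ¬ ∀ p ∈ F, σ p.1 = p.2) : extCount A F = 0 := by
  rw [extCount, extSet, Finset.card_eq_zero, Finset.filter_eq_empty_iff]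
  exact fun {σ} hσ => h σ hσ

theorem IsPartialInj.of_ext {F : Finset (α × α)} {σ : Equiv.Perm α}
    (h : ∀ p ∈ F, σ p.1 = p.2) : IsPartialInj F := by
  intro p hp q hq
  refine ⟨fun h1 => Prod.ext h1 ?_, fun h1 => Prod.ext ?_ h1⟩
  · rw [← h p hp, ← h q hq, h1]
  · rw [← h p hp, ← h q hq] at h1
    exact σ.injective h1

/-! #### All permutations -/

/-- Split by the value at `i`. Values already taken are impossible, and composing with a
transposition of two free values shows that all free values contribute equally. -/
theorem extCount_univ_insert {F : Finset (α × α)} (hF : IsPartialInj F) {i j : α}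
    (hi : ∀ p ∈ F, p.1 ≠ i) (hj : ∀ p ∈ F, p.2 ≠ j) :
    extCount Finset.univ F = (Fintype.card α - F.card) * extCount Finset.univ (insert (i, j) F) := by
  rw [extCount_eq_sum _ _ i, ← Finset.sum_add_sum_compl (F.image Prod.snd)]
  have h1 : ∑ k ∈ F.image Prod.snd, extCount Finset.univ (insert (i, k) F) = 0 := by
    refine Finset.sum_eq_zero fun k hk => extCount_eq_zero fun σ _ hσ => ?_
    obtain ⟨p, hp, rfl⟩ := Finset.mem_image.1 hk
    have h2 := hσ (i, p.2) (by simp)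
    have h3 := hσ p (by simp [hp])
    exact hi p hp (σ.injective (h3.trans h2.symm))
  have h2 : ∀ k ∈ (F.image Prod.snd)ᶜ, extCount Finset.univ (insert (i, k) F) =
      extCount Finset.univ (insert (i, j) F) := by
    intro k hk
    have hk' : ∀ p ∈ F, p.2 ≠ k := by
      intro p hp h
      exact Finset.mem_compl.1 hk (Finset.mem_image.2 ⟨p, hp, h⟩)
    refine Finset.card_bij (fun σ _ => Equiv.swap j k * σ) (fun σ hσ => ?_)
      (fun σ _ τ _ h => mul_left_cancel h) fun τ hτ => ⟨Equiv.swap j k * τ, ?_, by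
        rw [← mul_assoc, Equiv.swap_mul_self, one_mul]⟩
    · simp only [mem_extSet, Finset.mem_univ, true_and, Finset.mem_insert,
        forall_eq_or_imp, Equiv.Perm.mul_apply] at hσ ⊢
      refine ⟨by rw [hσ.1, Equiv.swap_apply_right], fun p hp => ?_⟩
      rw [hσ.2 p hp, Equiv.swap_apply_of_ne_of_ne (hj p hp) (hk' p hp)]
    · simp only [mem_extSet, Finset.mem_univ, true_and, Finset.mem_insert,
        forall_eq_or_imp, Equiv.Perm.mul_apply] at hτ ⊢
      refine ⟨by rw [hτ.1, Equiv.swap_apply_left], fun p hp => ?_⟩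
      rw [hτ.2 p hp, Equiv.swap_apply_of_ne_of_ne (hj p hp) (hk' p hp)]
  rw [h1, zero_add, Finset.sum_congr rfl h2, Finset.sum_const, smul_eq_mul, Finset.card_compl,
    Finset.card_image_of_injOn fun p hp q hq h => (hF p hp q hq).2 h]

theorem extCount_univ {F : Finset (α × α)} (hF : IsPartialInj F) :
    (extCount Finset.univ F : ℝ) * ∏ t ∈ Finset.range F.card, ((Fintype.card α : ℝ) - t) =
      extCount (Finset.univ : Finset (Equiv.Perm α)) ∅ := by
  induction F using Finset.induction_on with
  | empty => simp
  | insert p F hp ih =>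
    have hF' := hF.mono (Finset.subset_insert p F)
    have hi : ∀ q ∈ F, q.1 ≠ p.1 := fun q hq h => by
      have := (hF q (by simp [hq]) p (by simp)).1 h
      exact hp (this ▸ hq)
    have hj : ∀ q ∈ F, q.2 ≠ p.2 := fun q hq h => by
      have := (hF q (by simp [hq]) p (by simp)).2 h
      exact hp (this ▸ hq)
    have hle : F.card ≤ Fintype.card α := by
      rw [← Finset.card_image_of_injOn fun p hp q hq h => (hF' p hp q hq).2 h]
      exact Finset.card_le_univ _
    rw [← ih hF', extCount_univ_insert hF' hi hj, Finset.card_insert_of_notMem hp,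
      Finset.prod_range_succ, Nat.cast_mul, Nat.cast_sub hle]
    ring

theorem extCount_of_forall_mem {A : Finset (Equiv.Perm α)} (hA : ∀ σ, σ ∈ A) {F : Finset (α × α)}
    (hF : IsPartialInj F) :
    (extCount A F : ℝ) * ∏ t ∈ Finset.range F.card, ((Fintype.card α : ℝ) - t) = A.card := by
  obtain rfl : A = Finset.univ := Finset.eq_univ_of_forall hA
  rw [extCount_univ hF, extCount_empty]

/-! #### Cycles -/

/-- The permutations that are a cycle on `X` and fix all other points. -/
noncomputable def cyclesOn (X : Finset α) : Finset (Equiv.Perm α) :=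
  Finset.univ.filter fun σ => σ.IsCycleOn (X : Set α) ∧ ∀ x ∉ X, σ x = x

theorem mem_cyclesOn {X : Finset α} {σ : Equiv.Perm α} :
    σ ∈ cyclesOn X ↔ σ.IsCycleOn (X : Set α) ∧ ∀ x ∉ X, σ x = x := by simp [cyclesOn]

/-- If `σ i = j`, then `σ * swap i j` fixes `j` and sends `i` straight to `σ j`: the point `j` is
cut out of its cycle and the remaining points keep their cyclic order. -/
theorem sameCycle_mul_swap {σ : Equiv.Perm α} {i j : α} (hσ : σ i = j)
    (k : ℕ) : ∀ x, x ≠ j → (σ ^ k) x ≠ j → (σ * Equiv.swap i j).SameCycle x ((σ ^ k) x) := by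
  induction k using Nat.strong_induction_on with
  | _ k ih =>
    intro x hx hy
    rcases k with _ | k
    · exact Equiv.Perm.SameCycle.refl _ _
    · by_cases hxi : x = i
      · subst hxi
        rcases k with _ | k
        · simp [hσ] at hy
        · have h1 : (σ ^ (k + 1 + 1)) x = (σ ^ k) ((σ * Equiv.swap x j) x) := by
            simp [pow_succ, hσ]
          rw [h1] at hy ⊢
          have h2 : (σ * Equiv.swap x j) x ≠ j := by
            simp only [Equiv.Perm.mul_apply, Equiv.swap_apply_left]
            intro h
            exact hx (σ.injective (hσ.trans h.symm))
          exact (Equiv.Perm.sameCycle_apply_left).1 (ih k (by omega) _ h2 hy)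
      · have h1 : (σ ^ (k + 1)) x = (σ ^ k) ((σ * Equiv.swap i j) x) := by
          simp [pow_succ, Equiv.swap_apply_of_ne_of_ne hxi hx]
        rw [h1] at hy ⊢
        have h2 : (σ * Equiv.swap i j) x ≠ j := by
          simp only [Equiv.Perm.mul_apply, Equiv.swap_apply_of_ne_of_ne hxi hx]
          intro h
          exact hxi (σ.injective (h.trans hσ.symm))
        exact (Equiv.Perm.sameCycle_apply_left).1 (ih k (by omega) _ h2 hy)

theorem sameCycle_of_mul_swap {σ : Equiv.Perm α} {i j : α} (hσ : σ i = j) {x y : α}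
    (hx : x ≠ j) (h : (σ * Equiv.swap i j).SameCycle x y) : σ.SameCycle x y := by
  obtain ⟨k, -, -, rfl⟩ := h.exists_pow_eq'
  clear h
  induction k generalizing x with
  | zero => exact Equiv.Perm.SameCycle.refl _ _
  | succ k ih =>
    have h1 : ((σ * Equiv.swap i j) ^ (k + 1)) x =
        ((σ * Equiv.swap i j) ^ k) ((σ * Equiv.swap i j) x) := by
      rw [pow_succ, Equiv.Perm.mul_apply]
    rw [h1]
    by_cases hxi : x = i
    · subst hxi
      have h2 : (σ * Equiv.swap x j) x ≠ j := by
        simp only [Equiv.Perm.mul_apply, Equiv.swap_apply_left]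
        intro h
        exact hx (σ.injective (hσ.trans h.symm))
      refine Equiv.Perm.SameCycle.trans ?_ (ih h2)
      have : (σ * Equiv.swap x j) x = σ (σ x) := by simp [hσ]
      rw [this, Equiv.Perm.sameCycle_apply_right, Equiv.Perm.sameCycle_apply_right]
    · have h2 : (σ * Equiv.swap i j) x = σ x := by
        simp [Equiv.swap_apply_of_ne_of_ne hxi hx]
      have h3 : σ x ≠ j := fun h => hxi (σ.injective (h.trans hσ.symm))
      rw [h2]
      exact (Equiv.Perm.sameCycle_apply_left).1 (ih h3)

theorem isCycleOn_of_sameCycle {X : Finset α} {σ : Equiv.Perm α} (hX : ∀ x ∉ X, σ x = x)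
    (h : ∀ x ∈ X, ∀ y ∈ X, σ.SameCycle x y) : σ.IsCycleOn (X : Set α) := by
  have h1 : Set.MapsTo σ X X := by
    intro x hx
    by_contra hσx
    have h2 := σ.injective (hX _ hσx)
    rw [h2] at hσx
    exact hσx hx
  refine ⟨⟨h1, σ.injective.injOn, ?_⟩, fun x hx y hy => h x hx y hy⟩
  exact Finset.surjOn_of_injOn_of_card_le σ h1 σ.injective.injOn le_rfl

/-- Cutting `j` out of the cycle is reversible: this is a bijection from the cycles on `X` with `i ↦
j` to the cycles on `X` without `j`. -/
theorem mem_cyclesOn_erase {X : Finset α} {σ : Equiv.Perm α} {i j : α} (hi : i ∈ X) (hj : j ∈ X)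
    (hij : i ≠ j) :
    (σ ∈ cyclesOn X ∧ σ i = j) ↔ σ * Equiv.swap i j ∈ cyclesOn (X.erase j) := by
  rw [mem_cyclesOn, mem_cyclesOn]
  constructor
  · rintro ⟨⟨h1, h2⟩, h3⟩
    have h4 : ∀ x ∉ X.erase j, (σ * Equiv.swap i j) x = x := by
      intro x hx
      by_cases hxj : x = j
      · subst hxj
        simp [h3]
      · have hxX : x ∉ X := fun h => hx (Finset.mem_erase.2 ⟨hxj, h⟩)
        have hxi : x ≠ i := fun h => hxX (h ▸ hi)
        simp [Equiv.swap_apply_of_ne_of_ne hxi hxj, h2 x hxX]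
    refine ⟨isCycleOn_of_sameCycle h4 fun x hx y hy => ?_, h4⟩
    obtain ⟨k, -, rfl⟩ := (h1.2 (Finset.mem_of_mem_erase hx)
      (Finset.mem_of_mem_erase hy)).exists_pow_eq' |>.imp fun k hk => hk
    exact sameCycle_mul_swap h3 k x (Finset.ne_of_mem_erase hx) (Finset.ne_of_mem_erase hy)
  · rintro ⟨h1, h2⟩
    have h3 : σ i = j := by simpa using h2 j (by simp)
    have h4 : ∀ x ∉ X, σ x = x := by
      intro x hx
      have hxi : x ≠ i := fun h => hx (h ▸ hi)
      have hxj : x ≠ j := fun h => hx (h ▸ hj)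
      simpa [Equiv.swap_apply_of_ne_of_ne hxi hxj] using h2 x fun h => hx (Finset.mem_of_mem_erase h)
    have h5 : ∀ x ∈ X, σ.SameCycle i x := by
      intro x hx
      by_cases hxj : x = j
      · rw [hxj, ← h3]
        exact (Equiv.Perm.sameCycle_apply_right).2 (Equiv.Perm.SameCycle.refl _ _)
      · exact sameCycle_of_mul_swap h3 hij
          (h1.2 (Finset.mem_coe.2 (Finset.mem_erase.2 ⟨hij, hi⟩))
            (Finset.mem_coe.2 (Finset.mem_erase.2 ⟨hxj, hx⟩)))
    exact ⟨⟨isCycleOn_of_sameCycle h4 fun x hx y hy => (h5 x hx).symm.trans (h5 y hy), h4⟩, h3⟩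

/-- The other constraints survive the contraction of `j` because none of them starts at `i` or `j`.
-/
theorem extCount_cyclesOn_insert {X : Finset α} {F : Finset (α × α)} {i j : α} (hi : i ∈ X)
    (hj : j ∈ X) (hij : i ≠ j) (h1 : ∀ p ∈ F, p.1 ≠ i) (h2 : ∀ p ∈ F, p.1 ≠ j) :
    extCount (cyclesOn X) (insert (i, j) F) = extCount (cyclesOn (X.erase j)) F := by
  refine extCount_congr (Equiv.swap i j) fun σ => ?_
  rw [← mem_cyclesOn_erase hi hj hij]
  simp only [Finset.mem_insert, forall_eq_or_imp, and_assoc]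
  refine and_congr_right fun _ => and_congr_right fun _ => forall₂_congr fun p hp => ?_
  rw [Equiv.Perm.mul_apply, Equiv.swap_apply_of_ne_of_ne (h1 p hp) (h2 p hp)]

/-- A partial injection without closed part is a union of paths. Contract their pairs one at a time,
from the end of a path, until no constraint is left on a set with `N + 1 - F.card` points; there are
`(N - F.card)!` cycles on it. -/
theorem extCount_cyclesOn (N : ℕ) : ∀ (X : Finset α) (F : Finset (α × α)), X.card = N + 1 →
    (∀ p ∈ F, p.1 ∈ X ∧ p.2 ∈ X) → IsPartialInj F → ¬ HasLoopRel F →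
    F.card ≤ N ∧ extCount (cyclesOn X) F = (N - F.card).factorial := by
  induction N with
  | zero =>
    intro X F hX hF hinj hloop
    obtain ⟨a, rfl⟩ := Finset.card_eq_one.1 hX
    have hF0 : F = ∅ := by
      by_contra hne
      refine hloop ⟨F, subset_rfl, Finset.nonempty_iff_ne_empty.2 hne, fun p hp => ⟨p, hp, ?_⟩⟩
      rw [Finset.mem_singleton.1 (hF p hp).1, Finset.mem_singleton.1 (hF p hp).2]
    subst hF0
    refine ⟨by simp, ?_⟩
    have : cyclesOn {a} = {(1 : Equiv.Perm α)} := by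
      ext σ
      rw [mem_cyclesOn, Finset.mem_singleton]
      constructor
      · rintro ⟨h1, h2⟩
        ext x
        by_cases hx : x = a
        · subst hx
          have := h1.1.mapsTo (show x ∈ ((({x} : Finset α)) : Set α) by simp)
          simpa using this
        · simpa using h2 x (by simpa using hx)
      · rintro rfl
        simp
    rw [extCount_empty, this]
    simp
  | succ N ih =>
    intro X F hX hF hinj hloop
    by_cases hF0 : F = ∅
    · subst hF0
      refine ⟨by simp, ?_⟩
      have hne : X.Nonempty := Finset.card_pos.1 (by omega)
      obtain ⟨i, hi⟩ := hne
      have hsub : ∀ j ∈ X.erase i, extCount (cyclesOn X) (insert (i, j) ∅) = N.factorial := by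
        intro j hj
        rw [extCount_cyclesOn_insert hi (Finset.mem_of_mem_erase hj) (Finset.ne_of_mem_erase hj).symm
          (by simp) (by simp)]
        have := (ih (X.erase j) ∅ (by rw [Finset.card_erase_of_mem (Finset.mem_of_mem_erase hj)]; omega)
          (by simp) (by simp [IsPartialInj]) ?_).2
        · simpa using this
        · rintro ⟨Z, hZ, hZ', -⟩
          rw [Finset.subset_empty.1 hZ] at hZ'
          simp at hZ'
      rw [extCount_eq_sum _ _ i, ← Finset.sum_subset (Finset.subset_univ (X.erase i))]
      · rw [Finset.sum_congr rfl hsub, Finset.sum_const, Finset.card_erase_of_mem hi, hX]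
        simp [Nat.factorial_succ]
      · intro j _ hj
        refine extCount_eq_zero fun σ hσ h => ?_
        rw [mem_cyclesOn] at hσ
        have hσi : σ i = j := h (i, j) (by simp)
        refine hj (Finset.mem_erase.2 ⟨?_, ?_⟩)
        · rw [← hσi]
          refine hσ.1.apply_ne ?_ (Finset.mem_coe.2 hi)
          exact Finset.one_lt_card_iff_nontrivial.1 (by omega)
        · rw [← hσi]
          exact hσ.1.1.mapsTo (Finset.mem_coe.2 hi)
    -- The last pair of a path; if there were none, `F` itself would be a closed part.
    · have : ∃ p ∈ F, ∀ q ∈ F, q.1 ≠ p.2 := by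
        by_contra hcon
        push Not at hcon
        exact hloop ⟨F, subset_rfl, Finset.nonempty_iff_ne_empty.2 hF0, hcon⟩
      obtain ⟨⟨i, j⟩, hp, hq⟩ := this
      have hij : i ≠ j := fun h => hq (i, j) hp h
      obtain ⟨hi, hj⟩ := hF (i, j) hp
      have hFe : F = insert (i, j) (F.erase (i, j)) := (Finset.insert_erase hp).symm
      have hcard := Finset.card_erase_of_mem hp
      have hpos : 0 < F.card := Finset.card_pos.2 ⟨_, hp⟩
      have h1 : ∀ p ∈ F.erase (i, j), p.1 ≠ i := by
        intro p hp' h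
        exact Finset.ne_of_mem_erase hp' ((hinj p (Finset.mem_of_mem_erase hp') (i, j) hp).1 h)
      have h2 : ∀ p ∈ F.erase (i, j), p.2 ≠ j := by
        intro p hp' h
        exact Finset.ne_of_mem_erase hp' ((hinj p (Finset.mem_of_mem_erase hp') (i, j) hp).2 h)
      have := ih (X.erase j) (F.erase (i, j)) (by rw [Finset.card_erase_of_mem hj]; omega)
        (fun p hp' => ?_) (hinj.mono (Finset.erase_subset _ _))
        (fun h => hloop (h.mono (Finset.erase_subset _ _)))
      · rw [hcard] at this
        refine ⟨by omega, ?_⟩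
        rw [hFe, extCount_cyclesOn_insert hi hj hij h1
          (fun p hp' => hq p (Finset.mem_of_mem_erase hp')), this.2, ← hFe]
        congr 1
        omega
      · have hp'' := Finset.mem_of_mem_erase hp'
        exact ⟨Finset.mem_erase.2 ⟨hq p hp'', (hF p hp'').1⟩,
          Finset.mem_erase.2 ⟨h2 p hp', (hF p hp'').2⟩⟩

end Extensions

section

open scoped Nat

/-! #### Matchings -/

section Matchings

variable {α : Type*} [Fintype α]

/-- The involutions that move exactly the points of `X`. -/
noncomputable def matchingsOn (X : Finset α) : Finset (Equiv.Perm α) :=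
  Finset.univ.filter fun σ => (∀ i, σ (σ i) = i) ∧ ∀ i, σ i ≠ i ↔ i ∈ X

theorem mem_matchingsOn {X : Finset α} {σ : Equiv.Perm α} :
    σ ∈ matchingsOn X ↔ (∀ i, σ (σ i) = i) ∧ ∀ i, σ i ≠ i ↔ i ∈ X := by simp [matchingsOn]

/-- Number of pairs on the diagonal. -/
noncomputable def diagCount (F : Finset (α × α)) : ℕ := (F.filter fun p => p.1 = p.2).card

theorem diagCount_eq_zero {F : Finset (α × α)} : diagCount F = 0 ↔ ∀ p ∈ F, p.1 ≠ p.2 := by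
  rw [diagCount, Finset.card_eq_zero, Finset.filter_eq_empty_iff]

theorem diagCount_le_one {F : Finset (α × α)} :
    diagCount F ≤ 1 ↔ ∀ p ∈ F, ∀ q ∈ F, p.1 = p.2 → q.1 = q.2 → p = q := by
  rw [diagCount, Finset.card_le_one]
  simp only [Finset.mem_filter]
  exact ⟨fun h p hp q hq h1 h2 => h p ⟨hp, h1⟩ q ⟨hq, h2⟩, fun h p hp q hq => h p hp.1 q hq.1 hp.2 hq.2⟩

theorem card_eq_natCard {β γ : Type*} {F : Finset γ} (f : β → γ) (hf : Function.Injective f)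
    (h : ∀ p, p ∈ F ↔ ∃ b, f b = p) : F.card = Nat.card β := by
  rw [← Set.ncard_coe_finset, show (F : Set γ) = Set.range f from Set.ext fun p => h p]
  exact Set.ncard_range_of_injective hf

theorem diagCount_eq_natCard {β : Type*} {F : Finset (α × α)} (f : β → α × α)
    (hf : Function.Injective f) (h : ∀ p, (p ∈ F ∧ p.1 = p.2) ↔ ∃ b, f b = p) :
    diagCount F = Nat.card β :=
  card_eq_natCard f hf fun p => by rw [← h, Finset.mem_filter]

theorem diagCount_mono {F F' : Finset (α × α)} (h : F' ⊆ F) : diagCount F' ≤ diagCount F :=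
  Finset.card_le_card (Finset.filter_subset_filter _ h)

def IsSymmRel (F : Finset (α × α)) : Prop := ∀ p ∈ F, (p.2, p.1) ∈ F

/-- Multiplication by `swap i j` removes the matched pair `{i, j}` and leaves the rest of the
matching alone. -/
theorem mem_matchingsOn_erase {X : Finset α} {σ : Equiv.Perm α} {i j : α} (hi : i ∈ X) (hj : j ∈ X)
    (hij : i ≠ j) :
    (σ ∈ matchingsOn X ∧ σ i = j) ↔ σ * Equiv.swap i j ∈ matchingsOn ((X.erase i).erase j) := by
  have swap_ne : ∀ x, x ≠ i → x ≠ j → (σ * Equiv.swap i j) x = σ x := fun x h1 h2 => by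
    rw [Equiv.Perm.mul_apply, Equiv.swap_apply_of_ne_of_ne h1 h2]
  have swap_i : (σ * Equiv.swap i j) i = σ j := by simp
  have swap_j : (σ * Equiv.swap i j) j = σ i := by simp
  rw [mem_matchingsOn, mem_matchingsOn]
  constructor
  · rintro ⟨⟨h1, h2⟩, h3⟩
    have h4 : σ j = i := by rw [← h3, h1]
    have hne : ∀ x, x ≠ i → x ≠ j → σ x ≠ i ∧ σ x ≠ j := fun x hxi hxj =>
      ⟨fun h => hxj (by rw [← h1 x, h, h3]), fun h => hxi (by rw [← h1 x, h, h4])⟩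
    refine ⟨fun x => ?_, fun x => ?_⟩
    · by_cases hxi : x = i
      · rw [hxi, swap_i, h4, swap_i, h4]
      by_cases hxj : x = j
      · rw [hxj, swap_j, h3, swap_j, h3]
      rw [swap_ne x hxi hxj, swap_ne _ (hne x hxi hxj).1 (hne x hxi hxj).2, h1]
    · by_cases hxi : x = i
      · rw [hxi, swap_i, h4]
        simp
      by_cases hxj : x = j
      · rw [hxj, swap_j, h3]
        simp
      rw [swap_ne x hxi hxj, h2]
      simp [hxi, hxj]
  · rintro ⟨h1, h2⟩
    have h3 : σ i = j := by
      have := (h2 j).not.2 (by simp)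
      rwa [not_not, swap_j] at this
    have h4 : σ j = i := by
      have := (h2 i).not.2 (by simp)
      rwa [not_not, swap_i] at this
    have hne : ∀ x, x ≠ i → x ≠ j → σ x ≠ i ∧ σ x ≠ j := fun x hxi hxj =>
      ⟨fun h => hxj (σ.injective (h.trans h4.symm)), fun h => hxi (σ.injective (h.trans h3.symm))⟩
    refine ⟨⟨fun x => ?_, fun x => ?_⟩, h3⟩
    · by_cases hxi : x = i
      · rw [hxi, h3, h4]
      by_cases hxj : x = j
      · rw [hxj, h4, h3]
      have := h1 x
      rwa [swap_ne x hxi hxj, swap_ne _ (hne x hxi hxj).1 (hne x hxi hxj).2] at this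
    · by_cases hxi : x = i
      · rw [hxi, h3]
        simp [hij.symm, hi]
      by_cases hxj : x = j
      · rw [hxj, h4]
        simp [hij, hj]
      have := h2 x
      rw [swap_ne x hxi hxj] at this
      simpa [hxi, hxj] using this

theorem extCount_matchingsOn_insert {X : Finset α} {F : Finset (α × α)} {i j : α} (hi : i ∈ X)
    (hj : j ∈ X) (hij : i ≠ j) (h1 : ∀ p ∈ F, p.1 ≠ i) (h2 : ∀ p ∈ F, p.1 ≠ j) :
    extCount (matchingsOn X) (insert (i, j) F) =
      extCount (matchingsOn ((X.erase i).erase j)) F := by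
  refine extCount_congr (Equiv.swap i j) fun σ => ?_
  rw [← mem_matchingsOn_erase hi hj hij]
  simp only [Finset.mem_insert, forall_eq_or_imp, and_assoc]
  refine and_congr_right fun _ => and_congr_right fun _ => forall₂_congr fun p hp => ?_
  rw [Equiv.Perm.mul_apply, Equiv.swap_apply_of_ne_of_ne (h1 p hp) (h2 p hp)]

theorem extCount_matchingsOn_insert_symm (X : Finset α) (F : Finset (α × α)) (i j : α) :
    extCount (matchingsOn X) (insert (i, j) (insert (j, i) F)) =
      extCount (matchingsOn X) (insert (i, j) F) := by
  rw [extCount, extCount]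
  congr 1
  ext σ
  simp only [mem_extSet, Finset.mem_insert, forall_eq_or_imp]
  constructor
  · rintro ⟨h1, h2, -, h3⟩
    exact ⟨h1, h2, h3⟩
  · rintro ⟨h1, h2, h3⟩
    exact ⟨h1, h2, by rw [← h2, (mem_matchingsOn.1 h1).1], h3⟩

/-- Remove the prescribed pairs two opposite elements of `F` at a time. Without constraints, a point
has `2 N - 1` possible partners, which is the recursion of the double factorial. -/
theorem extCount_matchingsOn (N : ℕ) : ∀ (X : Finset α) (F : Finset (α × α)), X.card = 2 * N →
    (∀ p ∈ F, p.1 ∈ X ∧ p.2 ∈ X) → IsPartialInj F → IsSymmRel F → diagCount F = 0 →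
    F.card ≤ 2 * N ∧ extCount (matchingsOn X) F = (2 * N - F.card - 1)‼ := by
  induction N with
  | zero =>
    intro X F hX hF hinj hsymm hdiag
    have hX0 : X = ∅ := Finset.card_eq_zero.1 (by simpa using hX)
    subst hX0
    have hF0 : F = ∅ := Finset.eq_empty_of_forall_notMem fun p hp => by simpa using hF p hp
    subst hF0
    refine ⟨by simp, ?_⟩
    have : matchingsOn (∅ : Finset α) = {1} := by
      ext σ
      rw [mem_matchingsOn, Finset.mem_singleton]
      constructor
      · rintro ⟨-, h2⟩
        ext x
        simpa using h2 x
      · rintro rfl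
        simp
    -- For `N = 0` the truncated difference is zero, and `0‼ = 1` counts the identity.
    rw [extCount_empty, this]
    simp
  | succ N ih =>
    intro X F hX hF hinj hsymm hdiag
    have hcardX : ∀ i ∈ X, ∀ j ∈ X, i ≠ j → ((X.erase i).erase j).card = 2 * N := by
      intro i hi j hj hij
      rw [Finset.card_erase_of_mem (Finset.mem_erase.2 ⟨hij.symm, hj⟩), Finset.card_erase_of_mem hi]
      omega
    by_cases hF0 : F = ∅
    · subst hF0
      refine ⟨by simp, ?_⟩
      have hne : X.Nonempty := Finset.card_pos.1 (by omega)
      obtain ⟨i, hi⟩ := hne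
      have hsub : ∀ j ∈ X.erase i, extCount (matchingsOn X) (insert (i, j) ∅) = (2 * N - 1)‼ := by
        intro j hj
        have hj' := Finset.mem_of_mem_erase hj
        have hij := (Finset.ne_of_mem_erase hj).symm
        rw [extCount_matchingsOn_insert hi hj' hij (by simp) (by simp)]
        have := (ih _ ∅ (hcardX i hi j hj' hij) (by simp) (by simp [IsPartialInj])
          (by simp [IsSymmRel]) (by simp [diagCount])).2
        simpa using this
      rw [extCount_eq_sum _ _ i, ← Finset.sum_subset (Finset.subset_univ (X.erase i))]
      · rw [Finset.sum_congr rfl hsub, Finset.sum_const, Finset.card_erase_of_mem hi, hX]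
        rcases N with _ | N
        · simp
        · have e1 : 2 * (N + 1 + 1) - (∅ : Finset (α × α)).card - 1 = 2 * N + 1 + 2 := by
            simp; omega
          have e2 : 2 * (N + 1) - 1 = 2 * N + 1 := by omega
          have e3 : 2 * (N + 1 + 1) - 1 = 2 * N + 3 := by omega
          rw [e1, e2, e3, Nat.doubleFactorial_add_two, smul_eq_mul]
      · intro j _ hj
        refine extCount_eq_zero fun σ hσ h => ?_
        rw [mem_matchingsOn] at hσ
        have hσi : σ i = j := h (i, j) (by simp)
        have h1 : j ≠ i := by
          rw [← hσi]
          exact (hσ.2 i).2 hi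
        refine hj (Finset.mem_erase.2 ⟨h1, (hσ.2 j).1 ?_⟩)
        rw [← hσi, hσ.1]
        rw [hσi]
        exact h1.symm
    · obtain ⟨⟨i, j⟩, hp⟩ := Finset.nonempty_iff_ne_empty.2 hF0
      have hp' := hsymm _ hp
      simp only at hp'
      have hnd : ∀ p ∈ F, p.1 ≠ p.2 := by
        intro p hp h
        exact (Finset.card_eq_zero.1 hdiag ▸ Finset.notMem_empty p) (Finset.mem_filter.2 ⟨hp, h⟩)
      have hij : i ≠ j := hnd _ hp
      obtain ⟨hi, hj⟩ := hF (i, j) hp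
      have hne : ((j, i) : α × α) ≠ (i, j) := fun h => hij (congrArg Prod.snd h)
      have hmem' : (j, i) ∈ F.erase (i, j) := Finset.mem_erase.2 ⟨hne, hp'⟩
      set F' := (F.erase (i, j)).erase (j, i) with hF'
      have hsub : F' ⊆ F := (Finset.erase_subset _ _).trans (Finset.erase_subset _ _)
      have hFe : F = insert (i, j) (insert (j, i) F') := by
        rw [hF', Finset.insert_erase hmem', Finset.insert_erase hp]
      have hcard : F'.card = F.card - 1 - 1 := by
        rw [hF', Finset.card_erase_of_mem hmem', Finset.card_erase_of_mem hp]
      have hpos : 0 < (F.erase (i, j)).card := Finset.card_pos.2 ⟨_, hmem'⟩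
      rw [Finset.card_erase_of_mem hp] at hpos
      have hi' : ∀ p ∈ F', p.1 ≠ i ∧ p.2 ≠ j := by
        intro p hpF'
        have hpF := hsub hpF'
        have hpne : p ≠ (i, j) := by
          have := Finset.mem_of_mem_erase hpF'
          exact Finset.ne_of_mem_erase this
        exact ⟨fun h => hpne ((hinj p hpF _ hp).1 h), fun h => hpne ((hinj p hpF _ hp).2 h)⟩
      have hj' : ∀ p ∈ F', p.1 ≠ j ∧ p.2 ≠ i := by
        intro p hpF'
        have hpF := hsub hpF'
        have hpne : p ≠ (j, i) := Finset.ne_of_mem_erase hpF'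
        exact ⟨fun h => hpne ((hinj p hpF _ hp').1 h), fun h => hpne ((hinj p hpF _ hp').2 h)⟩
      have := ih _ F' (hcardX i hi j hj hij) (fun p hpF' => ?_) (hinj.mono hsub) (fun p hpF' => ?_) ?_
      · refine ⟨by omega, ?_⟩
        rw [hFe, extCount_matchingsOn_insert_symm, extCount_matchingsOn_insert hi hj hij
          (fun p hp => (hi' p hp).1) (fun p hp => (hj' p hp).1), this.2, ← hFe]
        congr 1
        omega
      · have h1 := hF p (hsub hpF')
        have h2 := hi' p hpF'
        have h3 := hj' p hpF'
        simp [h1, h2, h3]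
      · have h1 := hsymm p (hsub hpF')
        have h2 := hi' p hpF'
        have h3 := hj' p hpF'
        refine Finset.mem_erase.2 ⟨fun h => h2.2 (congrArg Prod.fst h),
          Finset.mem_erase.2 ⟨fun h => h3.2 (congrArg Prod.fst h), h1⟩⟩
      · rw [diagCount, Finset.card_eq_zero, Finset.filter_eq_empty_iff]
        exact fun {p} hp => hnd p (hsub hp)

/-- The involutions with exactly one fixed point. -/
noncomputable def nearMatchings : Finset (Equiv.Perm α) :=
  Finset.univ.filter fun σ => (∀ i, σ (σ i) = i) ∧ ∃! i, σ i = i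

theorem extCount_nearMatchings_eq_sum (F : Finset (α × α)) :
    extCount (nearMatchings (α := α)) F = ∑ i, extCount (matchingsOn (Finset.univ.erase i)) F := by
  rw [extCount, extSet]
  have : (nearMatchings (α := α)).filter (fun σ => ∀ p ∈ F, σ p.1 = p.2) =
      Finset.univ.biUnion fun i : α =>
        (matchingsOn (Finset.univ.erase i)).filter fun σ => ∀ p ∈ F, σ p.1 = p.2 := by
    ext σ
    simp only [nearMatchings, Finset.mem_filter, Finset.mem_univ, true_and, Finset.mem_biUnion,
      mem_matchingsOn, Finset.mem_erase, and_true]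
    constructor
    · rintro ⟨⟨h1, i, hi, hi'⟩, h2⟩
      exact ⟨i, ⟨h1, fun j => not_congr ⟨fun h => hi' j h, fun h => by rw [h]; exact hi⟩⟩, h2⟩
    · rintro ⟨i, ⟨h1, h2⟩, h3⟩
      refine ⟨⟨h1, i, ?_, fun j hj => ?_⟩, h3⟩
      · have := (h2 i).not.2 (by simp)
        exact not_not.1 this
      · by_contra hji
        exact (h2 j).2 hji hj
  rw [this, Finset.card_biUnion]
  · rfl
  · intro i _ j _ hij
    rw [Function.onFun, Finset.disjoint_left]
    intro σ h1 h2
    have h1 := (mem_matchingsOn.1 (Finset.mem_filter.1 h1).1).2 i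
    have h2 := (mem_matchingsOn.1 (Finset.mem_filter.1 h2).1).2 i
    simp [hij] at h1 h2
    exact h2 h1

/-- Sum over the fixed point. A diagonal pair of `F` determines it; otherwise it is any of the `2 N
+ 1 - F.card` points not used by `F`, and this number is the next factor of the double factorial of
the remaining matching. -/
theorem extCount_nearMatchings {N : ℕ} (hN : Fintype.card α = 2 * N + 1) {F : Finset (α × α)}
    (hinj : IsPartialInj F) (hsymm : IsSymmRel F) (hdiag : diagCount F ≤ 1) :
    F.card ≤ 2 * N + 1 ∧
      extCount (nearMatchings (α := α)) F = (2 * N + 1 - (F.card + diagCount F))‼ := by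
  have hcardF : F.card ≤ 2 * N + 1 := by
    rw [← Finset.card_image_of_injOn fun p hp q hq h => (hinj p hp q hq).2 h, ← hN]
    exact Finset.card_le_univ _
  refine ⟨hcardF, ?_⟩
  have hcard : ∀ i : α, (Finset.univ.erase i).card = 2 * N := fun i => by
    rw [Finset.card_erase_of_mem (Finset.mem_univ i), Finset.card_univ, hN]
    omega
  rw [extCount_nearMatchings_eq_sum]
  rcases Nat.lt_or_ge 0 (diagCount F) with hd | hd
  · obtain ⟨⟨i, i'⟩, hp⟩ := Finset.card_pos.1 hd
    obtain ⟨hp, hii⟩ := Finset.mem_filter.1 hp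
    simp only at hii
    subst hii
    rw [Finset.sum_eq_single i]
    · have h0 : ∀ p ∈ F.erase (i, i), p.1 ≠ i ∧ p.2 ≠ i := fun p hp' => by
        have h1 := Finset.mem_of_mem_erase hp'
        exact ⟨fun h => Finset.ne_of_mem_erase hp' ((hinj p h1 _ hp).1 h),
          fun h => Finset.ne_of_mem_erase hp' ((hinj p h1 _ hp).2 h)⟩
      have h1 : extCount (matchingsOn (Finset.univ.erase i)) F =
          extCount (matchingsOn (Finset.univ.erase i)) (F.erase (i, i)) := by
        rw [extCount, extCount]
        congr 1
        ext σ
        simp only [mem_extSet]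
        refine and_congr_right fun hσ => ⟨fun h p hp' => h p (Finset.mem_of_mem_erase hp'),
          fun h p hp' => ?_⟩
        by_cases hpi : p = (i, i)
        · subst hpi
          have := ((mem_matchingsOn.1 hσ).2 i).not.2 (by simp)
          exact not_not.1 this
        · exact h p (Finset.mem_erase.2 ⟨hpi, hp'⟩)
      have h2 := extCount_matchingsOn N (Finset.univ.erase i) (F.erase (i, i)) (hcard i)
        (fun p hp' => by simp [h0 p hp']) (hinj.mono (Finset.erase_subset _ _)) (fun p hp' => ?_) ?_
      · rw [h1, h2.2, Finset.card_erase_of_mem hp]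
        congr 1
        have : 0 < F.card := Finset.card_pos.2 ⟨_, hp⟩
        omega
      · refine Finset.mem_erase.2 ⟨fun h => (h0 p hp').1 (congrArg Prod.snd h),
          hsymm p (Finset.mem_of_mem_erase hp')⟩
      · rw [diagCount, Finset.card_eq_zero, Finset.filter_eq_empty_iff]
        intro p hp' hpd
        have := Finset.card_le_one.1 hdiag p
          (Finset.mem_filter.2 ⟨Finset.mem_of_mem_erase hp', hpd⟩) (i, i)
          (Finset.mem_filter.2 ⟨hp, rfl⟩)
        exact Finset.ne_of_mem_erase hp' this
    · intro j _ hj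
      refine extCount_eq_zero fun σ hσ h => ?_
      exact ((mem_matchingsOn.1 hσ).2 i).2 (by simp [hj.symm]) (h (i, i) hp)
    · simp
  · have hd0 : diagCount F = 0 := by omega
    rw [← Finset.sum_add_sum_compl (F.image Prod.fst)]
    have h1 : ∑ i ∈ F.image Prod.fst, extCount (matchingsOn (Finset.univ.erase i)) F = 0 := by
      refine Finset.sum_eq_zero fun i hi => extCount_eq_zero fun σ hσ h => ?_
      obtain ⟨p, hp, rfl⟩ := Finset.mem_image.1 hi
      have h2 := ((mem_matchingsOn.1 hσ).2 p.1).not.2 (by simp)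
      rw [not_not, h p hp] at h2
      exact (Finset.card_eq_zero.1 hd0 ▸ Finset.notMem_empty p) (Finset.mem_filter.2 ⟨hp, h2.symm⟩)
    have h2 : ∀ i ∈ (F.image Prod.fst)ᶜ, extCount (matchingsOn (Finset.univ.erase i)) F =
        (2 * N - F.card - 1)‼ := by
      intro i hi
      have hi' : ∀ p ∈ F, p.1 ≠ i := fun p hp h =>
        Finset.mem_compl.1 hi (Finset.mem_image.2 ⟨p, hp, h⟩)
      refine (extCount_matchingsOn N _ F (hcard i) (fun p hp => ?_) hinj hsymm hd0).2
      have := hi' _ (hsymm p hp)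
      simp [hi' p hp, this]
    rw [h1, zero_add, Finset.sum_congr rfl h2, Finset.sum_const, Finset.card_compl, hN,
      Finset.card_image_of_injOn fun p hp q hq h => (hinj p hp q hq).1 h, hd0, add_zero, smul_eq_mul]
    by_cases h3 : 2 * N < F.card + 1
    · rcases (show F.card = 2 * N ∨ F.card = 2 * N + 1 by omega) with h | h
      · simp [h]
      · obtain ⟨p, hp⟩ : F.Nonempty := Finset.card_pos.1 (by omega)
        exfalso
        have hall : F.image Prod.fst = Finset.univ := by
          apply Finset.eq_univ_of_card
          rw [Finset.card_image_of_injOn fun p hp q hq h => (hinj p hp q hq).1 h, h, hN]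
        -- Swapping coordinates has no fixed pair in `F`, so the set of first coordinates is even;
        -- it cannot be all of an odd set.
        have h4 : (∑ i ∈ F.image Prod.fst, (1 : ZMod 2)) = 0 := by
          rw [Finset.sum_image fun p hp q hq h => (hinj p hp q hq).1 h]
          refine Finset.sum_involution (fun p _ => (p.2, p.1)) (fun _ _ => by decide)
            (fun p hp _ h => ?_) (fun p hp => hsymm p hp) (fun _ _ => rfl)
          exact (Finset.card_eq_zero.1 hd0 ▸ Finset.notMem_empty p)
            (Finset.mem_filter.2 ⟨hp, (congrArg Prod.snd h)⟩)
        rw [hall, Finset.sum_const, Finset.card_univ, hN] at h4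
        simp [show (2 : ZMod 2) = 0 from rfl] at h4
    · obtain ⟨d, hd⟩ := Nat.exists_eq_add_of_le (show F.card + 1 ≤ 2 * N by omega)
      have e1 : 2 * N + 1 - F.card = d + 2 := by omega
      have e2 : 2 * N - F.card - 1 = d := by omega
      rw [e1, e2, Nat.doubleFactorial_add_two]

end Matchings

end

/-! ### Counting covers with prescribed values -/

section DoubleFactorial

open scoped Nat

theorem doubleFactorial_mul_prod (a m : ℕ) (h : 2 * m ≤ a + 1) :
    ((a - 2 * m)‼ : ℝ) * ∏ t ∈ Finset.range m, ((a : ℝ) - 2 * t) = (a‼ : ℝ) := by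
  induction m with
  | zero => simp
  | succ m ih =>
    rw [Finset.prod_range_succ, ← ih (by omega)]
    obtain ⟨d, hd⟩ := Nat.exists_eq_add_of_le (show 2 * m + 1 ≤ a by omega)
    have h1 : (a : ℝ) - 2 * m = d + 1 := by
      rw [hd]
      push_cast
      ring
    have h2 : (((a - 2 * m)‼ : ℕ) : ℝ) = (d + 1) * ((a - 2 * (m + 1))‼ : ℕ) := by
      have e1 : a - 2 * m = d + 1 := by omega
      have e2 : a - 2 * (m + 1) = d - 1 := by omega
      rw [e1, e2]
      rcases d with _ | d
      -- The borderline case `2 * (m + 1) = a + 1`, where the subtraction truncates: `1‼ = 1 * 0‼`.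
      · simp
      · rw [Nat.doubleFactorial_add_two]
        push_cast
        simp only [add_assoc, one_add_one_eq_two]
    rw [h1, h2]
    ring

theorem factorial_mul_prod (a m : ℕ) (h : m ≤ a) :
    ((a - m).factorial : ℝ) * ∏ t ∈ Finset.range m, ((a : ℝ) - t) = (a.factorial : ℝ) := by
  induction m with
  | zero => simp
  | succ m ih =>
    rw [Finset.prod_range_succ, ← ih (by omega)]
    obtain ⟨d, hd⟩ := Nat.exists_eq_add_of_le h
    have h1 : (a : ℝ) - m = d + 1 := by
      rw [hd]
      push_cast
      ring
    have e1 : a - m = d + 1 := by omega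
    have e2 : a - (m + 1) = d := by omega
    rw [h1, e1, e2, Nat.factorial_succ]
    push_cast
    ring

end DoubleFactorial

/-- Off-diagonal pairs come in twos and diagonal ones are counted twice. This makes the halving in
`relMult` exact. -/
theorem even_card_add_diagCount {α : Type*} {F : Finset (α × α)} (hF : IsSymmRel F) :
    Even (F.card + diagCount F) := by
  have h1 : (∑ p ∈ F.filter fun p => ¬ p.1 = p.2, (1 : ZMod 2)) = 0 := by
    refine Finset.sum_involution (fun p _ => (p.2, p.1)) (fun _ _ => by decide)
      (fun p hp _ h => ?_) (fun p hp => ?_) (fun _ _ => rfl)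
    · exact (Finset.mem_filter.1 hp).2 (congrArg Prod.snd h)
    · rw [Finset.mem_filter] at hp ⊢
      exact ⟨hF p hp.1, fun h => hp.2 h.symm⟩
  have h2 := Finset.card_filter_add_card_filter_not (s := F) fun p => p.1 = p.2
  rw [Finset.sum_const, nsmul_eq_mul, mul_one, ZMod.natCast_eq_zero_iff_even] at h1
  rw [← h2, diagCount]
  obtain ⟨d, hd⟩ := h1
  exact ⟨(F.filter fun p => p.1 = p.2).card + d, by omega⟩

/-! ### Allowed values at an edge and independence over the edges -/

namespace BasicKind

def IsEven : BasicKind → Prop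
  | permInvEven => True
  | cycInvEven => True
  | _ => False

def IsCyc : BasicKind → Prop
  | cyclic => True
  | cycInvEven => True
  | cycInvOdd => True
  | _ => False

variable {B : FinGraph.{u}} (κ : BasicKind) {n : ℕ}

/-- The permutations allowed at a directed edge. -/
noncomputable def allowed (κ : BasicKind) (n : ℕ) (e : B.E) : Finset (Equiv.Perm (Fin n)) :=
  Finset.univ.filter fun σ => (B.IsHalfLoop e → (∀ i, σ (σ i) = i) ∧ HalfRule σ κ) ∧
    (B.IsWholeLoop e → WholeRule σ κ)

/-- After `t` constraints, a further one has conditional probability `1 / (n - (slope * t +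
shift))`. The slope is two at a half-loop because one constraint on an involution uses up two
points. The shift is one where fixed points are forbidden from the start (perfect matchings) or
closing up is forbidden (`n`-cycles). -/
noncomputable def slope (e : B.E) : ℝ := if B.IsHalfLoop e then 2 else 1

noncomputable def shift (e : B.E) : ℝ :=
  if B.IsHalfLoop e then (if κ.IsEven then 1 else 0)
  else if B.IsWholeLoop e ∧ κ.IsCyc then 1 else 0

/-- The constraints at a directed edge that some allowed permutation satisfies. -/
def RelGood (e : B.E) (F : Finset (Fin n × Fin n)) : Prop :=
  IsPartialInj F ∧ (B.IsHalfLoop e → (κ.IsEven → diagCount F = 0) ∧ diagCount F ≤ 1) ∧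
    (B.IsWholeLoop e → κ.IsCyc → ¬ HasLoopRel F)

/-- At a half-loop a pair and its reverse are one condition, and a diagonal pair is a condition by
itself. -/
noncomputable def relMult (e : B.E) (F : Finset (Fin n × Fin n)) : ℕ :=
  if B.IsHalfLoop e then (F.card + diagCount F) / 2 else F.card

/-- The reciprocal of the probability of `m` constraints at a directed edge. -/
noncomputable def denom (κ : BasicKind) (n : ℕ) (e : B.E) (m : ℕ) : ℝ :=
  ∏ t ∈ Finset.range m, ((n : ℝ) - (slope e * t + shift κ e))

variable {κ}

theorem RelGood.mono {e : B.E} {F F' : Finset (Fin n × Fin n)} (h : RelGood κ e F) (hF : F' ⊆ F) :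
    RelGood κ e F' := by
  have hd := diagCount_mono hF
  refine ⟨h.1.mono hF, fun he => ⟨fun hk => ?_, hd.trans (h.2.1 he).2⟩,
    fun he hk hl => h.2.2 he hk (hl.mono hF)⟩
  have := (h.2.1 he).1 hk
  omega

/-- For `n`-cycles the hypothesis `F.card < n` is essential: a closed part of `F` contains the whole
orbit of its points under `σ`, hence all `n` points. -/
theorem relGood_of_ext (hκ : κ.Admissible B) {e : B.E} {F : Finset (Fin n × Fin n)}
    (hF : F.card < n) {σ : Equiv.Perm (Fin n)} (hσ : σ ∈ allowed κ n e)
    (h : ∀ p ∈ F, σ p.1 = p.2) : RelGood κ e F := by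
  simp only [allowed, Finset.mem_filter, Finset.mem_univ, true_and] at hσ
  refine ⟨IsPartialInj.of_ext h, fun he => ?_, fun he hk => ?_⟩
  · have h1 := (hσ.1 he).2
    have hE : IsPerfectMatching σ → diagCount F = 0 := by
      intro hm
      rw [diagCount_eq_zero]
      intro p hp hpd
      exact hm.2 p.1 (by rw [h p hp, hpd])
    have hO : IsNearPerfectMatching σ → diagCount F ≤ 1 := by
      rintro ⟨-, i, -, hi⟩
      rw [diagCount_le_one]
      intro p hp q hq hpd hqd
      have e1 : p.1 = q.1 :=
        (hi p.1 ((h p hp).trans hpd.symm)).trans (hi q.1 ((h q hq).trans hqd.symm)).symm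
      exact Prod.ext e1 (by rw [← hpd, ← hqd, e1])
    cases κ
    · exact absurd he (hκ e)
    · have := hE h1
      exact ⟨fun _ => this, by omega⟩
    · exact ⟨fun h => h.elim, hO h1⟩
    · exact absurd he (hκ e)
    · have := hE h1
      exact ⟨fun _ => this, by omega⟩
    · exact ⟨fun h => h.elim, hO h1⟩
  · have h1 : σ.IsCycleOn Set.univ := by
      have := hσ.2 he
      cases κ <;> first | exact this | exact hk.elim
    rintro ⟨Z, hZ, ⟨p, hp⟩, hZ'⟩
    have hmem : ∀ k : ℕ, (σ ^ k) p.1 ∈ Z.image Prod.fst := by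
      intro k
      induction k with
      | zero => exact Finset.mem_image.2 ⟨p, hp, rfl⟩
      | succ k ih =>
        obtain ⟨q, hq, hq'⟩ := Finset.mem_image.1 ih
        obtain ⟨q2, hq2, hq2'⟩ := hZ' q hq
        refine Finset.mem_image.2 ⟨q2, hq2, ?_⟩
        rw [pow_succ', Equiv.Perm.mul_apply, ← hq', h q (hZ hq), hq2']
    have huniv : Z.image Prod.fst = Finset.univ := by
      refine Finset.eq_univ_of_forall fun x => ?_
      obtain ⟨k, -, -, rfl⟩ := (h1.2 (Set.mem_univ p.1) (Set.mem_univ x)).exists_pow_eq'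
      exact hmem k
    have h2 : n ≤ Z.card := by
      have := Finset.card_image_le (s := Z) (f := Prod.fst)
      rwa [huniv, Finset.card_univ, Fintype.card_fin] at this
    have h3 := Finset.card_le_card hZ
    omega

theorem two_mul_relMult {e : B.E} {F : Finset (Fin n × Fin n)} (he : B.IsHalfLoop e)
    (hF : IsSymmRel F) : 2 * relMult e F = F.card + diagCount F := by
  rw [relMult, if_pos he]
  have := even_card_add_diagCount hF
  obtain ⟨d, hd⟩ := this
  omega

/-- The ratio of total count to extension count is a quotient of factorials of `n` or `n - 1` for
permutations and cycles, and of double factorials of `n` or `n - 1` for near perfect and perfect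
matchings. In all four cases it is a product over an arithmetic progression, which `denom` records
uniformly. -/
theorem extCount_allowed (hκ : κ.Admissible B) (hn : n ∈ κ.degrees) {e : B.E}
    {F : Finset (Fin n × Fin n)} (hsymm : B.IsHalfLoop e → IsSymmRel F) (hF : F.card < n)
    (hgood : RelGood κ e F) :
    (extCount (allowed κ n e) F : ℝ) * denom κ n e (relMult e F) = (allowed κ n e).card := by
  have hn0 := κ.pos_of_mem_degrees n hn
  by_cases he : B.IsHalfLoop e
  · have hw : ¬ B.IsWholeLoop e := fun h => h.1 he
    have hm := two_mul_relMult he (hsymm he)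
    have hall : allowed κ n e = Finset.univ.filter fun σ : Equiv.Perm (Fin n) =>
        (∀ i, σ (σ i) = i) ∧ HalfRule σ κ := by
      simp [allowed, he, hw]
    have hE : Even n → κ.IsEven → (∀ σ : Equiv.Perm (Fin n), HalfRule σ κ ↔ IsPerfectMatching σ) →
        (extCount (allowed κ n e) F : ℝ) * denom κ n e (relMult e F) = (allowed κ n e).card := by
      intro hev hk hrule
      obtain ⟨N, hN⟩ := hev
      have hA : allowed κ n e = matchingsOn Finset.univ := by
        rw [hall]
        ext σ
        simp [hrule, IsPerfectMatching, mem_matchingsOn]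
      have hd := (hgood.2.1 he).1 hk
      have h1 := extCount_matchingsOn N Finset.univ F (by simp [hN]; omega) (by simp) hgood.1
        (hsymm he) hd
      have h0 := extCount_matchingsOn N (Finset.univ : Finset (Fin n)) ∅ (by simp [hN]; omega)
        (by simp) (by simp [IsPartialInj]) (by simp [IsSymmRel]) (by simp [diagCount])
      have hdf := doubleFactorial_mul_prod (2 * N - 1) (relMult e F) (by omega)
      rw [← extCount_empty, hA, h1.2, h0.2]
      simp only [Finset.card_empty, Nat.sub_zero]
      rw [← hdf]
      have e1 : 2 * N - F.card - 1 = 2 * N - 1 - 2 * relMult e F := by omega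
      rw [e1, denom]
      congr 1
      refine Finset.prod_congr rfl fun t _ => ?_
      rw [slope, shift, if_pos he, if_pos he, if_pos hk, hN, Nat.cast_sub (by omega)]
      push_cast
      ring
    have hO : Odd n → ¬ κ.IsEven → (∀ σ : Equiv.Perm (Fin n), HalfRule σ κ ↔ IsNearPerfectMatching σ) →
        (extCount (allowed κ n e) F : ℝ) * denom κ n e (relMult e F) = (allowed κ n e).card := by
      intro hev hk hrule
      obtain ⟨N, hN⟩ := hev
      have hA : allowed κ n e = nearMatchings := by
        rw [hall]
        ext σ
        simp [hrule, IsNearPerfectMatching, nearMatchings]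
      have hd := (hgood.2.1 he).2
      have h1 := extCount_nearMatchings (N := N) (by simp [hN]) hgood.1 (hsymm he) hd
      have h0 := extCount_nearMatchings (N := N) (α := Fin n) (F := ∅) (by simp [hN])
        (by simp [IsPartialInj]) (by simp [IsSymmRel]) (by simp [diagCount])
      have hdf := doubleFactorial_mul_prod n (relMult e F) (by omega)
      rw [← extCount_empty, hA, h1.2, h0.2]
      have e0 : 2 * N + 1 - ((∅ : Finset (Fin n × Fin n)).card +
          diagCount (∅ : Finset (Fin n × Fin n))) = n := by simp [diagCount, hN]
      rw [e0, ← hdf, ← hm, ← hN, denom]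
      congr 1
      refine Finset.prod_congr rfl fun t _ => ?_
      rw [slope, shift, if_pos he, if_pos he, if_neg hk]
      ring
    cases κ
    · exact absurd he (hκ e)
    · exact hE hn.2 trivial fun _ => Iff.rfl
    · exact hO hn.2 id fun _ => Iff.rfl
    · exact absurd he (hκ e)
    · exact hE hn.2 trivial fun _ => Iff.rfl
    · exact hO hn.2 id fun _ => Iff.rfl
  · rw [relMult, if_neg he]
    by_cases hw : B.IsWholeLoop e ∧ κ.IsCyc
    · have hA : allowed κ n e = cyclesOn Finset.univ := by
        have hrule : ∀ σ : Equiv.Perm (Fin n), WholeRule σ κ ↔ σ.IsCycleOn Set.univ := by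
          intro σ
          have := hw.2
          cases κ <;> first | exact Iff.rfl | exact this.elim
        ext σ
        simp [allowed, he, hw.1, hrule, mem_cyclesOn]
      have h1 := extCount_cyclesOn (n - 1) Finset.univ F (by simp; omega) (by simp) hgood.1
        (hgood.2.2 hw.1 hw.2)
      have h0 := extCount_cyclesOn (n - 1) (Finset.univ : Finset (Fin n)) ∅ (by simp; omega)
        (by simp) (by simp [IsPartialInj]) (by
          rintro ⟨Z, hZ, hZ', -⟩
          rw [Finset.subset_empty.1 hZ] at hZ'
          simp at hZ')
      have hf := factorial_mul_prod (n - 1) F.card h1.1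
      rw [← extCount_empty, hA, h1.2, h0.2, Finset.card_empty, Nat.sub_zero, ← hf, denom]
      congr 1
      refine Finset.prod_congr rfl fun t _ => ?_
      rw [slope, shift, if_neg he, if_neg he, if_pos hw, Nat.cast_sub (by omega)]
      push_cast
      ring
    · have hA : ∀ σ, σ ∈ allowed κ n e := by
        intro σ
        simp only [allowed, he, Finset.mem_filter, Finset.mem_univ, true_and, false_imp_iff]
        intro hw'
        have : ¬ κ.IsCyc := fun h => hw ⟨hw', h⟩
        cases κ <;> first | trivial | exact (this trivial).elim
      rw [← extCount_of_forall_mem hA hgood.1, denom, Fintype.card_fin]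
      congr 1
      refine Finset.prod_congr rfl fun t _ => ?_
      rw [slope, shift, if_neg he, if_neg he, if_neg hw]
      ring

theorem inv_mem_allowed {e : B.E} {σ : Equiv.Perm (Fin n)} (hσ : σ ∈ allowed κ n e) :
    σ⁻¹ ∈ allowed κ n (B.inv e) := by
  simp only [allowed, Finset.mem_filter, Finset.mem_univ, true_and] at hσ ⊢
  refine ⟨fun he => ?_, fun he => ?_⟩
  · have he' : B.IsHalfLoop e := by
      have h : B.inv (B.inv e) = B.inv e := he
      rw [B.inv_inv] at h
      exact h.symm
    have h1 : σ⁻¹ = σ := by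
      ext i
      rw [Equiv.Perm.inv_eq_iff_eq.2 ((hσ.1 he').1 i).symm]
    rw [h1]
    exact hσ.1 he'
  · have he' : B.IsWholeLoop e := by
      refine ⟨fun h => he.1 (by rw [h, h]), ?_⟩
      have := he.2
      rw [B.head_inv, B.tail_inv] at this
      exact this.symm
    have := hσ.2 he'
    cases κ <;> first | trivial | exact Equiv.Perm.IsCycleOn.inv this

/-- At a half-loop, `σ (inv e) = (σ e)⁻¹` already makes `σ e` an involution, so the extra condition
in `allowed` costs nothing. -/
theorem mem_atoms {σ : Coord B n} : σ ∈ κ.atoms B n ↔ ∀ e, σ.1 e ∈ allowed κ n e := by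
  simp only [atoms, allowed, Finset.mem_filter, Finset.mem_univ, true_and]
  refine forall_congr' fun e => and_congr_left fun _ => imp_congr_right fun he => ?_
  have h1 : ∀ i, σ.1 e (σ.1 e i) = i := by
    intro i
    have h := σ.2 e
    have he' : B.inv e = e := he
    rw [he'] at h
    nth_rewrite 1 [h]
    simp
  simp [h1]

/-- The number of covers with prescribed values. -/
noncomputable def covCount (κ : BasicKind) (F : B.E → Finset (Fin n × Fin n)) : ℕ :=
  ((κ.atoms B n).filter fun σ => ∀ e, ∀ p ∈ F e, σ.1 e p.1 = p.2).card

/-- Compatibility of constraints with the involution. -/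
def IsCompatible (F : B.E → Finset (Fin n × Fin n)) : Prop :=
  ∀ e, ∀ p ∈ F e, (p.2, p.1) ∈ F (B.inv e)

theorem IsCompatible.isSymmRel {F : B.E → Finset (Fin n × Fin n)} (hF : IsCompatible F) {e : B.E}
    (he : B.IsHalfLoop e) : IsSymmRel (F e) := by
  intro p hp
  have := hF e p hp
  rwa [show B.inv e = e from he] at this

/-- Independence: allowed values on representatives extend uniquely to the other directed edges by
inversion. At half-loops this needs the values to be involutions, and compatibility of `F`
transports the constraints. -/
theorem covCount_eq_prod {F : B.E → Finset (Fin n × Fin n)} (hF : IsCompatible F) :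
    covCount κ F = ∏ e ∈ B.reps, extCount (allowed κ n e) (F e) := by
  rw [← Finset.prod_coe_sort]
  simp only [extCount]
  rw [← Fintype.card_piFinset]
  refine Finset.card_bij (fun σ _ e => σ.1 e.1) ?_ ?_ ?_
  · intro σ hσ
    rw [Finset.mem_filter] at hσ
    rw [Fintype.mem_piFinset]
    intro e
    exact mem_extSet.2 ⟨mem_atoms.1 hσ.1 e, hσ.2 e⟩
  · intro σ _ τ _ h
    refine Subtype.ext (funext fun e => ?_)
    rcases B.mem_reps_or e with he | he
    · exact congrFun h ⟨e, he⟩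
    · have h1 := congrFun h ⟨B.inv e, he⟩
      simp only [σ.2, τ.2] at h1
      exact inv_injective h1
  · intro τ hτ
    rw [Fintype.mem_piFinset] at hτ
    let σ : B.E → Equiv.Perm (Fin n) := fun e =>
      if h : e ∈ B.reps then τ ⟨e, h⟩ else (τ ⟨B.inv e, (B.mem_reps_or e).resolve_left h⟩)⁻¹
    have hσ1 : ∀ e (h : e ∈ B.reps), σ e = τ ⟨e, h⟩ := fun e h => dif_pos h
    have hσ : ∀ e, σ (B.inv e) = (σ e)⁻¹ := by
      intro e
      by_cases h : e ∈ B.reps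
      · by_cases h' : B.inv e ∈ B.reps
        · have he := B.eq_of_mem_reps h h'
          have h1 := (mem_extSet.1 (hτ ⟨e, h⟩)).1
          simp only [allowed, Finset.mem_filter, Finset.mem_univ, true_and] at h1
          have h2 := (h1.1 he).1
          rw [he, hσ1 e h]
          ext i
          rw [Equiv.Perm.inv_eq_iff_eq.2 (h2 i).symm]
        · rw [hσ1 e h]
          simp only [σ, h', dif_neg, not_false_iff]
          congr 2
          exact Subtype.ext (B.inv_inv e)
      · have h' := (B.mem_reps_or e).resolve_left h
        rw [hσ1 _ h']
        simp [σ, h]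
    let σ' : Coord B n := ⟨σ, hσ⟩
    have hmem : ∀ e ∈ B.reps, σ e ∈ allowed κ n e ∧ ∀ p ∈ F e, σ e p.1 = p.2 := by
      intro e he
      rw [hσ1 e he]
      exact mem_extSet.1 (hτ ⟨e, he⟩)
    have hmem' : ∀ e, σ e ∈ allowed κ n e ∧ ∀ p ∈ F e, σ e p.1 = p.2 := by
      intro e
      rcases B.mem_reps_or e with he | he
      · exact hmem e he
      · obtain ⟨h1, h2⟩ := hmem _ he
        constructor
        · have := inv_mem_allowed h1
          rwa [hσ, inv_inv, B.inv_inv] at this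
        · intro p hp
          have := h2 _ (hF e p hp)
          simp only [hσ] at this
          exact (Equiv.Perm.inv_eq_iff_eq.1 this).symm
    exact ⟨σ', Finset.mem_filter.2 ⟨mem_atoms.2 fun e => (hmem' e).1, fun e => (hmem' e).2⟩,
      funext fun e => hσ1 e.1 e.2⟩

theorem covCount_mul (hκ : κ.Admissible B) (hn : n ∈ κ.degrees) {F : B.E → Finset (Fin n × Fin n)}
    (hF : IsCompatible F) (hcard : ∀ e, (F e).card < n) (hgood : ∀ e, RelGood κ e (F e)) :
    (covCount κ F : ℝ) * ∏ e ∈ B.reps, denom κ n e (relMult e (F e)) = (κ.atoms B n).card := by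
  have h0 : (κ.atoms B n).card = covCount κ fun _ : B.E => (∅ : Finset (Fin n × Fin n)) := by
    simp [covCount]
  rw [h0, covCount_eq_prod hF, covCount_eq_prod fun e p hp => by simp at hp]
  push_cast
  rw [← Finset.prod_mul_distrib]
  refine Finset.prod_congr rfl fun e _ => ?_
  rw [extCount_allowed hκ hn (fun he => hF.isSymmRel he) (hcard e) (hgood e), extCount_empty]

theorem relGood_of_covCount_ne_zero (hκ : κ.Admissible B) {F : B.E → Finset (Fin n × Fin n)}
    (hcard : ∀ e, (F e).card < n) (h : covCount κ F ≠ 0) (e : B.E) : RelGood κ e (F e) := by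
  obtain ⟨σ, hσ⟩ := Finset.card_pos.1 (Nat.pos_of_ne_zero h)
  rw [Finset.mem_filter] at hσ
  exact relGood_of_ext hκ (hcard e) (mem_atoms.1 hσ.1 e) (hσ.2 e)

end BasicKind

/-! ### Expected number of copies of a graph -/

namespace BGraph

variable {B : FinGraph.{u}} (S : BGraph B)

/-- A nonempty set of directed edges over `b`, each of which has a successor in the set. -/
def HasLoop (b : B.E) : Prop :=
  ∃ Z : Set S.graph.E, Z.Nonempty ∧
    ∀ z ∈ Z, S.proj.onE z = b ∧ ∃ z' ∈ Z, S.graph.tail z' = S.graph.head z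

/-- The condition for `S` to occur in a basic model. -/
def Good (κ : BasicKind) : Prop :=
  S.Etale ∧ (∀ b, B.IsHalfLoop b → (κ.IsEven → S.fixE b = 0) ∧ S.fixE b ≤ 1) ∧
    ∀ b, B.IsWholeLoop b → κ.IsCyc → ¬ S.HasLoop b

/-- Labelings of the vertices that are injective on each fibre. -/
def Labeling (n : ℕ) : Type u :=
  {i : S.graph.V → Fin n // ∀ v v', S.proj.onV v = S.proj.onV v' → i v = i v' → v = v'}

instance (n : ℕ) : Finite (S.Labeling n) :=
  inferInstanceAs (Finite {i : S.graph.V → Fin n //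
    ∀ v v', S.proj.onV v = S.proj.onV v' → i v = i v' → v = v'})

noncomputable instance (n : ℕ) : Fintype (S.Labeling n) := Fintype.ofFinite _

/-- A labeling is a family of independent injections of the fibres into `Fin n`. -/
theorem card_labeling (n : ℕ) :
    Nat.card (S.Labeling n) = ∏ v, n.descFactorial (S.fibreV v) := by
  have e : S.Labeling n ≃ ((v : B.V) → {x : S.graph.V // S.proj.onV x = v} ↪ Fin n) :=
    { toFun := fun i v => ⟨fun x => i.1 x.1, fun x y h =>
        Subtype.ext (i.2 x.1 y.1 (x.2.trans y.2.symm) h)⟩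
      invFun := fun f => ⟨fun x => f (S.proj.onV x) ⟨x, rfl⟩, fun x y h hf => by
        have : f (S.proj.onV x) ⟨x, rfl⟩ = f (S.proj.onV x) ⟨y, h.symm⟩ := by
          refine Eq.trans hf ?_
          have : ∀ (v w : B.V) (hw : S.proj.onV y = w) (hv : v = w),
              f v ⟨y, hw.trans hv.symm⟩ = f w ⟨y, hw⟩ := by
            rintro v _ rfl rfl
            rfl
          exact (this _ _ rfl h).symm
        exact congrArg Subtype.val ((f (S.proj.onV x)).injective this)⟩
      left_inv := fun i => rfl
      right_inv := fun f => by
        ext v ⟨x, rfl⟩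
        rfl }
  rw [Nat.card_congr e, Nat.card_pi]
  refine Finset.prod_congr rfl fun v _ => ?_
  rw [Nat.card_eq_fintype_card, Fintype.card_embedding_eq, Fintype.card_fin, fibreV,
    Nat.card_eq_fintype_card]

variable {S} {n : ℕ}

/-- The constraints on the permutation assignment imposed by a labeling. -/
noncomputable def Labeling.rel (i : S.Labeling n) (b : B.E) : Finset (Fin n × Fin n) :=
  (Finset.univ.filter fun x => S.proj.onE x = b).image
    fun x => (i.1 (S.graph.tail x), i.1 (S.graph.head x))

namespace Labeling

variable (i : S.Labeling n)

theorem mem_rel {b : B.E} {p : Fin n × Fin n} : p ∈ i.rel b ↔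
    ∃ x, S.proj.onE x = b ∧ (i.1 (S.graph.tail x), i.1 (S.graph.head x)) = p := by
  simp [rel]

theorem isCompatible : BasicKind.IsCompatible i.rel := by
  intro b p hp
  obtain ⟨x, rfl, rfl⟩ := i.mem_rel.1 hp
  refine i.mem_rel.2 ⟨S.graph.inv x, by rw [← S.proj.inv_onE], ?_⟩
  rw [S.graph.tail_inv, S.graph.head_inv]

theorem inj (hS : S.Etale) {x y : S.graph.E} (h : S.proj.onE x = S.proj.onE y)
    (hi : i.1 (S.graph.tail x) = i.1 (S.graph.tail y)) : x = y := by
  refine hS.1 x y (i.2 _ _ ?_ hi) h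
  rw [← S.proj.tail_onE, ← S.proj.tail_onE, h]

theorem card_rel (hS : S.Etale) (b : B.E) : (i.rel b).card = S.fibreE b := by
  refine card_eq_natCard (fun x : {x : S.graph.E // S.proj.onE x = b} =>
    (i.1 (S.graph.tail x.1), i.1 (S.graph.head x.1))) (fun x y h => ?_) fun p => ?_
  · exact Subtype.ext (i.inj hS (x.2.trans y.2.symm) (congrArg Prod.fst h))
  · rw [mem_rel]
    exact ⟨fun ⟨x, h1, h2⟩ => ⟨⟨x, h1⟩, h2⟩, fun ⟨x, h⟩ => ⟨x.1, x.2, h⟩⟩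

theorem card_rel_le (b : B.E) : (i.rel b).card ≤ S.graph.numDir := by
  refine Finset.card_image_le.trans ((Finset.card_le_univ _).trans ?_)
  rw [FinGraph.numDir, Nat.card_eq_fintype_card]

theorem diagCount_rel (hS : S.Etale) {b : B.E} (hb : B.IsHalfLoop b) :
    diagCount (i.rel b) = S.fixE b := by
  have hb' : B.inv b = b := hb
  refine diagCount_eq_natCard (fun x : {x : S.graph.E // S.proj.onE x = b ∧ S.graph.inv x = x} =>
    (i.1 (S.graph.tail x.1), i.1 (S.graph.head x.1))) (fun x y h => ?_) fun p => ?_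
  · exact Subtype.ext (i.inj hS (x.2.1.trans y.2.1.symm) (congrArg Prod.fst h))
  · rw [mem_rel]
    constructor
    · rintro ⟨⟨x, h1, rfl⟩, h2⟩
      refine ⟨⟨x, h1, i.inj hS ?_ ?_⟩, rfl⟩
      · rw [← S.proj.inv_onE, h1, hb']
      · rw [S.graph.tail_inv]
        exact h2.symm
    · rintro ⟨⟨x, h1, h2⟩, rfl⟩
      refine ⟨⟨x, h1, rfl⟩, ?_⟩
      simp only
      rw [← S.graph.tail_inv, h2]

theorem relMult_rel (hS : S.Etale) (b : B.E) : BasicKind.relMult b (i.rel b) = S.mult b := by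
  rw [BasicKind.relMult, mult, i.card_rel hS]
  split_ifs with hb
  · rw [i.diagCount_rel hS hb]
  · rfl

/-- Heads and tails of edges over a whole-loop lie over a single vertex of `B`, where labels
identify vertices; so closed parts of the relation and of the graph correspond. -/
theorem hasLoopRel_iff {b : B.E} (hb : B.IsWholeLoop b) :
    HasLoopRel (i.rel b) ↔ S.HasLoop b := by
  constructor
  · rintro ⟨Z, hZ, hne, h⟩
    refine ⟨{x | S.proj.onE x = b ∧ (i.1 (S.graph.tail x), i.1 (S.graph.head x)) ∈ Z}, ?_, ?_⟩
    · obtain ⟨p, hp⟩ := hne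
      obtain ⟨x, h1, rfl⟩ := i.mem_rel.1 (hZ hp)
      exact ⟨x, h1, hp⟩
    · rintro x ⟨hx1, hx2⟩
      refine ⟨hx1, ?_⟩
      obtain ⟨q, hq, hq'⟩ := h _ hx2
      obtain ⟨y, h1, rfl⟩ := i.mem_rel.1 (hZ hq)
      refine ⟨y, ⟨h1, hq⟩, i.2 _ _ ?_ hq'⟩
      rw [← S.proj.tail_onE, ← S.proj.head_onE, h1, hx1, hb.2]
  · rintro ⟨Z, hne, h⟩
    refine ⟨(i.rel b).filter fun p => ∃ x ∈ Z, (i.1 (S.graph.tail x), i.1 (S.graph.head x)) = p,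
      Finset.filter_subset _ _, ?_, ?_⟩
    · obtain ⟨x, hx⟩ := hne
      exact ⟨_, Finset.mem_filter.2 ⟨i.mem_rel.2 ⟨x, (h x hx).1, rfl⟩, x, hx, rfl⟩⟩
    · intro p hp
      obtain ⟨-, x, hx, rfl⟩ := Finset.mem_filter.1 hp
      obtain ⟨-, y, hy, hxy⟩ := h x hx
      exact ⟨_, Finset.mem_filter.2 ⟨i.mem_rel.2 ⟨y, (h y hy).1, rfl⟩, y, hy, rfl⟩,
        congrArg i.1 hxy⟩

/-- Consistency of the constraints is thus a property of `S` alone, the same for all labelings. -/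
theorem relGood_iff {κ : BasicKind} (hS : S.Etale) :
    (∀ b, BasicKind.RelGood κ b (i.rel b)) ↔ S.Good κ := by
  have hinj : ∀ b, IsPartialInj (i.rel b) := by
    intro b p hp q hq
    obtain ⟨x, hx, rfl⟩ := i.mem_rel.1 hp
    obtain ⟨y, hy, rfl⟩ := i.mem_rel.1 hq
    refine ⟨fun h => ?_, fun h => ?_⟩
    · rw [i.inj hS (hx.trans hy.symm) h]
    · have : S.graph.inv x = S.graph.inv y := by
        refine i.inj hS ?_ ?_
        · rw [← S.proj.inv_onE, ← S.proj.inv_onE, hx, hy]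
        · rw [S.graph.tail_inv, S.graph.tail_inv]
          exact h
      rw [S.graph.inv_involutive.injective this]
  constructor
  · intro h
    refine ⟨hS, fun b hb => ?_, fun b hb hk => ?_⟩
    · rw [← i.diagCount_rel hS hb]
      exact (h b).2.1 hb
    · rw [← i.hasLoopRel_iff hb]
      exact (h b).2.2 hb hk
  · rintro ⟨-, h1, h2⟩ b
    refine ⟨hinj b, fun hb => ?_, fun hb hk => ?_⟩
    · rw [i.diagCount_rel hS hb]
      exact h1 b hb
    · rw [i.hasLoopRel_iff hb]
      exact h2 b hb hk

end Labeling

/-- The covers that are compatible with a labeling. -/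
def Labeling.Compat (i : S.Labeling n) (σ : Coord B n) : Prop :=
  ∀ b, ∀ p ∈ i.rel b, σ.1 b p.1 = p.2

theorem Labeling.compat_iff {i : S.Labeling n} {σ : Coord B n} : i.Compat σ ↔
    ∀ x, σ.1 (S.proj.onE x) (i.1 (S.graph.tail x)) = i.1 (S.graph.head x) := by
  constructor
  · intro h x
    exact h _ _ (i.mem_rel.2 ⟨x, rfl, rfl⟩)
  · intro h b p hp
    obtain ⟨x, rfl, rfl⟩ := i.mem_rel.1 hp
    exact h x

theorem Embedding.etale {σ : Coord B n} (f : Embedding S σ.toBGraph) : S.Etale := by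
  have key : ∀ e e', S.graph.tail e = S.graph.tail e' → S.proj.onE e = S.proj.onE e' → e = e' := by
    intro e e' h1 h2
    apply f.injE
    refine Prod.ext ((f.projE e).trans (h2.trans (f.projE e').symm)) ?_
    have h3 := (f.tail_onE e).trans ((congrArg f.onV h1).trans (f.tail_onE e').symm)
    have h4 := congrArg (fun z : B.V × Fin n => z.2) h3
    exact h4
  refine ⟨key, fun e e' h1 h2 => S.graph.inv_involutive.injective (key _ _ ?_ ?_)⟩
  · rw [S.graph.tail_inv, S.graph.tail_inv, h1]
  · rw [← S.proj.inv_onE, ← S.proj.inv_onE, h2]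

theorem Embedding.ext' {S G : BGraph B} {f g : Embedding S G} (h1 : f.onV = g.onV)
    (h2 : f.onE = g.onE) : f = g := by
  obtain ⟨⟨a, b, _, _, _⟩, _, _, _, _⟩ := f
  obtain ⟨⟨c, d, _, _, _⟩, _, _, _, _⟩ := g
  simp only at h1 h2
  subst h1 h2
  rfl

/-- Embeddings into a cover are compatible labelings. -/
noncomputable def embeddingEquiv (hS : S.Etale) (σ : Coord B n) :
    Embedding S σ.toBGraph ≃ {i : S.Labeling n // i.Compat σ} where
  toFun f := ⟨⟨fun v => (f.onV v).2, fun v v' h1 h2 =>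
      f.injV (Prod.ext ((f.projV v).trans (h1.trans (f.projV v').symm)) h2)⟩, Labeling.compat_iff.2 fun x => by
    have h1 : (f.onE x).1 = S.proj.onE x := f.projE x
    have h2 : (f.onE x).2 = (f.onV (S.graph.tail x)).2 := congrArg Prod.snd (f.tail_onE x)
    have h3 : σ.1 (f.onE x).1 (f.onE x).2 = (f.onV (S.graph.head x)).2 :=
      congrArg Prod.snd (f.head_onE x)
    rwa [h1, h2] at h3⟩
  invFun i :=
    { onV := fun v => (S.proj.onV v, i.1.1 v)
      onE := fun e => (S.proj.onE e, i.1.1 (S.graph.tail e))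
      tail_onE := fun e => Prod.ext (S.proj.tail_onE e) rfl
      head_onE := fun e => Prod.ext (S.proj.head_onE e) (Labeling.compat_iff.1 i.2 e)
      inv_onE := fun e => Prod.ext (S.proj.inv_onE e) <| by
        simp only
        rw [S.graph.tail_inv]
        exact Labeling.compat_iff.1 i.2 e
      injV := fun v v' h => i.1.2 v v' (congrArg Prod.fst h) (congrArg Prod.snd h)
      injE := fun e e' h => i.1.inj hS (congrArg Prod.fst h) (congrArg Prod.snd h)
      projV := fun _ => rfl
      projE := fun _ => rfl }
  left_inv f := by
    refine Embedding.ext' ?_ ?_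
    · funext v
      exact Prod.ext (f.projV v).symm rfl
    · funext e
      refine Prod.ext (f.projE e).symm ?_
      have h1 : (f.onV (S.graph.tail e)).2 = (f.onE e).2 := congrArg Prod.snd (f.tail_onE e).symm
      exact h1
  right_inv i := rfl

variable {κ : BasicKind}

theorem Embedding.good (hκ : κ.Admissible B) {σ : Coord B n} (hσ : σ ∈ κ.atoms B n)
    (hn : S.graph.numDir < n) (f : Embedding S σ.toBGraph) : S.Good κ := by
  have hS := f.etale
  obtain ⟨i, hi⟩ := embeddingEquiv hS σ f
  exact (i.relGood_iff hS).1 fun b => BasicKind.relGood_of_ext hκ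
    ((i.card_rel_le b).trans_lt hn) (BasicKind.mem_atoms.1 hσ b) (hi b)

/-- Double counting of the pairs of an atom and a compatible labeling. -/
theorem sum_card_embedding (hS : S.Etale) :
    ∑ σ ∈ κ.atoms B n, Nat.card (Embedding S σ.toBGraph) =
      ∑ i : S.Labeling n, BasicKind.covCount κ i.rel := by
  have h1 : ∀ σ : Coord B n, Nat.card (Embedding S σ.toBGraph) =
      ∑ i : S.Labeling n, if i.Compat σ then 1 else 0 := by
    intro σ
    rw [Nat.card_congr (embeddingEquiv hS σ), Nat.card_eq_fintype_card, Fintype.card_subtype,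
      Finset.card_filter]
  simp only [h1]
  rw [Finset.sum_comm]
  refine Finset.sum_congr rfl fun i _ => ?_
  rw [BasicKind.covCount, Finset.card_filter]
  refine Finset.sum_congr rfl fun σ _ => ?_
  congr 1

theorem covCount_rel (hκ : κ.Admissible B) (hn : n ∈ κ.degrees) (hS : S.Good κ)
    (hcard : S.graph.numDir < n) (i : S.Labeling n) :
    (BasicKind.covCount κ i.rel : ℝ) * ∏ e ∈ B.reps, κ.denom n e (S.mult e) =
      (κ.atoms B n).card := by
  rw [← BasicKind.covCount_mul hκ hn i.isCompatible (fun e => (i.card_rel_le e).trans_lt hcard)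
    ((i.relGood_iff hS.1).2 hS)]
  congr 1
  refine Finset.prod_congr rfl fun e _ => ?_
  rw [i.relMult_rel hS.1]

end BGraph

/-! ### Expectations and occurrence in the basic models -/

section BasicModel

variable {B : FinGraph.{u}} {κ : BasicKind} (hκ : κ.Admissible B)

theorem card_atoms_pos (n : ℕ) (hn : n ∈ κ.degrees) : 0 < ((κ.atoms B n).card : ℝ) := by
  exact_mod_cast Finset.card_pos.2 (κ.atoms_nonempty B n hn)

theorem basicModel_expect (n : (basicModel B κ hκ).degrees) (X : Coord B n → ℝ) :
    (basicModel B κ hκ).expect n X = (∑ σ ∈ κ.atoms B n, X σ) / (κ.atoms B n).card := by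
  rw [Model.expect, Finset.sum_div, ← Finset.sum_subset (Finset.subset_univ (κ.atoms B n))]
  · refine Finset.sum_congr rfl fun σ hσ => ?_
    have h1 : (basicModel B κ hκ).law n σ = ((κ.atoms B n).card : ENNReal)⁻¹ :=
      PMF.uniformOfFinset_apply_of_mem (κ.atoms_nonempty B n n.2) hσ
    rw [h1]
    simp [div_eq_inv_mul]
  · intro σ _ hσ
    have h1 : (basicModel B κ hκ).law n σ = 0 :=
      PMF.uniformOfFinset_apply_of_notMem (κ.atoms_nonempty B n n.2) hσ
    rw [h1]
    simp

theorem mem_support_basicModel (n : (basicModel B κ hκ).degrees) (σ : Coord B n) :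
    σ ∈ ((basicModel B κ hκ).law n).support ↔ σ ∈ κ.atoms B n :=
  PMF.mem_support_uniformOfFinset_iff (κ.atoms_nonempty B n n.2) _

theorem expectCount_of_not_good {S : BGraph B} (hS : ¬ S.Good κ)
    (n : (basicModel B κ hκ).degrees) (hn : S.graph.numDir < (n : ℕ)) :
    (basicModel B κ hκ).expectCount S n = 0 := by
  rw [Model.expectCount, basicModel_expect, Finset.sum_eq_zero, zero_div]
  intro σ hσ
  have : IsEmpty (BGraph.Embedding S σ.toBGraph) := ⟨fun f => hS (f.good hκ hσ hn)⟩
  simp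

theorem expectCount_of_good {S : BGraph B} (hS : S.Good κ)
    (n : (basicModel B κ hκ).degrees) (hn : S.graph.numDir < (n : ℕ)) :
    (basicModel B κ hκ).expectCount S n * ∏ e ∈ B.reps, κ.denom n e (S.mult e) =
      ∏ v, ((n : ℕ).descFactorial (S.fibreV v) : ℝ) := by
  have h1 : (∑ σ ∈ κ.atoms B n, (Nat.card (BGraph.Embedding S σ.toBGraph) : ℝ)) =
      ∑ i : S.Labeling n, (BasicKind.covCount κ i.rel : ℝ) := by
    exact_mod_cast BGraph.sum_card_embedding (κ := κ) (n := n) hS.1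
  have h0 := card_atoms_pos (B := B) (κ := κ) n n.2
  rw [Model.expectCount, basicModel_expect, h1, div_mul_eq_mul_div, Finset.sum_mul,
    Finset.sum_congr rfl fun i _ => BGraph.covCount_rel hκ n.2 hS hn i, Finset.sum_const,
    Finset.card_univ, ← Nat.card_eq_fintype_card, S.card_labeling, nsmul_eq_mul,
    mul_div_cancel_right₀ _ h0.ne']
  push_cast
  rfl

/-- A copy in an atom of large degree forces consistency of the constraints. Conversely the exact
formula is nonzero once `n` is large, so some atom contains a copy. -/
theorem occurs_iff_good (S : BGraph B) : (basicModel B κ hκ).Occurs S ↔ S.Good κ := by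
  constructor
  · rintro ⟨n₀, h⟩
    obtain ⟨n, hn, hn'⟩ := κ.infinite_degrees.exists_gt (max n₀ S.graph.numDir)
    obtain ⟨σ, hσ, ⟨f⟩⟩ := h ⟨n, hn⟩ ((le_max_left _ _).trans hn'.le)
    rw [mem_support_basicModel] at hσ
    exact f.good hκ hσ ((le_max_right _ _).trans_lt hn')
  · intro hS
    refine ⟨max (S.graph.numDir + 1) (Nat.card S.graph.V), fun n hn => ?_⟩
    have h1 : S.graph.numDir < (n : ℕ) := (le_max_left _ _).trans hn
    have h2 := expectCount_of_good hκ hS n h1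
    have h3 : ∏ v, ((n : ℕ).descFactorial (S.fibreV v) : ℝ) ≠ 0 := by
      refine Finset.prod_ne_zero_iff.2 fun v _ => ?_
      rw [Nat.cast_ne_zero, Ne, Nat.descFactorial_eq_zero_iff_lt, not_lt]
      exact (S.fibreV_le_card v).trans ((le_max_right _ _).trans hn)
    rw [← h2] at h3
    have h4 := left_ne_zero_of_mul h3
    rw [Model.expectCount, basicModel_expect] at h4
    by_contra hcon
    refine h4 ?_
    rw [Finset.sum_eq_zero, zero_div]
    intro σ hσ
    have : IsEmpty (BGraph.Embedding S σ.toBGraph) :=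
      ⟨fun f => hcon ⟨σ, (mem_support_basicModel hκ n σ).2 hσ, ⟨f⟩⟩⟩
    simp

end BasicModel

/-! ### Asymptotic expansions -/

namespace BGraph

variable {B : FinGraph.{u}}

/-- The expansion in `1 / n` of the expected number of copies of `S`, without the leading power. -/
noncomputable def expansion (κ : BasicKind) (S : BGraph B) : PowerSeries ℝ :=
  (∏ v, linBlock 1 0 (S.fibreV v)) *
    ∏ e ∈ B.reps, geomBlock (BasicKind.slope e) (κ.shift e) (S.mult e)

/-- The coefficients of the expansion of the expected number of copies of `S`. -/
noncomputable def expansionCoeff (κ : BasicKind) (S : BGraph B) (i : ℕ) : ℝ :=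
  if i < S.graph.order.toNat then 0
  else PowerSeries.coeff (i - S.graph.order.toNat) (S.expansion κ)

theorem coeff_zero_expansion (κ : BasicKind) (S : BGraph B) :
    PowerSeries.coeff 0 (S.expansion κ) = 1 := by
  rw [PowerSeries.coeff_zero_eq_constantCoeff_apply, expansion, map_mul, map_prod, map_prod,
    Finset.prod_eq_one, Finset.prod_eq_one, mul_one]
  · intro e _
    rw [← PowerSeries.coeff_zero_eq_constantCoeff_apply, coeff_zero_geomBlock]
  · intro e _
    rw [← PowerSeries.coeff_zero_eq_constantCoeff_apply, coeff_zero_linBlock]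

end BGraph

namespace BasicKind

variable {B : FinGraph.{u}} (κ : BasicKind)

theorem slope_nonneg (e : B.E) : 0 ≤ slope e := by
  rw [slope]
  split_ifs <;> norm_num

theorem slope_le (e : B.E) : slope e ≤ 2 := by
  rw [slope]
  split_ifs <;> norm_num

theorem shift_nonneg (e : B.E) : 0 ≤ κ.shift e := by
  rw [shift]
  split_ifs <;> norm_num

theorem shift_le (e : B.E) : κ.shift e ≤ 1 := by
  rw [shift]
  split_ifs <;> norm_num

end BasicKind

namespace BGraph

variable {B : FinGraph.{u}} (κ : BasicKind) (S : BGraph B)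

/-- Sum of all weights in the expansion. -/
noncomputable def expansionWeight : ℝ :=
  (∑ v, ∑ t ∈ Finset.range (S.fibreV v), ((1 : ℝ) * t + 0)) +
    ∑ e ∈ B.reps, ∑ t ∈ Finset.range (S.mult e), (BasicKind.slope e * t + κ.shift e)

/-- The sum of the expansion. -/
noncomputable def expansionFun (x : ℝ) : ℝ :=
  (∏ v, ∏ t ∈ Finset.range (S.fibreV v), (1 - ((1 : ℝ) * t + 0) * x)) *
    ∏ e ∈ B.reps, ∏ t ∈ Finset.range (S.mult e), (1 - (BasicKind.slope e * t + κ.shift e) * x)⁻¹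

theorem geomBounded_expansion :
    GeomBounded (S.expansion κ) (S.expansionWeight κ) (S.expansionFun κ) := by
  refine (GeomBounded.prod Finset.univ fun v _ => ?_).mul (GeomBounded.prod B.reps fun e _ => ?_)
  · refine GeomBounded.prod (Finset.range (S.fibreV v)) fun t _ => GeomBounded.lin ?_
    positivity
  · refine GeomBounded.prod (Finset.range (S.mult e)) fun t _ => GeomBounded.geom ?_
    exact add_nonneg (mul_nonneg (BasicKind.slope_nonneg e) (Nat.cast_nonneg t)) (κ.shift_nonneg e)

/-- A constant that depends only on `B`. -/
noncomputable def weightConst (B : FinGraph.{u}) : ℝ := Nat.card B.V + 3 * Nat.card B.E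

theorem weightConst_nonneg (B : FinGraph.{u}) : 0 ≤ weightConst B := by
  rw [weightConst]
  positivity

variable {S}

/-- A block of `m` weights in arithmetic progression adds up to at most `(slope + shift) * m ^ 2`,
and each `m` is at most `numDir`; for vertex fibres this uses prunedness. -/
theorem expansionWeight_le (hS : S.graph.Pruned) :
    S.expansionWeight κ ≤ weightConst B * (S.graph.numDir : ℝ) ^ 2 := by
  have h1 : ∀ v ∈ (Finset.univ : Finset B.V),
      ∑ t ∈ Finset.range (S.fibreV v), ((1 : ℝ) * t + 0) ≤ (S.graph.numDir : ℝ) ^ 2 := by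
    intro v _
    refine (sum_arith_le zero_le_one le_rfl _).trans ?_
    rw [add_zero, one_mul]
    have h2 : S.fibreV v ≤ S.graph.numDir := by
      have := S.fibreV_le_card v
      have := hS.two_mul_card_le
      omega
    gcongr
  have h2 : ∀ e ∈ B.reps, ∑ t ∈ Finset.range (S.mult e), (BasicKind.slope e * t + κ.shift e) ≤
      3 * (S.graph.numDir : ℝ) ^ 2 := by
    intro e _
    refine (sum_arith_le (BasicKind.slope_nonneg e) (κ.shift_nonneg e) _).trans ?_
    have h2 : S.mult e ≤ S.graph.numDir := (S.mult_le_fibreE e).trans (S.fibreE_le_numDir e)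
    have h3 : BasicKind.slope e + κ.shift e ≤ 3 := by
      linarith [BasicKind.slope_le e, κ.shift_le e]
    gcongr
  refine (add_le_add (Finset.sum_le_sum h1) (Finset.sum_le_sum h2)).trans ?_
  simp only [Finset.sum_const, nsmul_eq_mul, Finset.card_univ, weightConst, Nat.card_eq_fintype_card]
  have h3 : (B.reps.card : ℝ) ≤ Fintype.card B.E := by exact_mod_cast Finset.card_le_univ _
  nlinarith [sq_nonneg (S.graph.numDir : ℝ)]

/-- The exponent of `n` in the denominators exceeds the one in the numerators by the order. This is
the source of the leading power of `1 / n`. -/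
theorem sum_mult_eq (hS : S.graph.Pruned) :
    ∑ e ∈ B.reps, S.mult e = ∑ v, S.fibreV v + S.graph.order.toNat := by
  have h1 := hS.order_nonneg
  have h2 : S.graph.order = (S.graph.numEdges : ℤ) - (Nat.card S.graph.V : ℤ) := rfl
  rw [← S.numEdges_eq_sum, ← S.card_V_eq_sum]
  omega

theorem expansionFun_mul (hS : S.graph.Pruned) {n : ℕ} (hn : 0 < n) (hV : Nat.card S.graph.V ≤ n)
    (hD : ∀ e ∈ B.reps, κ.denom n e (S.mult e) ≠ 0) :
    (n : ℝ)⁻¹ ^ S.graph.order.toNat * S.expansionFun κ (n : ℝ)⁻¹ *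
      ∏ e ∈ B.reps, κ.denom n e (S.mult e) = ∏ v, (n.descFactorial (S.fibreV v) : ℝ) := by
  have hn' : (n : ℝ) ≠ 0 := by exact_mod_cast hn.ne'
  have h1 : ∀ v, (n.descFactorial (S.fibreV v) : ℝ) = (n : ℝ) ^ S.fibreV v *
      ∏ t ∈ Finset.range (S.fibreV v), (1 - ((1 : ℝ) * t + 0) * (n : ℝ)⁻¹) := by
    intro v
    have h2 : (n : ℝ) ^ S.fibreV v = ∏ _t ∈ Finset.range (S.fibreV v), (n : ℝ) := by simp
    rw [Nat.descFactorial_eq_prod_range, Nat.cast_prod, h2, ← Finset.prod_mul_distrib]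
    refine Finset.prod_congr rfl fun t ht => ?_
    have h3 : t ≤ n := by
      have := Finset.mem_range.1 ht
      have := S.fibreV_le_card v
      omega
    rw [Nat.cast_sub h3]
    field_simp
    ring
  have h2 : ∀ e ∈ B.reps, (∏ t ∈ Finset.range (S.mult e),
      (1 - (BasicKind.slope e * t + κ.shift e) * (n : ℝ)⁻¹)⁻¹) * κ.denom n e (S.mult e) =
      (n : ℝ) ^ S.mult e := by
    intro e he
    have h3 := hD e he
    rw [BasicKind.denom, Finset.prod_ne_zero_iff] at h3
    rw [BasicKind.denom, ← Finset.prod_mul_distrib]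
    have h4 : (n : ℝ) ^ S.mult e = ∏ _t ∈ Finset.range (S.mult e), (n : ℝ) := by simp
    rw [h4]
    refine Finset.prod_congr rfl fun t ht => ?_
    have h5 := h3 t ht
    have h6 : (n : ℝ) - (BasicKind.slope e * t + κ.shift e) =
        n * (1 - (BasicKind.slope e * t + κ.shift e) * (n : ℝ)⁻¹) := by
      field_simp
    rw [h6] at h5 ⊢
    have h7 := right_ne_zero_of_mul h5
    rw [mul_left_comm, inv_mul_cancel₀ h7, mul_one]
  rw [expansionFun, mul_assoc, mul_assoc, ← Finset.prod_mul_distrib, Finset.prod_congr rfl h2,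
    Finset.prod_congr rfl fun v _ => h1 v, Finset.prod_mul_distrib, Finset.prod_pow_eq_pow_sum,
    Finset.prod_pow_eq_pow_sum, sum_mult_eq hS, pow_add]
  have h8 : (n : ℝ)⁻¹ ^ S.graph.order.toNat * (n : ℝ) ^ S.graph.order.toNat = 1 := by
    rw [← mul_pow, inv_mul_cancel₀ hn', one_pow]
  linear_combination (n : ℝ) ^ (∑ v, S.fibreV v) *
    (∏ v, ∏ t ∈ Finset.range (S.fibreV v), (1 - ((1 : ℝ) * t + 0) * (n : ℝ)⁻¹)) * h8

theorem denom_ne_zero {n : ℕ} (hn : 2 * S.graph.numDir < n) (e : B.E) :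
    κ.denom n e (S.mult e) ≠ 0 := by
  refine Finset.prod_ne_zero_iff.2 fun t ht => ?_
  have h1 : t + 1 ≤ S.graph.numDir :=
    (Finset.mem_range.1 ht).trans_le ((S.mult_le_fibreE e).trans (S.fibreE_le_numDir e))
  have h2 : (2 * (t + 1) + 1 : ℝ) ≤ n := by
    have : 2 * (t + 1) + 1 ≤ n := by omega
    exact_mod_cast this
  have h3 := BasicKind.slope_le e
  have h4 := κ.shift_le e
  have h5 : (0 : ℝ) ≤ t := Nat.cast_nonneg t
  have h6 := mul_le_mul_of_nonneg_right h3 h5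
  linarith

theorem expectCount_eq (hκ : κ.Admissible B) (hS : S.graph.Pruned) (hgood : S.Good κ)
    (n : (basicModel B κ hκ).degrees) (hn : 2 * S.graph.numDir < (n : ℕ)) :
    (basicModel B κ hκ).expectCount S n =
      ((n : ℕ) : ℝ)⁻¹ ^ S.graph.order.toNat * S.expansionFun κ ((n : ℕ) : ℝ)⁻¹ := by
  have hD : ∀ e ∈ B.reps, κ.denom n e (S.mult e) ≠ 0 := fun e _ => denom_ne_zero κ hn e
  refine mul_right_cancel₀ (Finset.prod_ne_zero_iff.2 hD) ?_
  have := hS.two_mul_card_le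
  rw [expectCount_of_good hκ hgood n (by omega), expansionFun_mul κ hS (by omega) (by omega) hD]

/-- The prefactor `n ^ (-ord)` lets the series be cut after `r - ord` terms. The stated bound uses
the exponent `r` on a base at least one, which removes its dependence on the order. -/
theorem expansion_remainder (hκ : κ.Admissible B) (hS : S.graph.Pruned) (hgood : S.Good κ)
    (n : (basicModel B κ hκ).degrees) (hn : 2 * S.graph.numDir < (n : ℕ))
    (hw : weightConst B * (S.graph.numDir : ℝ) ^ 2 * ((n : ℕ) : ℝ)⁻¹ ≤ 1 / 2) {r : ℕ}
    (hr : S.graph.order < r) :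
    |(basicModel B κ hκ).expectCount S n -
      ∑ i ∈ Finset.range r, S.expansionCoeff κ i / ((n : ℕ) : ℝ) ^ i| ≤
      2 * (1 + weightConst B * (S.graph.numDir : ℝ) ^ 2) ^ r / ((n : ℕ) : ℝ) ^ r := by
  set x : ℝ := ((n : ℕ) : ℝ)⁻¹ with hx
  set o := S.graph.order.toNat with ho
  have hx0 : 0 ≤ x := by positivity
  have hor : o ≤ r := by
    have := hS.order_nonneg
    omega
  obtain ⟨R, rfl⟩ := Nat.exists_eq_add_of_le hor
  have hwt := expansionWeight_le κ hS
  have hG := S.geomBounded_expansion κ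
  have hsx : S.expansionWeight κ * x ≤ 1 / 2 :=
    (mul_le_mul_of_nonneg_right hwt hx0).trans hw
  have hrem := hG.remainder hx0 hsx R
  have hsum : ∑ i ∈ Finset.range (o + R), S.expansionCoeff κ i / ((n : ℕ) : ℝ) ^ i =
      x ^ o * ∑ i ∈ Finset.range R, PowerSeries.coeff i (S.expansion κ) * x ^ i := by
    rw [Finset.sum_range_add, Finset.sum_eq_zero, zero_add, Finset.mul_sum]
    · refine Finset.sum_congr rfl fun i _ => ?_
      rw [expansionCoeff, if_neg (by omega), ← ho, Nat.add_sub_cancel_left, div_eq_mul_inv,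
        ← inv_pow, ← hx, pow_add]
      ring
    · intro i hi
      rw [expansionCoeff, if_pos (Finset.mem_range.1 hi), zero_div]
  rw [hsum, expectCount_eq κ hκ hS hgood n hn, ← mul_sub, abs_mul, abs_of_nonneg (pow_nonneg hx0 _),
    div_eq_mul_inv, ← inv_pow, ← hx]
  have h1 : (S.expansionWeight κ) ^ R ≤
      (1 + weightConst B * (S.graph.numDir : ℝ) ^ 2) ^ (o + R) := by
    have h2 : 0 ≤ weightConst B * (S.graph.numDir : ℝ) ^ 2 :=
      mul_nonneg (weightConst_nonneg B) (sq_nonneg _)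
    calc (S.expansionWeight κ) ^ R ≤ (1 + weightConst B * (S.graph.numDir : ℝ) ^ 2) ^ R :=
          pow_le_pow_left₀ hG.nonneg (by linarith) _
      _ ≤ _ := pow_le_pow_right₀ (by linarith) (by omega)
  calc x ^ o * |S.expansionFun κ x - ∑ i ∈ Finset.range R, PowerSeries.coeff i (S.expansion κ) * x ^ i|
      ≤ x ^ o * (2 * (S.expansionWeight κ * x) ^ R) :=
        mul_le_mul_of_nonneg_left hrem (pow_nonneg hx0 _)
    _ = 2 * (S.expansionWeight κ) ^ R * x ^ (o + R) := by
        rw [mul_pow, pow_add]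
        ring
    _ ≤ _ := by gcongr

end BGraph

theorem isOfGrowth_polynomial_pow {K : ℝ} (hK : 0 ≤ K) (r : ℕ) :
    IsOfGrowth (fun k => 2 * (1 + K * (2 * (k : ℝ)) ^ 2) ^ r) 1 := by
  refine (IsOfGrowth.pow (2 * r)).of_isBigO (IsBigO.of_bound (2 * (1 + 4 * K) ^ r) ?_)
  filter_upwards [eventually_ge_atTop 1] with k hk
  have hk' : (1 : ℝ) ≤ k := by exact_mod_cast hk
  rw [Real.norm_of_nonneg (by positivity), Real.norm_of_nonneg (by positivity), mul_assoc]
  refine mul_le_mul_of_nonneg_left ?_ (by norm_num)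
  rw [pow_mul, ← mul_pow]
  refine pow_le_pow_left₀ (by positivity) ?_ _
  nlinarith

section BasicModel

variable {B : FinGraph.{u}} {κ : BasicKind} (hκ : κ.Admissible B)

theorem basicModel_hasExpansions :
    (basicModel B κ hκ).HasExpansions (BGraph.expansionCoeff κ) := by
  intro r _
  set K := BGraph.weightConst B with hK
  have hK0 : 0 ≤ K := BGraph.weightConst_nonneg B
  -- The constant `C = 2 K + 3` serves two purposes: `2 K ≤ C ^ 2` gives weight at most `n / 2`, and
  -- `C ≥ 3` gives `2 * numDir < n`. The function `g` bounds `numDir` by twice the number of edges.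
  refine ⟨fun k => 2 * (1 + K * (2 * (k : ℝ)) ^ 2) ^ r, 2 * K + 3, isOfGrowth_polynomial_pow hK0 r,
    by positivity, fun S hS hr => ?_⟩
  have hsize : ∀ n : (basicModel B κ hκ).degrees,
      (S.graph.numDir : ℝ) ≤ Real.sqrt (n : ℕ) / (2 * K + 3) →
      ((2 * K + 3) * S.graph.numDir) ^ 2 ≤ ((n : ℕ) : ℝ) := by
    intro n h
    rw [le_div_iff₀ (by positivity), mul_comm] at h
    have := pow_le_pow_left₀ (by positivity) h 2
    rwa [Real.sq_sqrt (Nat.cast_nonneg _)] at this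
  have hsize2 : ∀ n : (basicModel B κ hκ).degrees,
      (S.graph.numDir : ℝ) ≤ Real.sqrt (n : ℕ) / (2 * K + 3) →
      2 * S.graph.numDir < (n : ℕ) := by
    intro n h
    have h1 := hsize n h
    have hn : 0 < (n : ℕ) := (basicModel B κ hκ).pos_of_mem n n.2
    rcases Nat.eq_zero_or_pos S.graph.numDir with h0 | h0
    · omega
    · have h2 : (1 : ℝ) ≤ S.graph.numDir := by exact_mod_cast h0
      have h3 : (3 * (S.graph.numDir : ℝ)) ^ 2 ≤ ((2 * K + 3) * S.graph.numDir) ^ 2 := by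
        gcongr
        linarith
      have h4 : 2 * (S.graph.numDir : ℝ) < (n : ℕ) := by nlinarith
      exact_mod_cast h4
  rw [occurs_iff_good]
  refine ⟨fun hgood => ⟨fun n _ hn => ?_, fun i hi => ?_, fun i hi => ?_⟩, fun hgood n hn => ?_⟩
  · have hn0 : 0 < ((n : ℕ) : ℝ) := by exact_mod_cast (basicModel B κ hκ).pos_of_mem n n.2
    refine (BGraph.expansion_remainder κ hκ hS hgood n (hsize2 n hn) ?_ hr).trans ?_
    · rw [← div_eq_mul_inv, div_le_iff₀ hn0]
      have := hsize n hn
      have h5 : 2 * K ≤ (2 * K + 3) ^ 2 := by nlinarith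
      have h6 := mul_le_mul_of_nonneg_right h5 (sq_nonneg (S.graph.numDir : ℝ))
      rw [mul_pow] at this
      linarith
    · refine div_le_div_of_nonneg_right ?_ (by positivity)
      rw [abs_of_nonneg (by positivity)]
      have h7 : (S.graph.numDir : ℝ) ≤ 2 * S.graph.numEdges := by exact_mod_cast S.graph.numDir_le
      have h8 : 2 * (1 + K * (S.graph.numDir : ℝ) ^ 2) ^ r ≤
          2 * (1 + K * (2 * (S.graph.numEdges : ℝ)) ^ 2) ^ r := by gcongr
      refine h8.trans (le_mul_of_one_le_left (by positivity) ?_)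
      linarith
  · rw [BGraph.expansionCoeff, if_pos]
    omega
  · rw [BGraph.expansionCoeff, if_neg (by omega), ← hi, Int.toNat_natCast, Nat.sub_self,
      BGraph.coeff_zero_expansion]
    exact one_pos
  · have := hsize2 n hn
    exact expectCount_of_not_good hκ hgood n (by omega)

theorem basicModel_cycleCoeff : (basicModel B κ hκ).CycleCoeff (BGraph.expansionCoeff κ) := by
  intro S hS _
  rw [BGraph.expansionCoeff, hS.2.2]
  simp [BGraph.coeff_zero_expansion]

end BasicModel

/-! ### Counting non-backtracking words -/

namespace FinGraph

variable (B : FinGraph.{u})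

/-- The words of non-backtracking walks with `k + 1` steps from `b` to `b'`. -/
noncomputable def nbWords : ℕ → B.E → B.E → Finset (List B.E)
  | 0, b, b' => if b = b' then {[b]} else ∅
  | k + 1, b, b' => (Finset.univ.filter fun c => B.NBStep b c).biUnion fun c =>
      (nbWords k c b').image (List.cons b)

theorem mem_nbWords (k : ℕ) : ∀ (b b' : B.E) (w : List B.E), w ∈ B.nbWords k b b' ↔
    IsNBWord B w ∧ w.head? = some b ∧ w.getLast? = some b' ∧ w.length = k + 1 := by
  induction k with
  | zero =>
    intro b b' w
    rw [nbWords]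
    constructor
    · intro h
      split_ifs at h with hb
      · rw [Finset.mem_singleton.1 h]
        simp [IsNBWord, hb]
      · simp at h
    · rintro ⟨-, h1, h2, h3⟩
      obtain ⟨c, rfl⟩ := List.length_eq_one_iff.1 h3
      simp only [List.head?_cons, Option.some.injEq, List.getLast?_singleton] at h1 h2
      subst h1 h2
      simp
  | succ k ih =>
    intro b b' w
    rw [nbWords]
    simp only [Finset.mem_biUnion, Finset.mem_filter, Finset.mem_univ, true_and, Finset.mem_image, ih]
    constructor
    · rintro ⟨c, hc, l, ⟨⟨h1, h2⟩, h3, h4, h5⟩, rfl⟩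
      refine ⟨⟨by simp, ?_⟩, by simp, ?_, by simp [h5]⟩
      · rw [List.isChain_cons]
        refine ⟨fun y hy => ?_, h2⟩
        rw [h3] at hy
        rwa [← Option.some.inj hy]
      · rw [List.getLast?_cons, h4]
        rfl
    · rintro ⟨⟨h1, h2⟩, h3, h4, h5⟩
      rcases w with _ | ⟨x, _ | ⟨y, l⟩⟩
      · simp at h1
      · simp at h5
      · simp only [List.head?_cons, Option.some.injEq] at h3
        subst h3
        rw [List.isChain_cons_cons] at h2
        refine ⟨y, h2.1, y :: l, ⟨⟨by simp, h2.2⟩, by simp, ?_, by simpa using h5⟩, rfl⟩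
        rw [← h4, List.getLast?_cons_cons]

theorem card_nbWords (k : ℕ) : ∀ b b' : B.E,
    ((B.nbWords k b b').card : ℂ) = (B.hashimoto ^ k) b b' := by
  induction k with
  | zero =>
    intro b b'
    rw [nbWords, pow_zero, Matrix.one_apply]
    split_ifs <;> simp
  | succ k ih =>
    intro b b'
    rw [nbWords, Finset.card_biUnion]
    · rw [pow_succ', Matrix.mul_apply, Nat.cast_sum, Finset.sum_filter]
      refine Finset.sum_congr rfl fun c _ => ?_
      rw [Finset.card_image_of_injective _ List.cons_injective, ih, hashimoto, Matrix.of_apply]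
      split_ifs <;> simp
    -- Words with different second letters are different.
    · intro c _ c' _ hcc
      rw [Function.onFun, Finset.disjoint_left]
      intro w h1 h2
      obtain ⟨l, hl, rfl⟩ := Finset.mem_image.1 h1
      obtain ⟨l', hl', h⟩ := Finset.mem_image.1 h2
      obtain rfl := List.cons_injective h
      rw [mem_nbWords] at hl hl'
      exact hcc (Option.some.inj (hl.2.1.symm.trans hl'.2.1))

/-- The number of words of non-backtracking walks of length `k`. -/
noncomputable def numNBWords (k : ℕ) : ℕ := ∑ b, ∑ b', (B.nbWords (k - 1) b b').card

theorem isOfGrowth_card_nbWords (b b' : B.E) :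
    IsOfGrowth (fun k => ((B.nbWords (k - 1) b b').card : ℝ)) B.mu1 := by
  intro ε hε
  have h1 := (B.hashimoto_pow_isLittleO b b' hε).comp_tendsto (tendsto_sub_atTop_nat 1)
  have h2 : (fun k : ℕ => (B.mu1 + ε) ^ (k - 1)) =O[atTop] fun k : ℕ => (B.mu1 + ε) ^ k := by
    have hpos : 0 < B.mu1 + ε := by
      have := B.mu1_nonneg
      linarith
    refine IsBigO.of_bound (B.mu1 + ε)⁻¹ ?_
    filter_upwards [eventually_ge_atTop 1] with k hk
    obtain ⟨k, rfl⟩ := Nat.exists_eq_add_of_le' hk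
    rw [Nat.add_sub_cancel, Real.norm_of_nonneg (by positivity), Real.norm_of_nonneg (by positivity),
      pow_succ]
    field_simp
    exact le_rfl
  refine IsLittleO.of_norm_left ((h1.trans_isBigO h2).norm_left.congr_left fun k => ?_)
  rw [Function.comp_apply, ← card_nbWords]
  simp

theorem isOfGrowth_numNBWords : IsOfGrowth (fun k => (B.numNBWords k : ℝ)) B.mu1 := by
  intro ε hε
  simp only [numNBWords, Nat.cast_sum]
  exact IsLittleO.fun_sum fun b _ => IsLittleO.fun_sum fun b' _ => B.isOfGrowth_card_nbWords b b' ε hε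

/-- A whole-loop can be repeated, so there is a non-backtracking word of every length; with `mu1 <
1` the number of words would tend to zero. -/
theorem one_le_mu1 {b : B.E} (hb : B.IsWholeLoop b) : 1 ≤ B.mu1 := by
  by_contra hlt
  push Not at hlt
  have hstep : B.NBStep b b := ⟨hb.2, hb.1⟩
  have hpos : ∀ k, 1 ≤ (B.nbWords k b b).card := by
    intro k
    rw [Nat.one_le_iff_ne_zero, ← Nat.pos_iff_ne_zero, Finset.card_pos]
    induction k with
    | zero => exact ⟨[b], by simp [nbWords]⟩
    | succ k ih =>
      obtain ⟨w, hw⟩ := ih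
      refine ⟨b :: w, ?_⟩
      rw [nbWords, Finset.mem_biUnion]
      exact ⟨b, by simpa using hstep, Finset.mem_image_of_mem _ hw⟩
  have h := B.isOfGrowth_card_nbWords b b ((1 - B.mu1) / 2) (by linarith)
  have h0 := B.mu1_nonneg
  have hbound := h.bound (c := 1) one_pos
  have hlim : Tendsto (fun k : ℕ => (B.mu1 + (1 - B.mu1) / 2) ^ k) atTop (nhds 0) :=
    tendsto_pow_atTop_nhds_zero_of_lt_one (by linarith) (by linarith)
  have hev := hlim.eventually (gt_mem_nhds (show (0 : ℝ) < 1 by norm_num))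
  obtain ⟨k, hk1, hk2⟩ := (hbound.and hev).exists
  have h3 : (1 : ℝ) ≤ (B.nbWords (k - 1) b b).card := by exact_mod_cast hpos (k - 1)
  rw [one_mul, Real.norm_of_nonneg (by positivity), Real.norm_of_nonneg (pow_nonneg (by linarith) _)]
    at hk1
  linarith

end FinGraph

/-! ### Exploring a cover along a walk -/

section AddPair

variable {α : Type*} {F F' : Finset (α × α)} {i j : α}

theorem card_of_mem_iff_or {γ : Type*} {F F' : Finset γ} {p : γ} (hp : p ∉ F)
    (h : ∀ q, q ∈ F' ↔ q ∈ F ∨ q = p) : F'.card = F.card + 1 := by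
  rw [← Finset.card_insert_of_notMem hp]
  congr 1
  ext q
  rw [h, Finset.mem_insert, or_comm]

/-- Either one diagonal pair is added, counted in both summands, or two opposite pairs, counted in
the first only. Hence `relMult` at a half-loop grows by exactly one. -/
theorem card_add_diagCount_of_mem_iff (hF : IsSymmRel F) (hp : (i, j) ∉ F)
    (h : ∀ q, q ∈ F' ↔ q ∈ F ∨ q = (i, j) ∨ q = (j, i)) :
    F'.card + diagCount F' = F.card + diagCount F + 2 := by
  by_cases hij : i = j
  · subst hij
    have h' : ∀ q, q ∈ F' ↔ q ∈ F ∨ q = (i, i) := fun q => by rw [h, or_self]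
    have h1 := card_of_mem_iff_or hp h'
    have h2 : diagCount F' = diagCount F + 1 := by
      refine card_of_mem_iff_or (p := (i, i)) (fun hq => hp (Finset.mem_filter.1 hq).1) fun q => ?_
      rw [Finset.mem_filter, Finset.mem_filter, h']
      constructor
      · rintro ⟨h1 | h1, h2⟩
        · exact Or.inl ⟨h1, h2⟩
        · exact Or.inr h1
      · rintro (⟨h1, h2⟩ | rfl)
        · exact ⟨Or.inl h1, h2⟩
        · exact ⟨Or.inr rfl, rfl⟩
    omega
  · have h1 := card_of_mem_iff_or (F := insert (i, j) F) (p := (j, i)) (F' := F') (by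
      rw [Finset.mem_insert, not_or]
      refine ⟨fun h => hij (congrArg Prod.snd h), fun h => hp (hF _ h)⟩) fun q => by
        rw [h, Finset.mem_insert]
        tauto
    have h2 : diagCount F' = diagCount F := by
      rw [diagCount, diagCount]
      congr 1
      ext q
      rw [Finset.mem_filter, Finset.mem_filter, h]
      constructor
      · rintro ⟨h1 | rfl | rfl, h2⟩
        · exact ⟨h1, h2⟩
        · exact absurd h2 hij
        · exact absurd h2.symm hij
      · rintro ⟨h1, h2⟩
        exact ⟨Or.inl h1, h2⟩
    rw [Finset.card_insert_of_notMem hp] at h1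
    omega

end AddPair

namespace BasicKind

variable {B : FinGraph.{u}} {κ : BasicKind} {n : ℕ}

/-- The constraints `F` together with `σ e i = j`. -/
noncomputable def addRel (F : B.E → Finset (Fin n × Fin n)) (e : B.E) (i j : Fin n) (b : B.E) :
    Finset (Fin n × Fin n) :=
  F b ∪ ((if b = e then {(i, j)} else ∅) ∪ if b = B.inv e then {(j, i)} else ∅)

theorem mem_addRel {F : B.E → Finset (Fin n × Fin n)} {e : B.E} {i j : Fin n} {b : B.E}
    {p : Fin n × Fin n} : p ∈ addRel F e i j b ↔
      p ∈ F b ∨ (b = e ∧ p = (i, j)) ∨ (b = B.inv e ∧ p = (j, i)) := by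
  rw [addRel, Finset.mem_union, Finset.mem_union]
  refine or_congr Iff.rfl (or_congr ?_ ?_) <;> split_ifs with h <;> simp [h]

theorem IsCompatible.addRel {F : B.E → Finset (Fin n × Fin n)} (hF : IsCompatible F) (e : B.E)
    (i j : Fin n) : IsCompatible (addRel F e i j) := by
  intro b p hp
  rw [mem_addRel] at hp ⊢
  rcases hp with h | ⟨rfl, rfl⟩ | ⟨rfl, rfl⟩
  · exact Or.inl (hF b p h)
  · exact Or.inr (Or.inr ⟨rfl, rfl⟩)
  · exact Or.inr (Or.inl ⟨B.inv_inv e, rfl⟩)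

theorem card_addRel_le (F : B.E → Finset (Fin n × Fin n)) (e : B.E) (i j : Fin n) (b : B.E) :
    (addRel F e i j b).card ≤ (F b).card + 2 := by
  refine (Finset.card_union_le _ _).trans (Nat.add_le_add_left ((Finset.card_union_le _ _).trans ?_) _)
  have : ∀ (P : Prop) [Decidable P] (p : Fin n × Fin n),
      (if P then ({p} : Finset (Fin n × Fin n)) else ∅).card ≤ 1 := by
    intro P _ p
    split_ifs <;> simp
  exact Nat.add_le_add (this _ _) (this _ _)

theorem subset_addRel (F : B.E → Finset (Fin n × Fin n)) (e : B.E) (i j : Fin n) (b : B.E) :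
    F b ⊆ addRel F e i j b := Finset.subset_union_left

theorem ext_addRel_iff {F : B.E → Finset (Fin n × Fin n)} {e : B.E} {i j : Fin n} {σ : Coord B n} :
    (∀ b, ∀ p ∈ addRel F e i j b, σ.1 b p.1 = p.2) ↔
      (∀ b, ∀ p ∈ F b, σ.1 b p.1 = p.2) ∧ σ.1 e i = j := by
  constructor
  · intro h
    exact ⟨fun b p hp => h b p (subset_addRel F e i j b hp),
      h e (i, j) (mem_addRel.2 (Or.inr (Or.inl ⟨rfl, rfl⟩)))⟩
  · rintro ⟨h1, h2⟩ b p hp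
    rcases mem_addRel.1 hp with h | ⟨rfl, rfl⟩ | ⟨rfl, rfl⟩
    · exact h1 b p h
    · exact h2
    · simp only [σ.2]
      exact Equiv.Perm.inv_eq_iff_eq.2 h2.symm

theorem sum_covCount_addRel (F : B.E → Finset (Fin n × Fin n)) (e : B.E) (i : Fin n) :
    ∑ j, covCount κ (addRel F e i j) = covCount κ F := by
  rw [covCount, Finset.card_eq_sum_card_fiberwise (f := fun σ : Coord B n => σ.1 e i)
    (t := Finset.univ) (fun _ _ => Finset.mem_coe.2 (Finset.mem_univ _))]
  refine Finset.sum_congr rfl fun j _ => ?_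
  rw [covCount, Finset.filter_filter]
  congr 1
  ext σ
  rw [Finset.mem_filter, Finset.mem_filter, ext_addRel_iff]

/-- There is exactly one representative at which a new constraint counts. -/
theorem exists_relMult_addRel {F : B.E → Finset (Fin n × Fin n)} (hF : IsCompatible F) {e : B.E}
    {i j : Fin n} (hp : (i, j) ∉ F e) :
    ∃ e₀ ∈ B.reps, relMult e₀ (addRel F e i j e₀) = relMult e₀ (F e₀) + 1 ∧
      ∀ b ∈ B.reps, b ≠ e₀ → relMult b (addRel F e i j b) = relMult b (F b) := by
  have hother : ∀ b, b ≠ e → b ≠ B.inv e → addRel F e i j b = F b := by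
    intro b h1 h2
    ext p
    rw [mem_addRel]
    simp [h1, h2]
  by_cases he : B.IsHalfLoop e
  · have he' : B.inv e = e := he
    refine ⟨e, B.mem_reps_of_halfLoop he, ?_, fun b _ hb => ?_⟩
    · have h1 := two_mul_relMult he (hF.isSymmRel he)
      have h2 := two_mul_relMult he ((hF.addRel e i j).isSymmRel he)
      have h3 := card_add_diagCount_of_mem_iff (F' := addRel F e i j e) (hF.isSymmRel he) hp
        fun q => by rw [mem_addRel]; simp [he']
      omega
    · rw [hother b hb (by rwa [he'])]
  · have hne : B.inv e ≠ e := he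
    have hp' : (j, i) ∉ F (B.inv e) := by
      intro h
      have := hF _ _ h
      rw [B.inv_inv] at this
      exact hp this
    have hhi : ¬ B.IsHalfLoop (B.inv e) := by
      intro h
      have h' : B.inv (B.inv e) = B.inv e := h
      rw [B.inv_inv] at h'
      exact he h'.symm
    have hrel : ∀ b, ¬ B.IsHalfLoop b → ∀ G : Finset (Fin n × Fin n), relMult b G = G.card :=
      fun b hb G => if_neg hb
    have hone : relMult e (addRel F e i j e) = relMult e (F e) + 1 := by
      rw [hrel e he, hrel e he]
      refine card_of_mem_iff_or hp fun q => ?_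
      rw [mem_addRel]
      simp [hne.symm]
    have htwo : relMult (B.inv e) (addRel F e i j (B.inv e)) = relMult (B.inv e) (F (B.inv e)) + 1 := by
      rw [hrel _ hhi, hrel _ hhi]
      refine card_of_mem_iff_or hp' fun q => ?_
      rw [mem_addRel]
      simp [hne]
    rcases B.mem_reps_or e with h | h
    · refine ⟨e, h, hone, fun b hb hbe => ?_⟩
      rw [hother b hbe]
      rintro rfl
      exact he (B.eq_of_mem_reps h hb)
    · refine ⟨B.inv e, h, htwo, fun b hb hbe => ?_⟩
      rw [hother b _ hbe]
      rintro rfl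
      exact he (B.eq_of_mem_reps hb h)

theorem sum_relMult_addRel {F : B.E → Finset (Fin n × Fin n)} (hF : IsCompatible F) {e : B.E}
    {i j : Fin n} (hp : (i, j) ∉ F e) :
    ∑ b ∈ B.reps, relMult b (addRel F e i j b) = ∑ b ∈ B.reps, relMult b (F b) + 1 := by
  obtain ⟨e₀, h0, h1, h2⟩ := exists_relMult_addRel hF hp
  rw [← Finset.add_sum_erase _ _ h0, ← Finset.add_sum_erase _ _ h0, h1,
    Finset.sum_congr rfl fun b hb => h2 b (Finset.mem_of_mem_erase hb) (Finset.ne_of_mem_erase hb)]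
  ring

/-- A new constraint is satisfied with conditional probability at most `2 / n`. -/
theorem covCount_addRel_le (hκ : κ.Admissible B) (hn : n ∈ κ.degrees) {s : ℕ} (hs : 4 * (s + 1) ≤ n)
    {F : B.E → Finset (Fin n × Fin n)} (hF : IsCompatible F) (hcard : ∀ b, (F b).card ≤ 2 * s)
    {e : B.E} {i j : Fin n} (hp : (i, j) ∉ F e) :
    (covCount κ (addRel F e i j) : ℝ) ≤ 2 / n * covCount κ F := by
  have hn0 : (0 : ℝ) < n := by exact_mod_cast κ.pos_of_mem_degrees n hn
  by_cases h0 : covCount κ (addRel F e i j) = 0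
  · rw [h0, Nat.cast_zero]
    positivity
  have hcard' : ∀ b, (addRel F e i j b).card < n := fun b => by
    have := card_addRel_le F e i j b
    have := hcard b
    omega
  have hgood := relGood_of_covCount_ne_zero hκ hcard' h0
  have hgoodF : ∀ b, RelGood κ b (F b) := fun b => (hgood b).mono (subset_addRel F e i j b)
  have h1 := covCount_mul hκ hn (hF.addRel e i j) hcard' hgood
  have h2 := covCount_mul hκ hn hF (fun b => by have := hcard b; omega) hgoodF
  obtain ⟨e₀, he₀, h3, h4⟩ := exists_relMult_addRel hF hp
  -- The two denominators differ in the single factor that belongs to the new constraint; its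
  -- reciprocal is the conditional probability.
  have h5 : ∏ b ∈ B.reps, denom κ n b (relMult b (addRel F e i j b)) =
      (∏ b ∈ B.reps, denom κ n b (relMult b (F b))) *
        ((n : ℝ) - (slope e₀ * relMult e₀ (F e₀) + shift κ e₀)) := by
    rw [← Finset.mul_prod_erase _ _ he₀, ← Finset.mul_prod_erase _ (fun b => denom κ n b (relMult b (F b))) he₀,
      h3, Finset.prod_congr rfl fun b hb => by
        rw [h4 b (Finset.mem_of_mem_erase hb) (Finset.ne_of_mem_erase hb)]]
    rw [denom, Finset.prod_range_succ, ← denom]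
    ring
  have hP : (∏ b ∈ B.reps, denom κ n b (relMult b (F b))) ≠ 0 := by
    intro h
    rw [h, mul_zero] at h2
    have := κ.atoms_nonempty B n hn
    exact (Finset.card_pos.2 this).ne' (by exact_mod_cast h2.symm)
  have h6 : (covCount κ (addRel F e i j) : ℝ) *
      ((n : ℝ) - (slope e₀ * relMult e₀ (F e₀) + shift κ e₀)) = covCount κ F := by
    refine mul_right_cancel₀ hP ?_
    rw [h2, ← h1, h5]
    ring
  -- At a half-loop this uses that there is at most one diagonal pair. Together with `4 * (s + 1) ≤
  -- n`, the factor is at least `n / 2`.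
  have h7 : slope e₀ * relMult e₀ (F e₀) + shift κ e₀ ≤ 2 * s + 2 := by
    by_cases hh : B.IsHalfLoop e₀
    · have h8 := two_mul_relMult hh (hF.isSymmRel hh)
      have h9 := ((hgoodF e₀).2.1 hh).2
      have h10 : 2 * relMult e₀ (F e₀) ≤ 2 * s + 1 := by
        have := hcard e₀
        omega
      have h11 : (2 : ℝ) * relMult e₀ (F e₀) ≤ 2 * s + 1 := by exact_mod_cast h10
      rw [slope, if_pos hh]
      linarith [κ.shift_le e₀]
    · rw [slope, if_neg hh, relMult, if_neg hh]
      have h11 : ((F e₀).card : ℝ) ≤ 2 * s := by exact_mod_cast hcard e₀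
      linarith [κ.shift_le e₀]
  have h8 : (4 : ℝ) * (s + 1) ≤ n := by exact_mod_cast hs
  have h9 : (n : ℝ) / 2 ≤ (n : ℝ) - (slope e₀ * relMult e₀ (F e₀) + shift κ e₀) := by linarith
  rw [div_mul_eq_mul_div, le_div_iff₀ hn0, ← h6]
  have h10 : (0 : ℝ) ≤ covCount κ (addRel F e i j) := Nat.cast_nonneg _
  nlinarith

/-- The number of steps of the walk from `v` along a word that discover an edge leading to a vertex
that is already known; `F` and `U` are the known edges and vertices. -/
noncomputable def coincidences (σ : Coord B n) :
    List B.E → Fin n → (B.E → Finset (Fin n × Fin n)) → Finset (B.V × Fin n) → ℕ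
  | [], _, _, _ => 0
  | e :: l, v, F, U =>
    if ∃ p ∈ F e, p.1 = v then coincidences σ l (σ.1 e v) F U
    else (if (B.head e, σ.1 e v) ∈ U then 1 else 0) +
      coincidences σ l (σ.1 e v) (addRel F e v (σ.1 e v)) (insert (B.head e, σ.1 e v) U)

/-- The number of covers satisfying given constraints for which the walk has many coincidences. -/
noncomputable def coinCount (κ : BasicKind) (F : B.E → Finset (Fin n × Fin n)) (c : ℕ) (l : List B.E)
    (v : Fin n) (U : Finset (B.V × Fin n)) : ℕ :=
  ((κ.atoms B n).filter fun σ => (∀ b, ∀ p ∈ F b, σ.1 b p.1 = p.2) ∧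
    c ≤ coincidences σ l v F U).card

theorem coinCount_le_covCount (F : B.E → Finset (Fin n × Fin n)) (c : ℕ) (l : List B.E)
    (v : Fin n) (U : Finset (B.V × Fin n)) : coinCount κ F c l v U ≤ covCount κ F :=
  Finset.card_le_card fun σ hσ => by
    rw [Finset.mem_filter] at hσ ⊢
    exact ⟨hσ.1, hσ.2.1⟩

theorem coinCount_cons_of_mem {F : B.E → Finset (Fin n × Fin n)} {c : ℕ} {e : B.E} {l : List B.E}
    {v j : Fin n} {U : Finset (B.V × Fin n)} (h : (v, j) ∈ F e) :
    coinCount κ F c (e :: l) v U = coinCount κ F c l j U := by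
  rw [coinCount, coinCount]
  congr 1
  refine Finset.filter_congr fun σ _ => and_congr_right fun hσ => ?_
  rw [coincidences, if_pos ⟨_, h, rfl⟩, hσ e _ h]

/-- The undetermined value is revealed; if it leads to a known vertex, one coincidence fewer remains
to be found. -/
theorem coinCount_cons_of_notMem {F : B.E → Finset (Fin n × Fin n)} {c : ℕ} {e : B.E} {l : List B.E}
    {v : Fin n} {U : Finset (B.V × Fin n)} (h : ¬ ∃ p ∈ F e, p.1 = v) :
    coinCount κ F (c + 1) (e :: l) v U =
      ∑ j, coinCount κ (addRel F e v j) (if (B.head e, j) ∈ U then c else c + 1) l j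
        (insert (B.head e, j) U) := by
  rw [coinCount, Finset.card_eq_sum_card_fiberwise (f := fun σ : Coord B n => σ.1 e v)
    (t := Finset.univ) (fun _ _ => Finset.mem_coe.2 (Finset.mem_univ _))]
  refine Finset.sum_congr rfl fun j _ => ?_
  rw [coinCount, Finset.filter_filter]
  congr 1
  refine Finset.filter_congr fun σ _ => ?_
  rw [ext_addRel_iff, and_assoc, and_assoc]
  refine and_congr_right fun _ => ?_
  rw [and_comm]
  refine and_congr_right fun hj => ?_
  rw [coincidences, if_neg h, hj]
  split_ifs <;> omega

/-- A union bound over the steps at which coincidences happen. Here `s` is the number of steps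
already made: each adds at most two pairs to a fibre of `F` and one vertex to `U`. So a new edge
hits `U` with conditional probability at most `q`: at most `k + 1` targets, each with probability at
most `2 / n`. -/
theorem coinCount_le (hκ : κ.Admissible B) (hn : n ∈ κ.degrees) {k : ℕ} (hk : 4 * k ≤ n)
    (l : List B.E) : ∀ (s c : ℕ) (F : B.E → Finset (Fin n × Fin n)) (U : Finset (B.V × Fin n))
      (v : Fin n), s + l.length ≤ k → IsCompatible F → (∀ b, (F b).card ≤ 2 * s) →
      U.card ≤ s + 1 →
      (coinCount κ F c l v U : ℝ) ≤ covCount κ F * (l.length * ((k + 1) * (2 / n))) ^ c := by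
  have hn0 : (0 : ℝ) < n := by exact_mod_cast κ.pos_of_mem_degrees n hn
  set q : ℝ := (k + 1) * (2 / n) with hq
  have hq0 : 0 ≤ q := by positivity
  induction l with
  | nil =>
    intro s c F U v _ _ _ _
    rcases c with _ | c
    · simpa using coinCount_le_covCount F 0 [] v U
    · have : coinCount κ F (c + 1) [] v U = 0 := by
        rw [coinCount, Finset.card_eq_zero, Finset.filter_eq_empty_iff]
        rintro σ _ ⟨_, h⟩
        simp [coincidences] at h
      rw [this]
      simp
  | cons e l ih =>
    intro s c F U v hlen hF hcard hU
    rw [List.length_cons] at hlen ⊢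
    rcases c with _ | c
    · simpa using coinCount_le_covCount F 0 (e :: l) v U
    have hcov : (0 : ℝ) ≤ covCount κ F := Nat.cast_nonneg _
    have hl0 : (0 : ℝ) ≤ l.length := Nat.cast_nonneg _
    by_cases hdet : ∃ p ∈ F e, p.1 = v
    · obtain ⟨⟨v', j⟩, hp, rfl⟩ := hdet
      rw [coinCount_cons_of_mem hp]
      refine (ih s (c + 1) F U j (by omega) hF hcard hU).trans ?_
      push_cast
      gcongr
      linarith
    · rw [coinCount_cons_of_notMem hdet]
      set Q : ℝ := l.length * q with hQ
      have hQ0 : 0 ≤ Q := mul_nonneg hl0 hq0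
      -- The first summand is kept even for known vertices, so that summing it over all `j` gives
      -- `covCount κ F` exactly.
      have hbound : ∀ j, (coinCount κ (addRel F e v j) (if (B.head e, j) ∈ U then c else c + 1) l j
          (insert (B.head e, j) U) : ℝ) ≤ covCount κ (addRel F e v j) * Q ^ (c + 1) +
            if (B.head e, j) ∈ U then 2 / n * covCount κ F * Q ^ c else 0 := by
        intro j
        have hp : (v, j) ∉ F e := fun h => hdet ⟨_, h, rfl⟩
        have h1 := ih (s + 1) (if (B.head e, j) ∈ U then c else c + 1) (addRel F e v j)
          (insert (B.head e, j) U) j (by omega) (hF.addRel e v j) (fun b => by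
            have := card_addRel_le F e v j b
            have := hcard b
            omega) ((Finset.card_insert_le _ _).trans (by omega))
        have h2 := covCount_addRel_le hκ hn (s := s) (by omega) hF hcard hp
        refine h1.trans ?_
        have h3 : (0 : ℝ) ≤ covCount κ (addRel F e v j) := Nat.cast_nonneg _
        split_ifs with hU'
        · have h4 := mul_le_mul_of_nonneg_right h2 (pow_nonneg hQ0 c)
          have h5 : 0 ≤ (covCount κ (addRel F e v j) : ℝ) * Q ^ (c + 1) := by positivity
          linarith
        · rw [add_zero]
      rw [Nat.cast_sum]
      refine (Finset.sum_le_sum fun j _ => hbound j).trans ?_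
      rw [Finset.sum_add_distrib, ← Finset.sum_mul, ← Nat.cast_sum, sum_covCount_addRel,
        ← Finset.sum_filter, Finset.sum_const, nsmul_eq_mul]
      have hcardU : ((Finset.univ.filter fun j => (B.head e, j) ∈ U).card : ℝ) ≤ k + 1 := by
        have h1 : (Finset.univ.filter fun j => (B.head e, j) ∈ U).card ≤ U.card := by
          refine Finset.card_le_card_of_injOn (fun j => (B.head e, j))
            (fun j hj => (Finset.mem_filter.1 hj).2) fun j _ j' _ h => congrArg Prod.snd h
        have h2 : (Finset.univ.filter fun j => (B.head e, j) ∈ U).card ≤ k + 1 := by omega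
        exact_mod_cast h2
      have h1 : ((Finset.univ.filter fun j => (B.head e, j) ∈ U).card : ℝ) *
          (2 / n * covCount κ F * Q ^ c) ≤ (k + 1) * (2 / n * covCount κ F * Q ^ c) :=
        mul_le_mul_of_nonneg_right hcardU (by positivity)
      have h2 : ((l.length + 1 : ℕ) : ℝ) * q = Q + q := by
        push_cast
        rw [hQ]
        ring
      -- The first two terms of a binomial expansion; this inequality is what closes the induction
      -- on the length.
      have h3 : Q ^ (c + 1) + q * Q ^ c ≤ (Q + q) ^ (c + 1) := by
        rw [pow_succ (Q + q), pow_succ Q]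
        have h4 : Q ^ c ≤ (Q + q) ^ c := pow_le_pow_left₀ hQ0 (by linarith) c
        nlinarith [mul_le_mul_of_nonneg_right h4 (add_nonneg hQ0 hq0)]
      rw [h2]
      calc (covCount κ F : ℝ) * Q ^ (c + 1) +
            ((Finset.univ.filter fun j => (B.head e, j) ∈ U).card : ℝ) *
              (2 / n * covCount κ F * Q ^ c)
          ≤ covCount κ F * (Q ^ (c + 1) + q * Q ^ c) := by
            rw [hq] at *
            linarith
        _ ≤ _ := mul_le_mul_of_nonneg_left h3 hcov

end BasicKind

/-! ### Strictly non-backtracking closed walks of large order -/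

namespace BasicKind

variable {B : FinGraph.{u}} {κ : BasicKind} {n : ℕ}

/-- The edges and vertices discovered along a walk of the cover, given by its directed edges. -/
theorem exists_explored (σ : Coord B n) (L : List (B.E × Fin n)) :
    ∀ (F : B.E → Finset (Fin n × Fin n)) (U : Finset (B.V × Fin n)) (v : Fin n),
    IsCompatible F → (∀ b, ∀ p ∈ F b, σ.1 b p.1 = p.2) →
    (∀ b, ∀ p ∈ F b, (B.tail b, p.1) ∈ U) →
    L.IsChain (fun x y => B.head x.1 = B.tail y.1 ∧ σ.1 x.1 x.2 = y.2) →
    (∀ x ∈ L.head?, (B.tail x.1, x.2) ∈ U ∧ x.2 = v) →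
    ∃ (F' : B.E → Finset (Fin n × Fin n)) (U' : Finset (B.V × Fin n)),
      (∀ b p, p ∈ F' b ↔ p ∈ F b ∨ ∃ x ∈ L, (b = x.1 ∧ p = (x.2, σ.1 x.1 x.2)) ∨
        (b = B.inv x.1 ∧ p = (σ.1 x.1 x.2, x.2))) ∧
      (∀ w, w ∈ U' ↔ w ∈ U ∨ ∃ x ∈ L, w = (B.head x.1, σ.1 x.1 x.2)) ∧
      ∑ b ∈ B.reps, relMult b (F' b) + U.card =
        ∑ b ∈ B.reps, relMult b (F b) + U'.card + coincidences σ (L.map Prod.fst) v F U := by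
  induction L with
  | nil =>
    intro F U v _ _ _ _ _
    exact ⟨F, U, by simp, by simp, by simp [coincidences]⟩
  | cons x L ih =>
    intro F U v hF hσ hU hL hx
    obtain ⟨hxU, rfl⟩ := hx x (by simp)
    rw [List.isChain_cons] at hL
    have hUhead : ∀ b, ∀ p ∈ F b, (B.head b, p.2) ∈ U := by
      intro b p hp
      have := hU _ _ (hF b p hp)
      rwa [B.tail_inv] at this
    -- A known edge changes no count. A new edge raises the number of edges by one, and with it
    -- either the number of vertices or the number of coincidences.
    by_cases hdet : ∃ p ∈ F x.1, p.1 = x.2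
    · obtain ⟨p, hp, hpx⟩ := hdet
      have hval : σ.1 x.1 x.2 = p.2 := by rw [← hpx, hσ _ _ hp]
      have hpe : p = (x.2, σ.1 x.1 x.2) := Prod.ext hpx hval.symm
      have hmem : (x.2, σ.1 x.1 x.2) ∈ F x.1 := hpe ▸ hp
      obtain ⟨F', U', h1, h2, h3⟩ := ih F U (σ.1 x.1 x.2) hF hσ hU hL.2 (fun y hy => by
        obtain ⟨h1, h2⟩ := hL.1 y hy
        refine ⟨?_, h2.symm⟩
        rw [← h1, ← h2]
        exact hUhead _ _ hmem)
      refine ⟨F', U', fun b p => ?_, fun w => ?_, ?_⟩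
      · rw [h1]
        simp only [List.mem_cons, exists_eq_or_imp]
        constructor
        · rintro (h | h)
          · exact Or.inl h
          · exact Or.inr (Or.inr h)
        · rintro (h | (⟨rfl, rfl⟩ | ⟨rfl, rfl⟩) | h)
          · exact Or.inl h
          · exact Or.inl hmem
          · exact Or.inl (hF _ _ hmem)
          · exact Or.inr h
      · rw [h2]
        simp only [List.mem_cons, exists_eq_or_imp]
        constructor
        · rintro (h | h)
          · exact Or.inl h
          · exact Or.inr (Or.inr h)
        · rintro (h | rfl | h)
          · exact Or.inl h
          · exact Or.inl (hUhead _ _ hmem)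
          · exact Or.inr h
      · rw [List.map_cons, coincidences, if_pos ⟨p, hp, hpx⟩]
        exact h3
    · have hnot : (x.2, σ.1 x.1 x.2) ∉ F x.1 := fun h => hdet ⟨_, h, rfl⟩
      obtain ⟨F', U', h1, h2, h3⟩ := ih (addRel F x.1 x.2 (σ.1 x.1 x.2))
        (insert (B.head x.1, σ.1 x.1 x.2) U) (σ.1 x.1 x.2) (hF.addRel _ _ _)
        (ext_addRel_iff.2 ⟨hσ, rfl⟩) (fun b p hp => by
          rcases mem_addRel.1 hp with h | ⟨rfl, rfl⟩ | ⟨rfl, rfl⟩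
          · exact Finset.mem_insert_of_mem (hU b p h)
          · exact Finset.mem_insert_of_mem hxU
          · rw [B.tail_inv]
            exact Finset.mem_insert_self _ _) hL.2 (fun y hy => by
        obtain ⟨h1, h2⟩ := hL.1 y hy
        refine ⟨?_, h2.symm⟩
        rw [← h1, ← h2]
        exact Finset.mem_insert_self _ _)
      refine ⟨F', U', fun b p => ?_, fun w => ?_, ?_⟩
      · rw [h1, mem_addRel]
        simp only [List.mem_cons, exists_eq_or_imp, or_assoc]
      · rw [h2, Finset.mem_insert]
        simp only [List.mem_cons, exists_eq_or_imp]
        tauto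
      · rw [List.map_cons, coincidences, if_neg hdet]
        rw [sum_relMult_addRel hF hnot] at h3
        split_ifs with hin
        · rw [Finset.insert_eq_of_mem hin] at h3 ⊢
          omega
        · rw [Finset.card_insert_of_notMem hin] at h3
          omega

/-- The visited subgraph of a walk in a cover, as a `B`-graph. -/
def visitedBGraph (σ : Coord B n) {k : ℕ} (w : Fin k → σ.toBGraph.graph.E) : BGraph B where
  graph := σ.toBGraph.graph.visited w
  proj :=
    { onV := fun v => σ.toBGraph.proj.onV v.1
      onE := fun e => σ.toBGraph.proj.onE e.1
      tail_onE := fun _ => rfl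
      head_onE := fun _ => rfl
      inv_onE := fun _ => rfl }

theorem snbc_step (σ : Coord B n) {k : ℕ} {w : Fin (k + 1) → B.E × Fin n}
    (hw : σ.toBGraph.graph.IsSNBC w) (i : Fin (k + 1)) (h : i.1 + 1 < k + 1) :
    B.head (w i).1 = B.tail (w ⟨i.1 + 1, h⟩).1 ∧ σ.1 (w i).1 (w i).2 = (w ⟨i.1 + 1, h⟩).2 := by
  have h1 := (hw i).1
  have h2 : finRotate (k + 1) i = ⟨i.1 + 1, h⟩ := finRotate_of_lt (by omega)
  rw [h2] at h1
  exact ⟨congrArg Prod.fst h1, congrArg Prod.snd h1⟩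

/-- An identity: edges are counted with one unit each, vertices or coincidences balance them, and
the starting vertex, known before any edge, accounts for the `+ 1`. -/
theorem order_visited_lt (σ : Coord B n) {k : ℕ} (w : Fin (k + 1) → B.E × Fin n)
    (hw : σ.toBGraph.graph.IsSNBC w) :
    (σ.toBGraph.graph.visited w).order + 1 =
      coincidences σ ((List.ofFn w).map Prod.fst) (w 0).2 (fun _ => ∅) {(B.tail (w 0).1, (w 0).2)} := by
  have hstep := snbc_step σ hw
  have hchain : (List.ofFn w).IsChain
      (fun x y => B.head x.1 = B.tail y.1 ∧ σ.1 x.1 x.2 = y.2) := by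
    rw [List.isChain_iff_getElem]
    intro i hi
    simp only [List.length_ofFn] at hi
    simp only [List.getElem_ofFn]
    exact hstep ⟨i, by omega⟩ hi
  obtain ⟨F', U', h1, h2, h3⟩ := exists_explored σ (List.ofFn w) (fun _ => ∅)
    {(B.tail (w 0).1, (w 0).2)} (w 0).2 (fun _ _ hp => by simp at hp) (fun _ _ hp => by simp at hp)
    (fun _ _ hp => by simp at hp) hchain (fun x hx => by
      rw [List.ofFn_succ, List.head?_cons] at hx
      obtain rfl := Option.some.inj hx
      exact ⟨by simp, rfl⟩)
  simp only [List.mem_ofFn] at h1 h2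
  let S := visitedBGraph σ w
  have hSE : ∀ x y : S.graph.E, S.proj.onE x = S.proj.onE y → x.1.2 = y.1.2 → x = y :=
    fun x y h h' => Subtype.ext (Prod.ext h h')
  have hS : S.Etale := by
    refine ⟨fun x y hxy h => hSE x y h ?_, fun x y hxy h => hSE x y h ?_⟩
    · exact congrArg (fun z : S.graph.V => (z.1 : B.V × Fin n).2) hxy
    · have h4 : σ.1 x.1.1 x.1.2 = σ.1 y.1.1 y.1.2 :=
        congrArg (fun z : S.graph.V => (z.1 : B.V × Fin n).2) hxy
      have h5 : x.1.1 = y.1.1 := h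
      rw [h5] at h4
      exact (σ.1 y.1.1).injective h4
  let i : S.Labeling n := ⟨fun v => (v.1 : B.V × Fin n).2, fun v v' h h' =>
    Subtype.ext (Prod.ext h h')⟩
  have hrel : ∀ b, i.rel b = F' b := by
    intro b
    ext p
    rw [i.mem_rel, h1]
    simp only [Finset.notMem_empty, false_or, exists_exists_eq_and]
    constructor
    · rintro ⟨⟨x, a, hx | hx⟩, rfl, rfl⟩
      · subst hx
        exact ⟨a, Or.inl ⟨rfl, rfl⟩⟩
      · subst hx
        refine ⟨a, Or.inr ⟨rfl, Prod.ext rfl ?_⟩⟩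
        show σ.1 (B.inv (w a).1) (σ.1 (w a).1 (w a).2) = (w a).2
        simp [σ.2]
    · rintro ⟨a, ⟨rfl, rfl⟩ | ⟨rfl, rfl⟩⟩
      · exact ⟨⟨w a, a, Or.inl rfl⟩, rfl, rfl⟩
      · refine ⟨⟨σ.toBGraph.graph.inv (w a), a, Or.inr rfl⟩, rfl, Prod.ext rfl ?_⟩
        show σ.1 (B.inv (w a).1) (σ.1 (w a).1 (w a).2) = (w a).2
        simp [σ.2]
  have hEdges : ∑ b ∈ B.reps, relMult b (F' b) = S.graph.numEdges := by
    rw [S.numEdges_eq_sum]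
    refine Finset.sum_congr rfl fun b _ => ?_
    rw [← hrel, i.relMult_rel hS]
  have hVert : U'.card = Nat.card S.graph.V := by
    refine card_eq_natCard (fun v : S.graph.V => (v.1 : B.V × Fin n))
      (fun v v' h => Subtype.ext h) fun p => ?_
    rw [h2]
    simp only [Finset.mem_singleton, exists_exists_eq_and]
    constructor
    · rintro (rfl | ⟨a, rfl⟩)
      · exact ⟨⟨_, 0, Or.inl rfl⟩, rfl⟩
      · exact ⟨⟨_, a, Or.inr rfl⟩, rfl⟩
    · rintro ⟨⟨v, a, hv | hv⟩, rfl⟩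
      · rcases a with ⟨a, ha⟩
        rcases a with _ | a
        · exact Or.inl hv
        · refine Or.inr ⟨⟨a, by omega⟩, hv.trans ?_⟩
          obtain ⟨h4, h5⟩ := hstep ⟨a, by omega⟩ ha
          exact (Prod.ext h4 h5).symm
      · exact Or.inr ⟨a, hv⟩
  have hzero : ∑ b ∈ B.reps, relMult b (∅ : Finset (Fin n × Fin n)) = 0 := by
    refine Finset.sum_eq_zero fun b _ => ?_
    rw [relMult]
    simp [diagCount]
  have horder : (σ.toBGraph.graph.visited w).order =
      (S.graph.numEdges : ℤ) - (Nat.card S.graph.V : ℤ) := rfl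
  rw [hEdges, hVert, hzero, Finset.card_singleton] at h3
  rw [horder]
  omega

/-- The word below a strictly non-backtracking closed walk, in the set of all such words. -/
theorem word_mem_of_isSNBC (σ : Coord B n) {k : ℕ} (w : Fin (k + 1) → B.E × Fin n)
    (hw : σ.toBGraph.graph.IsSNBC w) :
    (List.ofFn w).map Prod.fst ∈ B.nbWords k (w 0).1 (w (Fin.last k)).1 := by
  rw [B.mem_nbWords]
  refine ⟨⟨by simp, ?_⟩, by simp [List.ofFn_succ], ?_, by simp⟩
  · rw [List.isChain_iff_getElem]
    intro i hi
    simp only [List.length_map, List.length_ofFn] at hi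
    simp only [List.getElem_map, List.getElem_ofFn]
    have h1 := hw ⟨i, by omega⟩
    have h2 : finRotate (k + 1) ⟨i, by omega⟩ = ⟨i + 1, hi⟩ := finRotate_of_lt (by omega)
    rw [h2] at h1
    refine ⟨congrArg Prod.fst h1.1, fun h => h1.2 (Prod.ext h ?_)⟩
    have h3 := congrArg (fun z : B.V × Fin n => z.2) h1.1
    exact h3
  · rw [List.getLast?_map, List.ofFn_succ', List.concat_eq_append, List.getLast?_append]
    simp

/-- A walk in a cover is determined by the word below it and its starting label. The count over all
atoms is then rearranged as a sum over words and labels. -/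
theorem snbcGE_le (r k : ℕ) :
    ∑ σ ∈ κ.atoms B n, σ.toBGraph.graph.snbcGE r (k + 1) ≤
      ∑ b, ∑ b', ∑ l ∈ B.nbWords k b b', ∑ v : Fin n,
        coinCount κ (fun _ : B.E => ∅) (r + 1) l v {(B.tail b, v)} := by
  have hle : ∀ σ ∈ κ.atoms B n, σ.toBGraph.graph.snbcGE r (k + 1) ≤
      ∑ b, ∑ b', ∑ l ∈ B.nbWords k b b', ∑ v : Fin n,
        if r + 1 ≤ coincidences σ l v (fun _ => ∅) {(B.tail b, v)} then 1 else 0 := by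
    intro σ _
    let T : Finset (Σ _ : B.E, Σ _ : B.E, Σ _ : List B.E, Fin n) :=
      (Finset.univ.sigma fun b => Finset.univ.sigma fun b' => (B.nbWords k b b').sigma fun _ =>
        Finset.univ).filter fun x =>
          r + 1 ≤ coincidences σ x.2.2.1 x.2.2.2 (fun _ => ∅) {(B.tail x.1, x.2.2.2)}
    have hT : T.card = ∑ b, ∑ b', ∑ l ∈ B.nbWords k b b', ∑ v : Fin n,
        if r + 1 ≤ coincidences σ l v (fun _ => ∅) {(B.tail b, v)} then 1 else 0 := by
      rw [Finset.card_filter, Finset.sum_sigma]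
      refine Finset.sum_congr rfl fun b _ => ?_
      rw [Finset.sum_sigma]
      refine Finset.sum_congr rfl fun b' _ => ?_
      rw [Finset.sum_sigma]
    rw [← hT, FinGraph.snbcGE, ← Fintype.card_coe, ← Nat.card_eq_fintype_card]
    change Nat.card {w : Fin (k + 1) → B.E × Fin n // σ.toBGraph.graph.IsSNBC w ∧
      (r : ℤ) ≤ (σ.toBGraph.graph.visited w).order} ≤ _
    refine Nat.card_le_card_of_injective
      (fun w => (⟨⟨(w.1 0).1, (w.1 (Fin.last k)).1, (List.ofFn w.1).map Prod.fst, (w.1 0).2⟩, ?_⟩ : T))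
      fun w w' h => ?_
    · rw [Finset.mem_filter]
      have h1 := order_visited_lt σ w.1 w.2.1
      have h2 := w.2.2
      have h3 := word_mem_of_isSNBC σ w.1 w.2.1
      refine ⟨by simp only [Finset.mem_sigma, Finset.mem_univ, and_true, h3], ?_⟩
      have h4 : (r : ℤ) + 1 ≤ (coincidences σ ((List.ofFn w.1).map Prod.fst) (w.1 0).2 (fun _ => ∅)
          {(B.tail (w.1 0).1, (w.1 0).2)} : ℕ) := by
        rw [← h1]
        exact add_le_add_left h2 1
      exact_mod_cast h4
    · simp only [Subtype.mk.injEq, Sigma.mk.injEq] at h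
      obtain ⟨-, h⟩ := h
      have h := eq_of_heq h
      simp only [Sigma.mk.injEq] at h
      obtain ⟨-, h⟩ := h
      have h := eq_of_heq h
      simp only [Sigma.mk.injEq, heq_eq_eq] at h
      obtain ⟨h1, h2⟩ := h
      rw [List.map_ofFn, List.map_ofFn, List.ofFn_inj] at h1
      have h3 : ∀ i (hi : i < k + 1), w.1 ⟨i, hi⟩ = w'.1 ⟨i, hi⟩ := by
        intro i
        induction i with
        | zero => exact fun hi => Prod.ext (congrFun h1 0) h2
        | succ i ih =>
          intro hi
          refine Prod.ext (congrFun h1 _) ?_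
          rw [← (snbc_step σ w.2.1 ⟨i, by omega⟩ hi).2, ← (snbc_step σ w'.2.1 ⟨i, by omega⟩ hi).2,
            ih]
      exact Subtype.ext (funext fun i => h3 i.1 i.2)
  refine (Finset.sum_le_sum hle).trans (le_of_eq ?_)
  rw [Finset.sum_comm]
  refine Finset.sum_congr rfl fun b _ => ?_
  rw [Finset.sum_comm]
  refine Finset.sum_congr rfl fun b' _ => ?_
  rw [Finset.sum_comm]
  refine Finset.sum_congr rfl fun l _ => ?_
  rw [Finset.sum_comm]
  refine Finset.sum_congr rfl fun v _ => ?_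
  rw [coinCount, Finset.card_filter]
  simp

theorem basicModel_orderBound (hκ : κ.Admissible B) : (basicModel B κ hκ).OrderBound := by
  intro r _
  -- For a given word, `n` starting labels each contribute at most `q ^ (r + 1)` with `q * n = 2 * k
  -- * (k + 1)`; one of the `r + 1` powers of `1 / n` is lost to the choice of the label.
  refine ⟨fun k => (2 * k * (k + 1)) ^ (r + 1) * B.numNBWords k, ?_, ?_⟩
  · refine IsOfGrowth.of_isBigO (B.isOfGrowth_numNBWords.pow_mul B.mu1_nonneg (2 * (r + 1))) ?_
    refine IsBigO.of_bound ((4 : ℝ) ^ (r + 1)) ?_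
    filter_upwards [eventually_ge_atTop 1] with k hk
    have hk' : (1 : ℝ) ≤ k := by exact_mod_cast hk
    have h2 : 2 * (k : ℝ) * (k + 1) ≤ 4 * k ^ 2 := by nlinarith
    rw [Real.norm_of_nonneg (by positivity), Real.norm_of_nonneg (by positivity), ← mul_assoc, pow_mul,
      ← mul_pow]
    gcongr
  · intro n k hk hkn
    obtain ⟨k, rfl⟩ := Nat.exists_eq_add_of_le' hk
    have hn0 : (0 : ℝ) < (n : ℕ) := by exact_mod_cast κ.pos_of_mem_degrees n n.2
    have h4 : 4 * (k + 1) ≤ (n : ℕ) := by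
      have : (4 : ℝ) * ((k + 1 : ℕ) : ℝ) ≤ (n : ℕ) := by linarith
      exact_mod_cast this
    have hA : (0 : ℝ) < (κ.atoms B n).card := by
      exact_mod_cast Finset.card_pos.2 (κ.atoms_nonempty B n n.2)
    rw [basicModel_expect, div_le_iff₀ hA, ← Nat.cast_sum]
    set q : ℝ := ((k + 1 : ℕ) : ℝ) * ((((k + 1 : ℕ) : ℝ) + 1) * (2 / (n : ℕ))) with hq
    have hcoin : ∀ b b' : B.E, ∀ l ∈ B.nbWords k b b', ∀ v : Fin n,
        (coinCount κ (fun _ : B.E => ∅) (r + 1) l v {(B.tail b, v)} : ℝ) ≤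
          (κ.atoms B n).card * q ^ (r + 1) := by
      intro b b' l hl v
      have hlen := ((B.mem_nbWords k b b' l).1 hl).2.2.2
      have h0 : (κ.atoms B n).card = covCount κ fun _ : B.E => (∅ : Finset (Fin n × Fin n)) := by
        simp [covCount]
      have h := coinCount_le hκ n.2 h4 l 0 (r + 1) (fun _ => ∅) {(B.tail b, v)} v (by omega)
        (fun e p hp => by simp at hp) (fun _ => by simp) (by simp)
      rwa [← h0, hlen] at h
    refine (Nat.cast_le.2 (snbcGE_le r k)).trans ?_
    push_cast
    calc (∑ b, ∑ b', ∑ l ∈ B.nbWords k b b', ∑ v : Fin n,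
          (coinCount κ (fun _ : B.E => ∅) (r + 1) l v {(B.tail b, v)} : ℝ))
        ≤ ∑ b, ∑ b', ∑ l ∈ B.nbWords k b b', ∑ v : Fin n,
          ((κ.atoms B n).card * q ^ (r + 1) : ℝ) :=
        Finset.sum_le_sum fun b _ => Finset.sum_le_sum fun b' _ => Finset.sum_le_sum fun l hl =>
          Finset.sum_le_sum fun v _ => hcoin b b' l hl v
      _ = B.numNBWords (k + 1) * ((n : ℕ) * ((κ.atoms B n).card * q ^ (r + 1))) := by
        simp only [Finset.sum_const, Finset.card_univ, Fintype.card_fin, nsmul_eq_mul,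
          FinGraph.numNBWords, Nat.add_sub_cancel, Nat.cast_sum, Finset.sum_mul]
      _ = _ := by
        have hqn : q * (n : ℕ) = 2 * ((k : ℝ) + 1) * ((k : ℝ) + 1 + 1) := by
          rw [hq]
          push_cast
          field_simp
        rw [← hqn, mul_pow q, pow_succ ((n : ℕ) : ℝ)]
        field_simp

end BasicKind

/-! ### Cycles that wrap around a whole-loop -/

namespace BGraph

variable {B : FinGraph.{u}} {S S' : BGraph B} {b : B.E}

/-- A cycle all of whose edges lie over a whole-loop `b`, described by the successor permutation `ν`
of its vertices and the edges `e v` from `v` to `ν v`. -/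
structure IsWrapping (S : BGraph B) (b : B.E) (ν : Equiv.Perm S.graph.V) (e : S.graph.V → S.graph.E) :
    Prop where
  tail_eq : ∀ v, S.graph.tail (e v) = v
  head_eq : ∀ v, S.graph.head (e v) = ν v
  proj_eq : ∀ v, S.proj.onE (e v) = b
  exhaust : ∀ x, x = e (S.graph.tail x) ∨ x = S.graph.inv (e (S.graph.head x))
  isCycleOn : ν.IsCycleOn Set.univ

/-- By étaleness the successor map on the loop set `Z` is injective, hence bijective. All degrees
are two, so at the tail of `z ∈ Z` the only outgoing edges are `z` and the reverse of its
predecessor. By connectedness `Z` and its reverses exhaust the cycle. -/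
theorem exists_isWrapping (hb : B.IsWholeLoop b) (hS : S.Etale) (hc : S.graph.IsCycle)
    (hloop : S.HasLoop b) : ∃ ν e, S.IsWrapping b ν e := by
  obtain ⟨Z, ⟨z₀, hz₀⟩, hZ⟩ := hloop
  choose nx hnx using fun z : Z => (hZ z.1 z.2).2
  have hnx_inj : Function.Injective fun z : Z => (⟨nx z, (hnx z).1⟩ : Z) := by
    intro y z hyz
    have h1 : nx y = nx z := congrArg Subtype.val hyz
    refine Subtype.ext (hS.2 _ _ ?_ ?_)
    · rw [← (hnx y).2, ← (hnx z).2, h1]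
    · rw [(hZ _ y.2).1, (hZ _ z.2).1]
  have hpred : ∀ z ∈ Z, ∃ y ∈ Z, S.graph.head y = S.graph.tail z := by
    intro z hz
    obtain ⟨y, hy⟩ := Finite.surjective_of_injective hnx_inj ⟨z, hz⟩
    refine ⟨y.1, y.2, ?_⟩
    rw [← (hnx y).2]
    exact congrArg (fun x : Z => S.graph.tail x.1) hy
  have hout : ∀ z ∈ Z, ∀ x, S.graph.tail x = S.graph.tail z →
      x = z ∨ ∃ y ∈ Z, x = S.graph.inv y := by
    intro z hz x hx
    obtain ⟨y, hy, hyz⟩ := hpred z hz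
    have hdeg := hc.degree_eq (S.graph.tail z)
    rw [FinGraph.degree, Nat.card_eq_two_iff] at hdeg
    obtain ⟨p, q, -, huniv⟩ := hdeg
    have hall : ∀ t : {t // S.graph.tail t = S.graph.tail z}, t = p ∨ t = q := fun t => by
      have : t ∈ ({p, q} : Set _) := huniv ▸ Set.mem_univ t
      simpa using this
    -- The two outgoing edges differ because they lie over `b` and `inv b`, which are distinct at a
    -- whole-loop.
    have hne : z ≠ S.graph.inv y := by
      intro h
      have h1 := (hZ z hz).1
      rw [h, ← S.proj.inv_onE, (hZ y hy).1] at h1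
      exact hb.1 h1
    have h1 := hall ⟨x, hx⟩
    have h2 := hall ⟨z, rfl⟩
    have h3 := hall ⟨S.graph.inv y, (S.graph.tail_inv y).trans hyz⟩
    have hne' : (⟨z, rfl⟩ : {t // S.graph.tail t = S.graph.tail z}) ≠
        ⟨S.graph.inv y, (S.graph.tail_inv y).trans hyz⟩ := fun h => hne (congrArg Subtype.val h)
    have h4 : (⟨x, hx⟩ : {t // S.graph.tail t = S.graph.tail z}) = ⟨z, rfl⟩ ∨
        (⟨x, hx⟩ : {t // S.graph.tail t = S.graph.tail z}) =
          ⟨S.graph.inv y, (S.graph.tail_inv y).trans hyz⟩ := by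
      grind
    rcases h4 with h4 | h4
    · exact Or.inl (congrArg Subtype.val h4)
    · exact Or.inr ⟨y, hy, congrArg Subtype.val h4⟩
  have hcover : ∀ v, ∃ z ∈ Z, S.graph.tail z = v := by
    intro v
    have hpath := hc.2.1.2 (S.graph.tail z₀) v
    induction hpath with
    | refl => exact ⟨z₀, hz₀, rfl⟩
    | tail _ h ih =>
      obtain ⟨z, hz, rfl⟩ := ih
      obtain ⟨x, hx, rfl⟩ := h
      rcases hout z hz x hx with rfl | ⟨y, hy, rfl⟩
      · exact ⟨nx ⟨x, hz⟩, hnx _⟩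
      · exact ⟨y, hy, (S.graph.head_inv y).symm⟩
  choose e heZ hetail using hcover
  have heproj : ∀ v, S.proj.onE (e v) = b := fun v => (hZ _ (heZ v)).1
  have huniq : ∀ z ∈ Z, z = e (S.graph.tail z) := fun z hz =>
    hS.1 _ _ (hetail _).symm (by rw [heproj, (hZ z hz).1])
  have hinj : Function.Injective fun v => S.graph.head (e v) := by
    intro v w h
    have := hS.2 (e v) (e w) h (by rw [heproj, heproj])
    rw [← hetail v, ← hetail w, this]
  let ν : Equiv.Perm S.graph.V := Equiv.ofBijective _ (Finite.injective_iff_bijective.1 hinj)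
  have hν : ∀ v, ν v = S.graph.head (e v) := fun _ => rfl
  have hex : ∀ x, x = e (S.graph.tail x) ∨ x = S.graph.inv (e (S.graph.head x)) := by
    intro x
    rcases hout (e (S.graph.tail x)) (heZ _) x (hetail _).symm with h | ⟨y, hy, rfl⟩
    · exact Or.inl h
    · right
      rw [S.graph.head_inv, ← huniq y hy]
  refine ⟨ν, e, hetail, fun _ => rfl, heproj, hex, Set.bijOn_univ.2 ν.bijective, fun v _ w _ => ?_⟩
  have hpath := hc.2.1.2 v w
  clear * - hpath hex hν
  induction hpath with
  | refl => exact Equiv.Perm.SameCycle.refl _ _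
  | tail _ h ih =>
    obtain ⟨x, rfl, rfl⟩ := h
    refine ih.trans ?_
    rcases hex x with h | h
    · have h1 : S.graph.head x = ν (S.graph.tail x) := by rw [hν, ← h]
      rw [h1]
      exact Equiv.Perm.sameCycle_apply_right.2 (Equiv.Perm.SameCycle.refl _ _)
    · have h1 : S.graph.tail x = ν (S.graph.head x) := by
        rw [hν, ← S.graph.tail_inv, ← h]
      rw [h1]
      exact Equiv.Perm.sameCycle_apply_left.2 (Equiv.Perm.SameCycle.refl _ _)

/-- Both vertex sets are cyclic orbits of equal size, so `ν ^ m v₀ ↦ ν' ^ m v₀'` is a well-defined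
bijection. The edges follow, those over `b` forwards and the others backwards. -/
theorem IsWrapping.iso (hb : B.IsWholeLoop b) {ν e ν' e'} (h : S.IsWrapping b ν e)
    (h' : S'.IsWrapping b ν' e') (hne : Nonempty S.graph.V) (hne' : Nonempty S'.graph.V)
    (hcard : Nat.card S.graph.V = Nat.card S'.graph.V) : S.Iso S' := by
  obtain ⟨v₀⟩ := hne
  obtain ⟨v₀'⟩ := hne'
  have hc : ν.IsCycleOn ((Finset.univ : Finset S.graph.V) : Set S.graph.V) := by
    simpa using h.isCycleOn
  have hc' : ν'.IsCycleOn ((Finset.univ : Finset S'.graph.V) : Set S'.graph.V) := by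
    simpa using h'.isCycleOn
  have hiff : ∀ m n : ℕ, (ν ^ m) v₀ = (ν ^ n) v₀ ↔ (ν' ^ m) v₀' = (ν' ^ n) v₀' := by
    intro m n
    rw [hc.pow_apply_eq_pow_apply (Finset.mem_univ _), hc'.pow_apply_eq_pow_apply (Finset.mem_univ _),
      Finset.card_univ, Finset.card_univ, ← Nat.card_eq_fintype_card, ← Nat.card_eq_fintype_card, hcard]
  choose i hi using fun v => (hc.exists_pow_eq (Finset.mem_univ v₀) (Finset.mem_univ v))
  let f : S.graph.V → S'.graph.V := fun v => (ν' ^ i v) v₀'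
  have hf : ∀ n : ℕ, f ((ν ^ n) v₀) = (ν' ^ n) v₀' := fun n => (hiff _ _).1 (hi _).2
  have hfν : ∀ v, f (ν v) = ν' (f v) := by
    intro v
    obtain ⟨n, -, rfl⟩ := hc.exists_pow_eq (Finset.mem_univ v₀) (Finset.mem_univ v)
    rw [← Equiv.Perm.mul_apply, ← pow_succ', hf, hf, pow_succ', Equiv.Perm.mul_apply]
  have hfinj : Function.Injective f := by
    intro v w hvw
    rw [← (hi v).2, ← (hi w).2, hiff]
    exact hvw
  have hfsurj : Function.Surjective f := by
    intro v
    obtain ⟨n, -, rfl⟩ := hc'.exists_pow_eq (Finset.mem_univ v₀') (Finset.mem_univ v)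
    exact ⟨_, hf n⟩
  let g : S.graph.E → S'.graph.E := fun x =>
    if S.proj.onE x = b then e' (f (S.graph.tail x)) else S'.graph.inv (e' (f (S.graph.head x)))
  have hinvb : ∀ v, S.proj.onE (S.graph.inv (e v)) ≠ b := by
    intro v
    rw [← S.proj.inv_onE, h.proj_eq]
    exact hb.1
  have hg1 : ∀ v, g (e v) = e' (f v) := by
    intro v
    simp only [g, h.proj_eq, h.tail_eq, if_true]
  have hg2 : ∀ v, g (S.graph.inv (e v)) = S'.graph.inv (e' (f v)) := by
    intro v
    simp only [g, hinvb, S.graph.head_inv, h.tail_eq, if_false]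
  have hcases : ∀ (P : S.graph.E → Prop), (∀ v, P (e v)) → (∀ v, P (S.graph.inv (e v))) → ∀ x, P x := by
    intro P h1 h2 x
    rcases h.exhaust x with hx | hx
    · exact hx ▸ h1 _
    · exact hx ▸ h2 _
  have hprojE : ∀ x, S'.proj.onE (g x) = S.proj.onE x := by
    refine hcases _ (fun v => ?_) fun v => ?_
    · rw [hg1, h'.proj_eq, h.proj_eq]
    · rw [hg2, ← S'.proj.inv_onE, ← S.proj.inv_onE, h'.proj_eq, h.proj_eq]
  have hprojV : ∀ v, S'.proj.onV (f v) = S.proj.onV v := by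
    intro v
    have h1 := S'.proj.tail_onE (e' (f v))
    have h2 := S.proj.tail_onE (e v)
    rw [h'.proj_eq, h'.tail_eq] at h1
    rw [h.proj_eq, h.tail_eq] at h2
    rw [← h1, h2]
  refine ⟨⟨⟨f, g, ?_, ?_, ?_⟩, hfinj, ?_, hprojV, hprojE⟩, hfsurj, ?_⟩
  · refine hcases _ (fun v => ?_) fun v => ?_
    · rw [hg1, h'.tail_eq, h.tail_eq]
    · rw [hg2, S'.graph.tail_inv, S.graph.tail_inv, h'.head_eq, h.head_eq, hfν]
  · refine hcases _ (fun v => ?_) fun v => ?_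
    · rw [hg1, h'.head_eq, h.head_eq, hfν]
    · rw [hg2, S'.graph.head_inv, S.graph.head_inv, h'.tail_eq, h.tail_eq]
  · refine hcases _ (fun v => ?_) fun v => ?_
    · rw [hg1, hg2]
    · rw [hg2, S'.graph.inv_inv, S.graph.inv_inv, hg1]
  · intro x y hxy
    change g x = g y at hxy
    have hpxy : S.proj.onE x = S.proj.onE y := by rw [← hprojE, ← hprojE y, hxy]
    revert x
    refine hcases _ (fun v => ?_) fun v => ?_
    · revert y
      refine hcases _ (fun w hvw _ => ?_) fun w _ hp => ?_
      · rw [hg1, hg1] at hvw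
        have h3 := congrArg S'.graph.tail hvw
        rw [h'.tail_eq, h'.tail_eq] at h3
        rw [hfinj h3]
      · rw [h.proj_eq] at hp
        exact absurd hp.symm (hinvb w)
    · revert y
      refine hcases _ (fun w _ hp => ?_) fun w hvw _ => ?_
      · rw [h.proj_eq] at hp
        exact absurd hp (hinvb v)
      · rw [hg2, hg2] at hvw
        have h3 := congrArg S'.graph.head hvw
        rw [S'.graph.head_inv, S'.graph.head_inv, h'.tail_eq, h'.tail_eq] at h3
        rw [hfinj h3]
  · intro x
    rcases h'.exhaust x with hx | hx
    · obtain ⟨v, hv⟩ := hfsurj (S'.graph.tail x)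
      exact ⟨e v, (hg1 v).trans (by rw [hv, ← hx])⟩
    · obtain ⟨v, hv⟩ := hfsurj (S'.graph.head x)
      exact ⟨S.graph.inv (e v), (hg2 v).trans (by rw [hv, ← hx])⟩

theorem fixE_eq_zero_of_noHalfLoops (h : S.graph.NoHalfLoops) (b : B.E) : S.fixE b = 0 := by
  rw [fixE, Nat.card_eq_zero]
  exact Or.inl ⟨fun x => h _ x.2.2⟩

end BGraph

/-! ### The number of missing cycles -/

namespace BasicKind

variable {B : FinGraph.{u}} {κ : BasicKind}

theorem exists_hasLoop_of_not_occurs (hκ : κ.Admissible B) {S : BGraph B} (hS : S.Etale)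
    (hc : S.graph.IsCycle) (hocc : ¬ (basicModel B κ hκ).Occurs S) :
    ∃ b, B.IsWholeLoop b ∧ S.HasLoop b := by
  rw [occurs_iff_good] at hocc
  by_contra hno
  push Not at hno
  refine hocc ⟨hS, fun b _ => ?_, fun b hb _ => hno b hb⟩
  rw [BGraph.fixE_eq_zero_of_noHalfLoops hc.noHalfLoops]
  exact ⟨fun _ => rfl, zero_le_one⟩

/-- Cycles have no half-loops, so a missing one has a loop over some whole-loop `b` and wraps around
it; its length and `b` determine its isomorphism class. -/
theorem missingCycles_le (hκ : κ.Admissible B) (k : ℕ) :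
    (basicModel B κ hκ).missingCycles k ≤ Nat.card {b : B.E // B.IsWholeLoop b} := by
  rw [Model.missingCycles, ← Nat.card_coe_set_eq]
  choose S hq hS hc hk hocc using fun q : {q : Quot (BGraph.Iso (B := B)) |
    ∃ S : BGraph B, q = Quot.mk _ S ∧ S.Etale ∧ S.graph.IsCycle ∧ S.graph.numEdges = k ∧
      ¬ (basicModel B κ hκ).Occurs S} => q.2
  choose b hb hloop using fun q => exists_hasLoop_of_not_occurs hκ (hS q) (hc q) (hocc q)
  refine Nat.card_le_card_of_injective (fun q => (⟨b q, hb q⟩ : {b : B.E // B.IsWholeLoop b})) ?_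
  intro q q' h
  have hbq : b q = b q' := congrArg Subtype.val h
  obtain ⟨ν, e, h1⟩ := BGraph.exists_isWrapping (hb q) (hS q) (hc q) (hloop q)
  obtain ⟨ν', e', h2⟩ := BGraph.exists_isWrapping (hb q') (hS q') (hc q') (hloop q')
  refine Subtype.ext ?_
  rw [hq q, hq q']
  refine Quot.sound (h1.iso (hb q) (hbq ▸ h2) (hc q).2.1.1 (hc q').2.1.1 ?_)
  have h3 := (hc q).2.2
  have h4 := (hc q').2.2
  rw [FinGraph.order, hk] at h3 h4
  omega

/-- The number is bounded. A bounded function is of growth `sqrt mu1` because a whole-loop forces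
`mu1 ≥ 1`; without whole-loops nothing is missing. -/
theorem basicModel_missingCycles (hκ : κ.Admissible B) :
    IsOfGrowth (fun k => ((basicModel B κ hκ).missingCycles k : ℝ)) (Real.sqrt B.mu1) := by
  by_cases hB : ∃ b, B.IsWholeLoop b
  · obtain ⟨b, hb⟩ := hB
    have h1 : 1 ≤ Real.sqrt B.mu1 := by
      rw [Real.one_le_sqrt]
      exact B.one_le_mu1 hb
    intro ε hε
    refine IsBigO.trans_isLittleO (g := fun _ => (1 : ℝ)) ?_ ?_
    · refine IsBigO.of_bound (Nat.card {b : B.E // B.IsWholeLoop b} : ℝ) (Eventually.of_forall fun k => ?_)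
      rw [Real.norm_of_nonneg (by positivity), norm_one, mul_one]
      exact_mod_cast missingCycles_le hκ k
    · rw [isLittleO_const_left]
      right
      refine tendsto_norm_atTop_atTop.comp (tendsto_pow_atTop_atTop_of_one_lt ?_)
      linarith
  · push Not at hB
    have h0 : ∀ k, (basicModel B κ hκ).missingCycles k = 0 := by
      intro k
      have h := missingCycles_le hκ k
      have : IsEmpty {b : B.E // B.IsWholeLoop b} := ⟨fun b => hB b.1 b.2⟩
      rw [Nat.card_of_isEmpty] at h
      omega
    intro ε _
    simp only [h0, Nat.cast_zero]
    exact isLittleO_zero _ _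

end BasicKind

/-! ### Polynomiality of the expansion coefficients -/

namespace BGraph

variable {B : FinGraph.{u}}

/-- Reduces polynomiality of all coefficients to that of the vertex counts and of the edge
multiplicities. -/
theorem coeff_expansion_mem {ι : Type*} (A : Subalgebra ℝ (ι → ℝ)) (κ : BasicKind) {S : ι → BGraph B}
    (hV : ∀ v, (fun s => ((S s).fibreV v : ℝ)) ∈ A)
    (hE : ∀ e ∈ B.reps, (fun s => ((S s).mult e : ℝ)) ∈ A) (i : ℕ) :
    (fun s => PowerSeries.coeff i ((S s).expansion κ)) ∈ A := by
  refine Subalgebra.coeff_mul_mem A (fun i => Subalgebra.coeff_prod_mem A _ (fun v _ i => ?_) i)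
    (fun i => Subalgebra.coeff_prod_mem A _ (fun e he i => ?_) i) i
  · obtain ⟨p, hp⟩ := exists_polynomial_linBlock 1 0 i
    simp only [hp]
    exact Subalgebra.polynomial_comp_mem A (hV v) p
  · obtain ⟨p, hp⟩ := exists_polynomial_geomBlock (BasicKind.slope e) (κ.shift e) i
    simp only [hp]
    exact Subalgebra.polynomial_comp_mem A (hE e he) p

theorem exists_mvPolynomial_of_mem {ι σ : Type*} {x : ι → σ → ℝ} {f : ι → ℝ}
    (h : f ∈ (MvPolynomial.aeval (R := ℝ) fun j s => x s j).range) :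
    ∃ p : MvPolynomial σ ℝ, ∀ s, f s = p.eval (x s) := by
  obtain ⟨p, rfl⟩ := h
  refine ⟨p, fun s => ?_⟩
  have h := DFunLike.congr_fun (MvPolynomial.comp_aeval (R := ℝ) (fun j s => x s j)
    (Pi.evalAlgHom ℝ (fun _ : ι => ℝ) s)) p
  exact h.trans (DFunLike.congr_fun (MvPolynomial.coe_aeval_eq_eval (x s)) p)

theorem coordinate_mem_range_aeval {ι σ : Type*} (x : ι → σ → ℝ) (j : σ) :
    (fun s => x s j) ∈ (MvPolynomial.aeval (R := ℝ) fun j s => x s j).range :=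
  ⟨MvPolynomial.X j, by simp⟩

theorem isHalfLoop_proj {S : BGraph B} {x : S.graph.E} (hx : S.graph.IsHalfLoop x) :
    B.IsHalfLoop (S.proj.onE x) := by
  have h : S.graph.inv x = x := hx
  rw [FinGraph.IsHalfLoop, S.proj.inv_onE, h]

theorem noHalfLoops_of_fixE_eq_zero {S : BGraph B} (h : ∀ b, B.IsHalfLoop b → S.fixE b = 0) :
    S.graph.NoHalfLoops := by
  intro x hx
  have h1 := h _ (isHalfLoop_proj hx)
  rw [fixE, Finite.card_eq_zero_iff] at h1
  exact h1.false ⟨x, rfl, hx⟩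

end BGraph

namespace BasicKind

variable {B : FinGraph.{u}} {κ : BasicKind}

theorem basicModel_occurs_iff (hκ : κ.Admissible B)
    (hκ' : κ = BasicKind.permutation ∨ κ = BasicKind.permInvEven) (S : BGraph B) :
    (basicModel B κ hκ).Occurs S ↔ S.Etale ∧ S.graph.NoHalfLoops := by
  rw [occurs_iff_good]
  constructor
  · rintro ⟨h1, h2, -⟩
    refine ⟨h1, BGraph.noHalfLoops_of_fixE_eq_zero fun b hb => ?_⟩
    rcases hκ' with rfl | rfl
    · exact absurd hb (hκ b)
    · exact (h2 b hb).1 trivial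
  · rintro ⟨h1, h2⟩
    refine ⟨h1, fun b _ => ?_, fun b _ hc => ?_⟩
    · rw [BGraph.fixE_eq_zero_of_noHalfLoops h2]
      exact ⟨fun _ => rfl, zero_le_one⟩
    · rcases hκ' with rfl | rfl
      · exact hc.elim
      · exact hc.elim

theorem basicModel_isStronglyAlgebraic (hκ : κ.Admissible B)
    (hκ' : κ = BasicKind.permutation ∨ κ = BasicKind.permInvEven) :
    (basicModel B κ hκ).IsStronglyAlgebraic := by
  refine ⟨basicModel_orderBound hκ, BGraph.expansionCoeff κ, basicModel_hasExpansions hκ,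
    basicModel_cycleCoeff hκ, basicModel_occurs_iff hκ hκ', ?_⟩
  -- Without half-loops in `S`, every `mult` is a fixed multiple, one half or one, of `fibreE`.
  let ι := {S : BGraph B // S.graph.NoHalfLoops}
  let x : ι → B.E ⊕ B.V → ℝ := fun S =>
    Sum.elim (fun e => (S.1.fibreE e : ℝ)) fun v => (S.1.fibreV v : ℝ)
  have hmem : ∀ i, (fun S : ι => PowerSeries.coeff i (S.1.expansion κ)) ∈
      (MvPolynomial.aeval (R := ℝ) fun j s => x s j).range := by
    refine BGraph.coeff_expansion_mem _ κ (fun v => BGraph.coordinate_mem_range_aeval x (Sum.inr v))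
      fun e _ => ?_
    have he := BGraph.coordinate_mem_range_aeval x (Sum.inl e)
    by_cases hb : B.IsHalfLoop e
    · have h1 : (fun S : ι => (S.1.mult e : ℝ)) = (1 / 2 : ℝ) • fun S => x S (Sum.inl e) := by
        ext S
        have h2 := S.1.two_mul_mult hb
        rw [BGraph.fixE_eq_zero_of_noHalfLoops S.2, add_zero] at h2
        have h3 : (2 : ℝ) * S.1.mult e = S.1.fibreE e := by exact_mod_cast h2
        simp only [Pi.smul_apply, smul_eq_mul, x, Sum.elim_inl, ← h3]
        ring
      rw [h1]
      exact Subalgebra.smul_mem _ he _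
    · have h1 : (fun S : ι => (S.1.mult e : ℝ)) = fun S => x S (Sum.inl e) := by
        ext S
        rw [BGraph.mult, if_neg hb]
        rfl
      rw [h1]
      exact he
  choose p hp using fun i => BGraph.exists_mvPolynomial_of_mem (hmem i)
  -- The chosen `p 0` is only known to take the value one at the relevant points, while `1` is
  -- required as a polynomial.
  refine ⟨fun i => if i = 0 then 1 else p i, if_pos rfl, fun S hS hS' hocc j i hij => ?_⟩
  have h0 := hS.order_nonneg
  have hN := ((basicModel_occurs_iff hκ hκ' S).1 hocc).2
  rw [BGraph.expansionCoeff, if_neg (by omega), show j - S.graph.order.toNat = i by omega]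
  beta_reduce
  split_ifs with hi
  · rw [hi, BGraph.coeff_zero_expansion, map_one]
  · exact hp i ⟨S, hN⟩

end BasicKind

/-! ### Regular languages of non-backtracking words -/

theorem Set.Finite.range_of_factor {α β γ : Type*} [Nonempty α] {f : α → β} {d : α → γ}
    (hd : (Set.range d).Finite) (h : ∀ x y, d x = d y → f x = f y) : (Set.range f).Finite := by
  refine (hd.image fun z => f (Function.invFun d z)).subset ?_
  rintro _ ⟨x, rfl⟩
  exact ⟨d x, ⟨x, rfl⟩, h _ _ (Function.invFun_eq ⟨x, rfl⟩)⟩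

namespace FinGraph

variable {B : FinGraph.{u}}

/-- The word repeats a single whole-loop. -/
def IsConstWord (B : FinGraph.{u}) (w : List B.E) : Prop :=
  w.IsChain Eq ∧ ∀ c ∈ w, B.IsWholeLoop c

/-- First letter, last letter, and whether the word repeats a single whole-loop. -/
def wordKey (B : FinGraph.{u}) (w : List B.E) : Option B.E × Option B.E × Prop :=
  (w.head?, w.getLast?, B.IsConstWord w)

/-- The non-backtracking words with a given key; if `p` holds, only words that consist of a single
half-loop are admitted. -/
def keyLang (B : FinGraph.{u}) (p : Prop) (key : Option B.E × Option B.E × Prop) : Language B.E :=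
  {w | IsNBWord B w ∧ B.wordKey w = key ∧ (p → ∃ b, B.IsHalfLoop b ∧ w = [b])}

theorem mem_keyLang {p : Prop} {key : Option B.E × Option B.E × Prop} {w : List B.E} :
    w ∈ B.keyLang p key ↔
      IsNBWord B w ∧ B.wordKey w = key ∧ (p → ∃ b, B.IsHalfLoop b ∧ w = [b]) := Iff.rfl

theorem isConstWord_iff {w : List B.E} {b : B.E} (h : w.head? = some b) :
    B.IsConstWord w ↔ B.IsWholeLoop b ∧ w = List.replicate w.length b := by
  rw [IsConstWord, List.isChain_eq_iff_eq_replicate]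
  constructor
  · rintro ⟨h1, h2⟩
    exact ⟨h2 b (List.mem_of_mem_head? h), h1 b h⟩
  · rintro ⟨h1, h2⟩
    refine ⟨fun a ha => ?_, fun c hc => ?_⟩
    · rw [h] at ha
      rwa [← Option.some.inj ha]
    · rw [h2] at hc
      rwa [List.eq_of_mem_replicate hc]

/-- Myhill–Nerode: the left quotient by `x` depends only on finitely many data, namely the first two
letters, the last letter, and whether `x` is non-backtracking and whether it is constant. Two
initial letters are kept in order to recognize words of length one. -/
theorem isRegular_keyLang (p : Prop) (key : Option B.E × Option B.E × Prop) :
    (B.keyLang p key).IsRegular := by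
  refine Language.IsRegular.of_finite_range_leftQuotient (Set.Finite.range_of_factor
    (d := fun x : List B.E => (x.take 2, x.getLast?, x.IsChain B.NBStep, B.IsConstWord x)) ?_ ?_)
  · refine ((List.finite_length_le B.E 2).prod (Set.finite_univ (α := Option B.E × Prop × Prop))).subset ?_
    rintro _ ⟨x, rfl⟩
    exact ⟨by simp, trivial⟩
  · intro x y hxy
    simp only [Prod.mk.injEq, eq_iff_iff] at hxy
    obtain ⟨h1, h2, h3, h4⟩ := hxy
    have htake : ∀ z : List B.E, (x ++ z).take 2 = (y ++ z).take 2 := by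
      intro z
      rcases x with _ | ⟨a, _ | ⟨b, x⟩⟩ <;> rcases y with _ | ⟨c, _ | ⟨d, y⟩⟩ <;> simp_all
    have hhead : ∀ z : List B.E, (x ++ z).head? = (y ++ z).head? := by
      intro z
      have h := congrArg List.head? (htake z)
      simpa [List.head?_take] using h
    have hsingle : ∀ (z : List B.E) b, x ++ z = [b] ↔ y ++ z = [b] := by
      intro z b
      have hs : ∀ l : List B.E, l = [b] ↔ l.take 2 = [b] := by
        rintro (_ | ⟨a, _ | ⟨c, l⟩⟩) <;> simp
      rw [hs, htake, ← hs]
    have hnil : ∀ z : List B.E, x ++ z ≠ [] ↔ y ++ z ≠ [] := by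
      intro z
      rw [← List.isSome_head?, ← List.isSome_head?, hhead]
    ext z
    rw [Language.mem_leftQuotient, Language.mem_leftQuotient, mem_keyLang, mem_keyLang]
    simp only [wordKey, IsNBWord, hsingle, hhead, hnil, List.getLast?_append, List.isChain_append,
      IsConstWord, List.forall_mem_append] at h4 ⊢
    have h5 : ((x.IsChain Eq ∧ z.IsChain Eq ∧ ∀ a ∈ y.getLast?, ∀ b ∈ z.head?, a = b) ∧
        (∀ c ∈ x, B.IsWholeLoop c) ∧ ∀ c ∈ z, B.IsWholeLoop c) =
      ((y.IsChain Eq ∧ z.IsChain Eq ∧ ∀ a ∈ y.getLast?, ∀ b ∈ z.head?, a = b) ∧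
        (∀ c ∈ y, B.IsWholeLoop c) ∧ ∀ c ∈ z, B.IsWholeLoop c) := by
      rw [eq_iff_iff]
      tauto
    rw [h2, h3, h5]

theorem card_filter_isConstWord (k : ℕ) (b b' : B.E) :
    ((B.nbWords k b b').filter fun w => B.IsConstWord w).card =
      if B.IsWholeLoop b ∧ b = b' then 1 else 0 := by
  split_ifs with h
  · obtain ⟨hb, rfl⟩ := h
    rw [Finset.card_eq_one]
    refine ⟨List.replicate (k + 1) b, ?_⟩
    ext w
    rw [Finset.mem_filter, Finset.mem_singleton, mem_nbWords]
    constructor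
    · rintro ⟨⟨-, h1, -, h3⟩, h4⟩
      rw [isConstWord_iff h1, h3] at h4
      exact h4.2
    · rintro rfl
      refine ⟨⟨⟨by simp, List.isChain_replicate_of_rel _ ⟨hb.2, hb.1⟩⟩, by simp [List.replicate_succ], ?_, by simp⟩, ?_⟩
      · rw [List.getLast?_replicate]
        simp
      · rw [isConstWord_iff (b := b) (by simp [List.replicate_succ])]
        exact ⟨hb, by simp⟩
  · rw [Finset.card_eq_zero, Finset.filter_eq_empty_iff]
    intro w hw hc
    rw [mem_nbWords] at hw
    obtain ⟨-, h1, h2, h3⟩ := hw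
    rw [isConstWord_iff h1] at hc
    refine h ⟨hc.1, ?_⟩
    rw [hc.2, List.getLast?_replicate, h3] at h2
    simpa using h2

theorem IsExpSum.const {Λ : Finset ℂ} (h : (1 : ℂ) ∈ Λ) (c : ℂ) : IsExpSum Λ fun _ => c := by
  simpa using IsExpSum.single h one_ne_zero (Polynomial.C c)

/-- The nonempty key fixes the end letters. If `p` holds, the language is a single one-letter word,
an eventually vanishing count. Otherwise the constant words contribute one or nothing for each
length (exponent `1`), and the others are an entry of a power of the Hashimoto matrix minus this. -/
theorem hasExponents_keyLang {p : Prop} {key : Option B.E × Option B.E × Prop} {w₀ : List B.E}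
    (hw₀ : w₀ ∈ B.keyLang p key) {Λ : Finset ℂ} (hspec : ∀ μ ∈ spectrum ℂ B.hashimoto, μ ∈ Λ)
    (hone : (1 : ℂ) ∈ Λ) (hzero : p → (0 : ℂ) ∈ Λ) :
    HasExponents (fun k => (wordCount (B.keyLang p key) k : ℂ)) Λ := by
  obtain ⟨h1, h2, h3⟩ := hw₀
  by_cases hp : p
  · obtain ⟨b, hb, rfl⟩ := h3 hp
    have hL : ∀ w, w ∈ B.keyLang p key ↔ w = [b] := by
      intro w
      constructor
      · rintro ⟨-, h5, h6⟩
        obtain ⟨c, -, rfl⟩ := h6 hp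
        rw [← h2] at h5
        have := congrArg Prod.fst h5
        simpa [wordKey] using this
      · rintro rfl
        exact ⟨h1, h2, h3⟩
    refine IsExpSum.hasExponents (f := fun k => if k = 0 then 1 else 0)
      (IsExpSum.of_eventually_zero (hzero hp) ?_) fun k => ?_
    · filter_upwards [eventually_ge_atTop 1] with k hk
      rw [if_neg (by omega)]
    · simp only [wordCount, hL]
      split_ifs with hk
      · subst hk
        have : {w : List B.E | w = [b] ∧ w.length = 0 + 1} = {[b]} := by
          ext w
          constructor
          · exact fun h => h.1
          · rintro rfl
            exact ⟨rfl, rfl⟩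
        rw [this, Set.ncard_singleton, Nat.cast_one]
      · have : {w : List B.E | w = [b] ∧ w.length = k + 1} = ∅ := by
          ext w
          simp only [Set.mem_ofPred_eq, Set.mem_empty_iff_false, iff_false]
          rintro ⟨rfl, h⟩
          simp at h
          omega
        rw [this, Set.ncard_empty, Nat.cast_zero]
  · obtain ⟨b, hb⟩ : ∃ b, w₀.head? = some b := Option.isSome_iff_exists.1 (List.isSome_head?.2 h1.1)
    obtain ⟨b', hb'⟩ : ∃ b, w₀.getLast? = some b :=
      ⟨_, List.getLast?_eq_some_getLast h1.1⟩
    have hset : ∀ k, {w | w ∈ B.keyLang p key ∧ w.length = k + 1} =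
        ((B.nbWords k b b').filter fun w => B.IsConstWord w ↔ B.IsConstWord w₀ : Finset (List B.E)) := by
      intro k
      ext w
      rw [Finset.coe_filter, Set.mem_ofPred_eq, Set.mem_ofPred_eq, mem_keyLang, mem_nbWords, ← h2]
      simp only [wordKey, Prod.mk.injEq, hb, hb', hp, false_imp_iff, and_true, eq_iff_iff]
      tauto
    have hpow := isExpSum_matrix_pow B.hashimoto Λ hspec b b'
    by_cases hc : B.IsConstWord w₀
    · refine (IsExpSum.const hone (if B.IsWholeLoop b ∧ b = b' then 1 else 0)).hasExponents fun k => ?_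
      simp only [wordCount, hset, Set.ncard_coe_finset, hc, iff_true]
      rw [card_filter_isConstWord]
      split_ifs <;> simp
    · refine (hpow.add (IsExpSum.const hone
        (-if B.IsWholeLoop b ∧ b = b' then 1 else 0))).hasExponents fun k => ?_
      simp only [wordCount, hset, Set.ncard_coe_finset, hc, iff_false]
      have h4 := Finset.card_filter_add_card_filter_not (s := B.nbWords k b b')
        (fun w => B.IsConstWord w)
      rw [card_filter_isConstWord] at h4
      rw [← card_nbWords, ← h4]
      split_ifs <;> simp

end FinGraph

/-! ### Variable-length graphs -/

theorem BGraph.etale_iff {B : FinGraph.{u}} {S : BGraph B} : S.Etale ↔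
    ∀ e e', S.graph.tail e = S.graph.tail e' → S.proj.onE e = S.proj.onE e' → e = e' := by
  refine ⟨fun h => h.1, fun h => ⟨h, fun e e' h1 h2 => ?_⟩⟩
  refine S.graph.inv_involutive.injective (h _ _ ?_ ?_)
  · rwa [S.graph.tail_inv, S.graph.tail_inv]
  · rw [← S.proj.inv_onE, ← S.proj.inv_onE, h2]

namespace IsWording

variable {B T : FinGraph.{u}} {W : T.E → List B.E} (h : IsWording B T W)

/-- The first step along the path replacing `e`. -/
def firstStep (e : T.E) : Step W := ⟨(e, 0), h.length_pos e⟩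

theorem head?_eq (e : T.E) : (W e).head? = some (letter W (h.firstStep e)) := by
  have h0 := h.length_pos e
  rw [List.head?_eq_getElem?, List.getElem?_eq_getElem h0]
  rfl

theorem stepTail_firstStep (e : T.E) : h.stepTail (h.firstStep e) = Sum.inl (T.tail e) := by
  simp [stepTail, firstStep]

theorem stepTail_eq_inl {x : Step W} {t : T.V} (hx : h.stepTail x = Sum.inl t) :
    x = h.firstStep x.1.1 ∧ T.tail x.1.1 = t := by
  unfold stepTail at hx
  split_ifs at hx with h0
  refine ⟨Subtype.ext (Prod.ext rfl ?_), Sum.inl_injective hx⟩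
  change x.1.2 = 0
  omega

theorem posInv_posInv (x : Pos W) : h.posInv (h.posInv x) = x := by
  refine Subtype.ext (Subtype.ext (Prod.ext (T.inv_inv _) ?_))
  have h1 := x.1.2
  simp only [posInv, h.length_inv]
  omega

/-- The generating relation is the graph of an involution, so its classes have at most two elements.
-/
theorem bead_eq_iff {x y : Pos W} : (Quot.mk _ x : h.Bead) = Quot.mk _ y ↔ y = x ∨ y = h.posInv x := by
  constructor
  · intro hxy
    have heqv : Equivalence fun x y : Pos W => y = x ∨ y = h.posInv x := by
      refine ⟨fun _ => Or.inl rfl, ?_, ?_⟩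
      · rintro x y (rfl | rfl)
        · exact Or.inl rfl
        · exact Or.inr (h.posInv_posInv x).symm
      · rintro x y z (rfl | rfl) (rfl | rfl)
        · exact Or.inl rfl
        · exact Or.inr rfl
        · exact Or.inr rfl
        · exact Or.inl (h.posInv_posInv x)
    have h1 := Quot.eqvGen_exact hxy
    exact (heqv.eqvGen_iff).1 (h1.mono fun _ _ => Or.inr)
  · rintro (rfl | rfl)
    · rfl
    · exact Quot.sound rfl

/-- A fixed position would lie on a half-loop of `T`, whose word has one letter and therefore no
intermediate vertex. Each bead thus has exactly two positions. -/
theorem posInv_ne (x : Pos W) : h.posInv x ≠ x := by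
  intro hx
  have h1 : T.inv x.1.1.1 = x.1.1.1 := congrArg (fun y : Pos W => y.1.1.1) hx
  obtain ⟨b, -, hb⟩ := h.half _ h1
  have h2 := x.1.2
  have h3 := x.2
  rw [hb, List.length_singleton] at h2
  omega

theorem stepTail_eq_of_pos {x : Step W} (hx : 0 < x.1.2) : h.stepTail x = Sum.inr (Quot.mk _ ⟨x, hx⟩) :=
  dif_pos hx

theorem nbStep_letter (h : IsWording B T W) (e : T.E) (i : ℕ) (hi : i + 1 < (W e).length) :
    B.NBStep (letter W ⟨(e, i), by simp only; omega⟩) (letter W ⟨(e, i + 1), hi⟩) :=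
  List.isChain_iff_getElem.1 (h.nb e).2 i hi

/-- The head of a step that is not the last one is the tail of the next step. -/
theorem stepTail_stepInv_of_lt (e : T.E) (i : ℕ) (hi : i + 1 < (W e).length) :
    h.stepTail (h.stepInv ⟨(e, i), by simp only; omega⟩) = h.stepTail ⟨(e, i + 1), hi⟩ := by
  rw [h.stepTail_eq_of_pos (x := ⟨(e, i + 1), hi⟩) (by simp only; omega),
    h.stepTail_eq_of_pos (x := h.stepInv ⟨(e, i), by simp only; omega⟩)
      (by simp only [stepInv]; omega)]
  refine congrArg Sum.inr ((h.bead_eq_iff).2 (Or.inr ?_))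
  refine Subtype.ext (Subtype.ext (Prod.ext (T.inv_inv _).symm ?_))
  simp only [posInv, stepInv, h.length_inv]
  omega

theorem stepTail_stepInv_last (e : T.E) (i : ℕ) (hi : i + 1 = (W e).length) :
    h.stepTail (h.stepInv ⟨(e, i), by simp only; omega⟩) = Sum.inl (T.head e) := by
  have h1 : ¬ 0 < (h.stepInv ⟨(e, i), by simp only; omega⟩).1.2 := by
    simp only [stepInv]
    omega
  rw [stepTail, dif_neg h1]
  exact congrArg Sum.inl (T.tail_inv e)

/-- Two steps with the same tail at an intermediate vertex are equal or their letters differ. -/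
theorem eq_of_stepTail_eq_of_pos {x y : Step W} (hx : 0 < x.1.2) (hxy : h.stepTail x = h.stepTail y)
    (hl : letter W x = letter W y) : x = y := by
  have hy : 0 < y.1.2 := by
    by_contra hy
    rw [h.stepTail_eq_of_pos hx, stepTail, dif_neg hy] at hxy
    cases hxy
  rw [h.stepTail_eq_of_pos hx, h.stepTail_eq_of_pos hy] at hxy
  rcases (h.bead_eq_iff).1 (Sum.inr_injective hxy) with h1 | h1
  · exact (congrArg Subtype.val h1).symm
  -- Here `y` is the reverse of the step before `x`, and equal letters would contradict that the
  -- word is non-backtracking.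
  · obtain ⟨⟨e, i⟩, hi⟩ := x
    obtain ⟨i, rfl⟩ : ∃ j, i = j + 1 := ⟨i - 1, by simp only at hx; omega⟩
    have h2 : y = h.stepInv ⟨(e, i), by simp only at hi ⊢; omega⟩ := by
      refine (congrArg Subtype.val h1).trans (Subtype.ext (Prod.ext rfl ?_))
      simp only [posInv, stepInv]
      omega
    rw [h2, letter_stepInv] at hl
    exact absurd hl.symm (h.nbStep_letter e i hi).2

/-- At intermediate vertices étaleness is automatic for non-backtracking words, so only the first
letters at the vertices of `T` matter. -/
theorem vlg_etale_iff : h.vlg.Etale ↔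
    ∀ e e', T.tail e = T.tail e' → (W e).head? = (W e').head? → e = e' := by
  rw [BGraph.etale_iff]
  constructor
  · intro hS e e' h1 h2
    rw [h.head?_eq, h.head?_eq] at h2
    have h3 := hS (h.firstStep e) (h.firstStep e')
      ((h.stepTail_firstStep e).trans ((congrArg Sum.inl h1).trans (h.stepTail_firstStep e').symm))
      (Option.some.inj h2)
    exact congrArg (fun x : Step W => x.1.1) h3
  · intro hT x y hxy hl
    change h.stepTail x = h.stepTail y at hxy
    change letter W x = letter W y at hl
    by_cases hx : 0 < x.1.2
    · exact h.eq_of_stepTail_eq_of_pos hx hxy hl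
    · have h1 : h.stepTail x = Sum.inl (T.tail x.1.1) := dif_neg hx
      obtain ⟨h2, -⟩ := h.stepTail_eq_inl h1
      obtain ⟨h3, h4⟩ := h.stepTail_eq_inl (hxy.symm.trans h1)
      rw [h2, h3] at hl ⊢
      rw [hT x.1.1 y.1.1 h4.symm (by rw [h.head?_eq, h.head?_eq, hl])]

theorem fixE_vlg (b : B.E) :
    h.vlg.fixE b = Nat.card {e : T.E // T.IsHalfLoop e ∧ (W e).head? = some b} := by
  have key : ∀ x : Step W, h.stepInv x = x → T.IsHalfLoop x.1.1 ∧ x = h.firstStep x.1.1 := by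
    intro x hx
    have h1 : T.IsHalfLoop x.1.1 := congrArg (fun y : Step W => y.1.1) hx
    obtain ⟨b, -, hb⟩ := h.half _ h1
    have h2 := x.2
    rw [hb, List.length_singleton] at h2
    refine ⟨h1, Subtype.ext (Prod.ext rfl ?_)⟩
    change x.1.2 = 0
    omega
  refine Nat.card_congr ⟨fun x => ⟨x.1.1.1, (key x.1 x.2.2).1, ?_⟩,
    fun e => ⟨h.firstStep e.1, ?_, ?_⟩, fun x => ?_, fun e => rfl⟩
  · have h1 := x.2.1
    rw [(key x.1 x.2.2).2] at h1
    rw [h.head?_eq]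
    exact congrArg some h1
  · have h1 := e.2.2
    rw [h.head?_eq] at h1
    exact Option.some.inj h1
  · obtain ⟨b, -, hb⟩ := h.half _ e.2.1
    refine Subtype.ext (Prod.ext e.2.1 ?_)
    change (W e.1).length - 1 - 0 = 0
    rw [hb, List.length_singleton]
  · exact Subtype.ext (key x.1 x.2.2).2.symm

/-- A loop set that enters the path of an edge must follow it to its end, since turning back would
use the letter `inv b ≠ b`. Hence from the next edge of `T` on it consists of whole paths, over
words that repeat `b`. -/
theorem hasLoop_vlg_iff {b : B.E} (hb : B.IsWholeLoop b) : h.vlg.HasLoop b ↔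
    ∃ Z : Set T.E, Z.Nonempty ∧ ∀ z ∈ Z, ((W z).head? = some b ∧ B.IsConstWord (W z)) ∧
      ∃ z' ∈ Z, T.tail z' = T.head z := by
  constructor
  · rintro ⟨Z, ⟨⟨⟨e₀, i₀⟩, hi₀⟩, hz₀⟩, hZ⟩
    have hnext : ∀ e i (hi : i + 1 < (W e).length), (⟨(e, i), by simp only; omega⟩ : Step W) ∈ Z →
        (⟨(e, i + 1), hi⟩ : Step W) ∈ Z := by
      intro e i hi hz
      obtain ⟨h1, y, hy, hy'⟩ := hZ _ hz
      have h2 : h.stepTail y = h.stepTail ⟨(e, i + 1), hi⟩ :=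
        Eq.trans hy' (h.stepTail_stepInv_of_lt e i hi)
      have hpos : 0 < (⟨(e, i + 1), hi⟩ : Step W).1.2 := Nat.succ_pos i
      have hypos : 0 < y.1.2 := by
        by_contra h0
        have h3 : h.stepTail y = Sum.inl (T.tail y.1.1) := dif_neg h0
        rw [h.stepTail_eq_of_pos hpos, h3] at h2
        cases h2
      rw [h.stepTail_eq_of_pos hpos, h.stepTail_eq_of_pos hypos] at h2
      rcases (h.bead_eq_iff).1 (Sum.inr_injective h2) with h3 | h3
      · have h4 : y = (⟨(e, i + 1), hi⟩ : Step W) := (congrArg Subtype.val h3).symm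
        exact h4 ▸ hy
      · exfalso
        have h4 : y = h.stepInv ⟨(e, i), by simp only; omega⟩ := by
          have h5 : (⟨y, hypos⟩ : Pos W) = h.posInv ⟨⟨(e, i + 1), hi⟩, hpos⟩ := by
            rw [h3, h.posInv_posInv]
          refine (congrArg Subtype.val h5).trans (Subtype.ext (Prod.ext rfl ?_))
          simp only [posInv, stepInv]
          omega
        have h5 : letter W y = b := (hZ y hy).1
        have h6 : letter W ⟨(e, i), by simp only; omega⟩ = b := h1
        rw [h4, letter_stepInv, h6] at h5
        exact hb.1 h5
    have hall : ∀ e i (hi : i < (W e).length), (⟨(e, i), hi⟩ : Step W) ∈ Z →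
        ∀ j (hj : j < (W e).length), i ≤ j → (⟨(e, j), hj⟩ : Step W) ∈ Z := by
      intro e i hi hz j hj hij
      induction j, hij using Nat.le_induction with
      | base => exact hz
      | succ j _ ih => exact hnext e j hj (ih (by omega))
    have hsucc : ∀ e i (hi : i < (W e).length), (⟨(e, i), hi⟩ : Step W) ∈ Z →
        ∃ e', h.firstStep e' ∈ Z ∧ T.tail e' = T.head e := by
      intro e i hi hz
      obtain ⟨j, hj⟩ : ∃ j, j + 1 = (W e).length := ⟨(W e).length - 1, by omega⟩
      obtain ⟨-, y, hy, hy'⟩ := hZ _ (hall e i hi hz j (by omega) (by omega))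
      have h2 : h.stepTail y = Sum.inl (T.head e) := Eq.trans hy' (h.stepTail_stepInv_last e j hj)
      obtain ⟨h3, h4⟩ := h.stepTail_eq_inl h2
      exact ⟨y.1.1, h3 ▸ hy, h4⟩
    refine ⟨{e | h.firstStep e ∈ Z}, ?_, fun e he => ⟨?_, ?_⟩⟩
    · obtain ⟨e', he', -⟩ := hsucc e₀ i₀ hi₀ hz₀
      exact ⟨e', he'⟩
    · have hfirst : (W e).head? = some b := by
        rw [h.head?_eq]
        exact congrArg some (hZ _ he).1
      refine ⟨hfirst, ?_⟩
      rw [FinGraph.isConstWord_iff hfirst]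
      refine ⟨hb, List.eq_replicate_iff.2 ⟨rfl, fun c hc => ?_⟩⟩
      obtain ⟨j, hj, rfl⟩ := List.getElem_of_mem hc
      exact (hZ _ (hall e 0 (h.length_pos e) he j hj (Nat.zero_le j))).1
    · exact hsucc e 0 (h.length_pos e) he
  · rintro ⟨Z, ⟨z₀, hz₀⟩, hZ⟩
    refine ⟨{x : Step W | x.1.1 ∈ Z}, ⟨h.firstStep z₀, hz₀⟩, ?_⟩
    rintro ⟨⟨e, i⟩, hi⟩ he
    obtain ⟨⟨h1, h2⟩, e', he', hee'⟩ := hZ e he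
    rw [FinGraph.isConstWord_iff h1] at h2
    refine ⟨?_, ?_⟩
    · refine List.eq_of_mem_replicate (n := (W e).length) ?_
      rw [← h2.2]
      exact List.get_mem _ _
    · rcases Nat.lt_or_ge (i + 1) (W e).length with hlt | hge
      · exact ⟨⟨(e, i + 1), hlt⟩, he, (h.stepTail_stepInv_of_lt e i hlt).symm⟩
      · refine ⟨h.firstStep e', he', ?_⟩
        have h3 := h.stepTail_stepInv_last e i (by simp only at hi; omega)
        refine Eq.trans (h.stepTail_firstStep e') (Eq.trans ?_ h3.symm)
        rw [hee']

end IsWording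

/-! ### Vertex counts and order of a variable-length graph -/

namespace BGraph

variable {B : FinGraph.{u}}

theorem sum_fibreE_tail (S : BGraph B) (v : B.V) :
    ∑ b with B.tail b = v, S.fibreE b = Nat.card {x : S.graph.E // B.tail (S.proj.onE x) = v} := by
  rw [Nat.card_eq_fintype_card, Fintype.card_subtype,
    Finset.card_eq_sum_card_fiberwise (f := S.proj.onE) (t := Finset.univ.filter fun b => B.tail b = v)]
  · refine Finset.sum_congr rfl fun b hb => ?_
    rw [fibreE, Nat.card_eq_fintype_card, Fintype.card_subtype, Finset.filter_filter]
    congr 1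
    refine Finset.filter_congr fun x _ => ?_
    rw [Finset.mem_filter] at hb
    constructor
    · rintro rfl
      exact ⟨hb.2, rfl⟩
    · exact fun hx => hx.2
  · intro x hx
    simpa using hx

end BGraph

namespace IsWording

variable {B T : FinGraph.{u}} {W W' : T.E → List B.E}

theorem card_pos_over (h : IsWording B T W) (v : B.V) :
    Nat.card {x : Pos W // B.tail (letter W x.1) = v} =
      2 * Nat.card {β : h.Bead // h.projV (Sum.inr β) = v} := by
  let f : {x : Pos W // B.tail (letter W x.1) = v} → {β : h.Bead // h.projV (Sum.inr β) = v} :=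
    fun x => ⟨Quot.mk _ x.1, x.2⟩
  have : Fintype {β : h.Bead // h.projV (Sum.inr β) = v} := Fintype.ofFinite _
  rw [← Nat.card_congr (Equiv.sigmaFiberEquiv f), Nat.card_sigma, Finset.sum_congr rfl (g := fun _ => 2),
    Finset.sum_const, Finset.card_univ, smul_eq_mul, mul_comm, Nat.card_eq_fintype_card]
  rintro ⟨β, hβ⟩ -
  obtain ⟨x, rfl⟩ := Quot.exists_rep β
  rw [Nat.card_eq_two_iff]
  have hx' : B.tail (letter W (h.posInv x).1) = v := (h.tail_letter_posInv x).trans hβ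
  refine ⟨⟨⟨x, hβ⟩, rfl⟩, ⟨⟨h.posInv x, hx'⟩, Subtype.ext ((h.bead_eq_iff).2 ?_)⟩, ?_, ?_⟩
  · exact Or.inr (h.posInv_posInv x).symm
  · intro heq
    exact h.posInv_ne x (congrArg (fun y => y.1.1) heq).symm
  · ext ⟨⟨y, hy⟩, hyx⟩
    simp only [Set.mem_insert_iff, Set.mem_singleton_iff, Set.mem_univ, iff_true, Subtype.mk.injEq]
    rcases (h.bead_eq_iff).1 (congrArg Subtype.val hyx).symm with h1 | h1
    · exact Or.inl (Subtype.ext h1)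
    · exact Or.inr h1

theorem card_step_over (h : IsWording B T W) (v : B.V) :
    Nat.card {x : Step W // B.tail (letter W x) = v} =
      Nat.card {e : T.E // h.vertexMap (T.tail e) = v} +
        Nat.card {x : Pos W // B.tail (letter W x.1) = v} := by
  rw [← Nat.card_sum]
  symm
  let f : {e : T.E // h.vertexMap (T.tail e) = v} ⊕ {x : Pos W // B.tail (letter W x.1) = v} →
      {x : Step W // B.tail (letter W x) = v} :=
    Sum.elim (fun e => ⟨h.firstStep e.1, (h.tail_first e.1 (h.length_pos e.1)).trans e.2⟩)
      fun x => ⟨x.1.1, x.2⟩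
  refine Nat.card_eq_of_bijective f ⟨?_, ?_⟩
  · rintro (⟨e, he⟩ | ⟨x, hx⟩) (⟨e', he'⟩ | ⟨x', hx'⟩) hf
    · have h1 : e = e' :=
        congrArg (fun y : {x : Step W // B.tail (letter W x) = v} => y.1.1.1) hf
      subst h1
      rfl
    · exfalso
      have h1 : 0 = x'.1.1.2 :=
        congrArg (fun y : {x : Step W // B.tail (letter W x) = v} => y.1.1.2) hf
      have h2 := x'.2
      omega
    · exfalso
      have h1 : x.1.1.2 = 0 :=
        congrArg (fun y : {x : Step W // B.tail (letter W x) = v} => y.1.1.2) hf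
      have h2 := x.2
      omega
    · have h1 : x = x' :=
        Subtype.ext (congrArg (fun y : {x : Step W // B.tail (letter W x) = v} => y.1) hf)
      subst h1
      rfl
  · rintro ⟨⟨⟨e, i⟩, hi⟩, hx⟩
    rcases Nat.eq_zero_or_pos i with rfl | h0
    · exact ⟨Sum.inl ⟨e, (h.tail_first e hi).symm.trans hx⟩, rfl⟩
    · exact ⟨Sum.inr ⟨⟨⟨(e, i), hi⟩, h0⟩, hx⟩, rfl⟩

/-- Count the steps that leave the fibre over `v`: two for each intermediate vertex and one for each
edge of `T` starting there. The vertex count is thus affine in the edge counts, with constants that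
depend only on `vertexMap`. -/
theorem two_mul_fibreV_vlg (h : IsWording B T W) (v : B.V) :
    2 * h.vlg.fibreV v + Nat.card {e : T.E // h.vertexMap (T.tail e) = v} =
      ∑ b with B.tail b = v, h.vlg.fibreE b + 2 * Nat.card {t : T.V // h.vertexMap t = v} := by
  have h1 : h.vlg.fibreV v = Nat.card {t : T.V // h.vertexMap t = v} +
      Nat.card {β : h.Bead // h.projV (Sum.inr β) = v} := by
    rw [← Nat.card_sum]
    exact Nat.card_congr Equiv.subtypeSum
  have h2 : ∑ b with B.tail b = v, h.vlg.fibreE b =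
      Nat.card {x : Step W // B.tail (letter W x) = v} := h.vlg.sum_fibreE_tail v
  rw [h1, h2, h.card_step_over, h.card_pos_over]
  ring

/-- In a pruned graph every vertex is the tail of an edge, and the first letter of its word
determines the vertex below. -/
theorem vertexMap_eq (hT : T.Pruned) (h : IsWording B T W) (h' : IsWording B T W')
    (hW : ∀ e, B.wordKey (W e) = B.wordKey (W' e)) : h.vertexMap = h'.vertexMap := by
  funext t
  have h1 := hT t
  have h2 : Nonempty {e : T.E // T.tail e = t} := by
    by_contra hne
    rw [not_nonempty_iff] at hne
    rw [FinGraph.degree, Nat.card_of_isEmpty] at h1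
    omega
  obtain ⟨e, rfl⟩ := h2
  have h3 : (W e).head? = (W' e).head? := congrArg Prod.fst (hW e)
  rw [h.head?_eq, h'.head?_eq] at h3
  rw [← h.tail_first e (h.length_pos e), ← h'.tail_first e (h'.length_pos e)]
  exact congrArg B.tail (Option.some.inj h3)

theorem fixE_vlg_eq (h : IsWording B T W) (h' : IsWording B T W')
    (hW : ∀ e, B.wordKey (W e) = B.wordKey (W' e)) (b : B.E) : h.vlg.fixE b = h'.vlg.fixE b := by
  have h1 : ∀ e, (W e).head? = (W' e).head? := fun e => congrArg Prod.fst (hW e)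
  rw [fixE_vlg, fixE_vlg]
  simp only [h1]

/-- Étaleness, half-loops and loops over whole-loops of a variable-length graph have all been
expressed by first letters and constancy of words, which the keys contain. -/
theorem good_vlg_iff (h : IsWording B T W) (h' : IsWording B T W')
    (hW : ∀ e, B.wordKey (W e) = B.wordKey (W' e)) (κ : BasicKind) :
    h.vlg.Good κ ↔ h'.vlg.Good κ := by
  have h1 : ∀ e, (W e).head? = (W' e).head? := fun e => congrArg Prod.fst (hW e)
  have h2 : ∀ e, B.IsConstWord (W e) = B.IsConstWord (W' e) := fun e =>
    congrArg (fun z => z.2.2) (hW e)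
  have h3 : ∀ b, B.IsWholeLoop b → (h.vlg.HasLoop b ↔ h'.vlg.HasLoop b) := by
    intro b hb
    rw [h.hasLoop_vlg_iff hb, h'.hasLoop_vlg_iff hb]
    simp only [h1, h2]
  rw [BGraph.Good, BGraph.Good, vlg_etale_iff, vlg_etale_iff]
  simp only [h1, h.fixE_vlg_eq h' hW]
  refine and_congr_right fun _ => and_congr_right fun _ => ?_
  refine forall_congr' fun b => forall_congr' fun hb => ?_
  rw [h3 b hb]

theorem two_mul_order_vlg (h : IsWording B T W) :
    2 * h.vlg.graph.order = ∑ v, (Nat.card {e : T.E // h.vertexMap (T.tail e) = v} : ℤ) -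
      2 * ∑ v, (Nat.card {t : T.V // h.vertexMap t = v} : ℤ) + ∑ b, (h.vlg.fixE b : ℤ) := by
  have h1 := h.vlg.graph.two_mul_numEdges
  have h2 : h.vlg.graph.numDir = ∑ v, ∑ b with B.tail b = v, h.vlg.fibreE b := by
    rw [h.vlg.numDir_eq_sum]
    exact (Finset.sum_fiberwise _ _ _).symm
  have h3 := h.vlg.card_V_eq_sum
  have h4 := h.vlg.numHalf_eq_sum
  have h5 : 2 * Nat.card h.vlg.graph.V + ∑ v, Nat.card {e : T.E // h.vertexMap (T.tail e) = v} =
      h.vlg.graph.numDir + 2 * ∑ v, Nat.card {t : T.V // h.vertexMap t = v} := by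
    rw [h2, h3, Finset.mul_sum, Finset.mul_sum, ← Finset.sum_add_distrib, ← Finset.sum_add_distrib]
    exact Finset.sum_congr rfl fun v _ => h.two_mul_fibreV_vlg v
  rw [FinGraph.order]
  rw [h4] at h1
  zify at h1 h5
  linarith

theorem order_vlg_eq (hT : T.Pruned) (h : IsWording B T W) (h' : IsWording B T W')
    (hW : ∀ e, B.wordKey (W e) = B.wordKey (W' e)) : h.vlg.graph.order = h'.vlg.graph.order := by
  have h1 := h.two_mul_order_vlg
  have h2 := h'.two_mul_order_vlg
  rw [h.vertexMap_eq hT h' hW] at h1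
  simp only [h.fixE_vlg_eq h' hW] at h1
  linarith

/-- Over the wordings of a pruned graph with given keys, the expansion coefficients are polynomials
in the numbers of edges over the edges of the base. -/
theorem exists_mvPolynomial_expansionCoeff (hT : T.Pruned) {W₀ : T.E → List B.E}
    (h₀ : IsWording B T W₀) (κ : BasicKind) : ∃ p : ℕ → MvPolynomial B.E ℝ,
      ∀ (W : T.E → List B.E) (h : IsWording B T W), (∀ e, B.wordKey (W e) = B.wordKey (W₀ e)) →
        ∀ i, BGraph.expansionCoeff κ h.vlg i = (p i).eval fun e => (h.vlg.fibreE e : ℝ) := by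
  let ι := {W : T.E → List B.E // IsWording B T W ∧ ∀ e, B.wordKey (W e) = B.wordKey (W₀ e)}
  let S : ι → BGraph B := fun W => W.2.1.vlg
  let x : ι → B.E → ℝ := fun W e => ((S W).fibreE e : ℝ)
  let A := (MvPolynomial.aeval (R := ℝ) fun j s => x s j).range
  have hx : ∀ e, (fun s => x s e) ∈ A := BGraph.coordinate_mem_range_aeval x
  have hconst : ∀ c : ℝ, (fun _ : ι => c) ∈ A := fun c => A.algebraMap_mem c
  have hmem : ∀ i, (fun s => PowerSeries.coeff i ((S s).expansion κ)) ∈ A := by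
    refine BGraph.coeff_expansion_mem A κ (fun v => ?_) fun e _ => ?_
    · have h1 : (fun s => ((S s).fibreV v : ℝ)) = (1 / 2 : ℝ) • ((∑ b with B.tail b = v, fun s => x s b) -
          (fun _ => (Nat.card {e : T.E // h₀.vertexMap (T.tail e) = v} : ℝ)) +
          fun _ => 2 * (Nat.card {t : T.V // h₀.vertexMap t = v} : ℝ)) := by
        funext s
        have h2 := s.2.1.two_mul_fibreV_vlg v
        rw [s.2.1.vertexMap_eq hT h₀ s.2.2] at h2
        have h3 : (2 : ℝ) * (S s).fibreV v + Nat.card {e : T.E // h₀.vertexMap (T.tail e) = v} =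
          ∑ b with B.tail b = v, x s b + 2 * Nat.card {t : T.V // h₀.vertexMap t = v} := by
          simp only [x]
          exact_mod_cast h2
        simp only [Pi.smul_apply, Pi.add_apply, Pi.sub_apply, Finset.sum_apply, smul_eq_mul]
        linarith
      rw [h1]
      exact A.smul_mem (A.add_mem (A.sub_mem (A.sum_mem fun b _ => hx b) (hconst _)) (hconst _)) _
    · by_cases hb : B.IsHalfLoop e
      · have h1 : (fun s => ((S s).mult e : ℝ)) =
            (1 / 2 : ℝ) • ((fun s => x s e) + fun _ => (h₀.vlg.fixE e : ℝ)) := by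
          funext s
          have h2 := (S s).two_mul_mult hb
          rw [s.2.1.fixE_vlg_eq h₀ s.2.2] at h2
          have h3 : (2 : ℝ) * (S s).mult e = x s e + h₀.vlg.fixE e := by
            simp only [x]
            exact_mod_cast h2
          simp only [Pi.smul_apply, Pi.add_apply, smul_eq_mul]
          linarith
        rw [h1]
        exact A.smul_mem (A.add_mem (hx e) (hconst _)) _
      · have h1 : (fun s => ((S s).mult e : ℝ)) = fun s => x s e := by
          funext s
          rw [BGraph.mult, if_neg hb]
        rw [h1]
        exact hx e
  choose p hp using fun i => BGraph.exists_mvPolynomial_of_mem (hmem i)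
  refine ⟨fun i => if i < h₀.vlg.graph.order.toNat then 0 else p (i - h₀.vlg.graph.order.toNat),
    fun W h hW i => ?_⟩
  rw [BGraph.expansionCoeff, h.order_vlg_eq hT h₀ hW]
  beta_reduce
  split_ifs
  · rw [map_zero]
  · exact hp _ ⟨W, h, hW⟩

end IsWording

/-! ### The types of a pruned graph -/

namespace FinGraph

variable {B : FinGraph.{u}}

theorem IsNBWord.revWord {w : List B.E} (h : IsNBWord B w) : IsNBWord B (revWord B w) := by
  refine ⟨by simpa [_root_.revWord] using h.1, ?_⟩
  rw [_root_.revWord, List.isChain_reverse, List.isChain_map]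
  refine h.2.imp fun a b hab => ⟨?_, fun hba => hab.2 ?_⟩
  · rw [B.head_inv, B.tail_inv, hab.1]
  · rw [B.inv_inv] at hba
    exact hba.symm

theorem isConstWord_revWord_iff {w : List B.E} :
    B.IsConstWord (revWord B w) ↔ B.IsConstWord w := by
  have hloop : ∀ b, B.IsWholeLoop (B.inv b) ↔ B.IsWholeLoop b := by
    intro b
    rw [IsWholeLoop, IsWholeLoop, B.inv_inv, B.head_inv, B.tail_inv]
    exact and_congr ne_comm eq_comm
  rw [IsConstWord, IsConstWord, revWord, List.isChain_reverse, List.isChain_map]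
  simp only [List.mem_reverse, List.mem_map, forall_exists_index, and_imp, forall_apply_eq_imp_iff₂,
    hloop, B.inv_involutive.injective.eq_iff]
  refine and_congr_left fun _ => ?_
  constructor
  · exact fun h => h.imp fun _ _ h => h.symm
  · exact fun h => h.imp fun _ _ h => h.symm

theorem wordKey_revWord {w w' : List B.E} (h : B.wordKey w = B.wordKey w') :
    B.wordKey (revWord B w) = B.wordKey (revWord B w') := by
  simp only [wordKey, Prod.mk.injEq, eq_iff_iff, isConstWord_revWord_iff] at h ⊢
  simp only [revWord, List.head?_reverse, List.getLast?_reverse, List.head?_map, List.getLast?_map]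
  rw [h.1, h.2.1]
  exact ⟨rfl, rfl, h.2.2⟩

end FinGraph

namespace IsWording

variable {B T : FinGraph.{u}} {W₀ : T.E → List B.E}

/-- The type consisting of the wordings with the same keys as a given wording. -/
noncomputable def keyType (h₀ : IsWording B T W₀) : BType B T where
  lang e := B.keyLang (T.IsHalfLoop e) (B.wordKey (W₀ e))
  regular _ := FinGraph.isRegular_keyLang _ _
  nb _ _ hw := hw.1
  rev e w hw := by
    obtain ⟨h1, h2, h3⟩ := hw
    refine ⟨FinGraph.IsNBWord.revWord h1, ?_, fun he => ?_⟩
    · rw [h₀.rev]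
      exact FinGraph.wordKey_revWord h2
    · have he' : T.IsHalfLoop e := by
        have h4 : T.inv (T.inv e) = T.inv e := he
        rw [T.inv_inv] at h4
        exact h4.symm
      obtain ⟨b, hb, rfl⟩ := h3 he'
      refine ⟨b, hb, ?_⟩
      have h4 : B.inv b = b := hb
      simp [revWord, h4]
  wording W hW hrev := by
    refine ⟨fun e => (hW e).1, hrev, fun e => (hW e).2.2, ?_⟩
    obtain ⟨f, hf⟩ := h₀.start
    refine ⟨f, fun e b l he => ?_⟩
    have h1 : (W e).head? = (W₀ e).head? := congrArg Prod.fst (hW e).2.1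
    rw [he, List.head?_cons] at h1
    obtain ⟨l', hl'⟩ := List.head?_eq_some_iff.1 h1.symm
    exact hf e b l' hl'

theorem keyType_contains_iff (h₀ : IsWording B T W₀) {W : T.E → List B.E} (h : IsWording B T W) :
    h₀.keyType.Contains W ↔ ∀ e, B.wordKey (W e) = B.wordKey (W₀ e) :=
  ⟨fun hW e => (hW e).2.1, fun hW e => ⟨h.nb e, hW e, h.half e⟩⟩

theorem eigenvalues_keyType (h₀ : IsWording B T W₀) {μ : ℂ} (hμ : μ ∈ h₀.keyType.eigenvalues) :
    μ ∈ spectrum ℂ B.hashimoto ∨ μ = 1 ∨ (μ = 0 ∧ ∃ e, B.IsHalfLoop e) := by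
  rw [BType.eigenvalues, Set.mem_iUnion] at hμ
  obtain ⟨e, he⟩ := hμ
  have h1 := he (insert 1 (B.spec ∪ if T.IsHalfLoop e then {0} else ∅)) <|
    FinGraph.hasExponents_keyLang (w₀ := W₀ e) ⟨h₀.nb e, rfl, h₀.half e⟩
      (fun μ hμ => by simp [FinGraph.mem_spec, hμ]) (by simp) fun hp => by simp [hp]
  rw [Finset.mem_insert, Finset.mem_union, FinGraph.mem_spec] at h1
  rcases h1 with h1 | h1 | h1
  · exact Or.inr (Or.inl h1)
  · exact Or.inl h1
  · split_ifs at h1 with hp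
    · obtain ⟨b, hb, -⟩ := h₀.half e hp
      exact Or.inr (Or.inr ⟨Finset.mem_singleton.1 h1, b, hb⟩)
    · simp at h1

end IsWording

/-! ### Algebraicity of the basic models -/

namespace BasicKind

variable {B : FinGraph.{u}} {κ : BasicKind}

theorem algebraicOn_keyType (hκ : κ.Admissible B) {T : FinGraph.{u}} (hT : T.Pruned)
    {W₀ : T.E → List B.E} (h₀ : IsWording B T W₀) :
    (basicModel B κ hκ).AlgebraicOn (BGraph.expansionCoeff κ) h₀.keyType.graphs := by
  by_cases hgood : h₀.vlg.Good κ
  · right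
    refine ⟨?_, ?_⟩
    · rintro _ ⟨W, h, hW, rfl⟩
      rw [occurs_iff_good, h.good_vlg_iff h₀ ((h₀.keyType_contains_iff h).1 hW)]
      exact hgood
    · obtain ⟨p, hp⟩ := h₀.exists_mvPolynomial_expansionCoeff hT κ
      refine ⟨p, ?_⟩
      rintro _ ⟨W, h, hW, rfl⟩ i
      exact hp W h ((h₀.keyType_contains_iff h).1 hW) i
  · left
    rintro _ ⟨W, h, hW, rfl⟩
    rw [occurs_iff_good, h.good_vlg_iff h₀ ((h₀.keyType_contains_iff h).1 hW)]
    exact hgood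

theorem basicModel_hasTypes (hκ : κ.Admissible B) :
    (basicModel B κ hκ).HasTypes (BGraph.expansionCoeff κ)
      {μ | μ ∈ spectrum ℂ B.hashimoto ∨ μ = 1 ∨ (μ = 0 ∧ ∃ e, B.IsHalfLoop e)} := by
  intro T hT
  -- Only keys that some wording realizes give types; there are finitely many, and a wording belongs
  -- to the type of its own keys and to no other.
  let K := {τ : T.E → Option B.E × Option B.E × Prop //
    ∃ W, IsWording B T W ∧ ∀ e, B.wordKey (W e) = τ e}
  obtain ⟨s, ⟨f⟩⟩ := Finite.exists_equiv_fin K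
  choose W₀ h₀ hW₀ using fun τ : K => τ.2
  refine ⟨s, fun j => (h₀ (f.symm j)).keyType, fun W hW => ?_, fun j =>
    ⟨algebraicOn_keyType hκ hT _, fun μ hμ => (h₀ (f.symm j)).eigenvalues_keyType hμ⟩⟩
  refine ⟨f ⟨fun e => B.wordKey (W e), W, hW, fun _ => rfl⟩, ?_, fun j hj => ?_⟩
  · beta_reduce
    rw [IsWording.keyType_contains_iff _ hW]
    intro e
    rw [hW₀, Equiv.symm_apply_apply]
  · beta_reduce at hj
    rw [IsWording.keyType_contains_iff _ hW] at hj
    rw [← f.symm_apply_eq]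
    refine Subtype.ext (funext fun e => ?_)
    rw [← hW₀, ← hj]

end BasicKind

theorem mainTheorem7 (B : FinGraph.{u}) (κ : BasicKind) (hκ : κ.Admissible B) :
    (basicModel B κ hκ).IsAlgebraic ∧
    (∃ Λ : Set ℂ,
      (∀ μ ∈ Λ, μ ∈ spectrum ℂ B.hashimoto ∨ μ = 1 ∨ (μ = 0 ∧ ∃ e, B.IsHalfLoop e)) ∧
      (basicModel B κ hκ).IsEigenvalueSet Λ) ∧
    (κ = BasicKind.permutation ∨ κ = BasicKind.permInvEven →
      (basicModel B κ hκ).IsStronglyAlgebraic) := by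
  have htypes := BasicKind.basicModel_hasTypes hκ
  refine ⟨⟨BasicKind.basicModel_orderBound hκ, BasicKind.basicModel_missingCycles hκ,
    BGraph.expansionCoeff κ, basicModel_hasExpansions hκ, basicModel_cycleCoeff hκ,
    fun T hT => ?_⟩, ⟨_, fun _ hμ => hμ, BGraph.expansionCoeff κ,
    basicModel_hasExpansions hκ, basicModel_cycleCoeff hκ, htypes⟩,
    BasicKind.basicModel_isStronglyAlgebraic hκ⟩
  obtain ⟨s, R, h1, h2⟩ := htypes T hT
  exact ⟨s, R, h1, fun j => ⟨(h2 j).1, Set.subset_univ _⟩⟩
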